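/- Arrangements are finite sets of linear hyperplanes in a finite-dimensional real vector space $V$; a $3$-arrangement is one with $\dim V=3$. For an arrangement $\mathcal A$ in $V$ let $L(\mathcal A)$ be the set of all intersections of hyperplanes of $\mathcal A$ (including $V$ as the empty intersection), ordered by reverse inclusion; two arrangements are \emph{lattice equivalent} if these lattices are isomorphic. $\mathcal A$ is \emph{irreducible} if it is not a product, i.e. there is no decomposition $V=V_1\oplus V_2$ with $V_1,V_2\neq 0$ and arrangements $\mathcal A_i$ in $V_i$ such that $\mathcal A=\{H_1\oplus V_2: H_1\in\mathcal A_1\}\cup\{V_1\oplus H_2: H_2\in\mathcal A_2\}$. An element $X\in L(\mathcal A)$ is \emph{modular} if $X+Y\in L(\mathcal A)$ for all $Y\in L(\mathcal A)$; with $\ell=\dim V$, $\mathcal A$ is \emph{supersolvable} if $\bigcap_{H\in\mathcal A}H=0$ and there is a chain $V=X_0\supsetneq X_1\supsetneq\dots\supsetneq X_\ell=0$ of modular elements of $L(\mathcal A)$. $\mathcal A$ is \emph{simplicial} if every connected component of $V\setminus\bigcup_{H\in\mathcal A}H$ is an open simplicial cone, i.e. of the form $\{\sum_i\lambda_i v_i:\lambda_i>0\}$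 for a basis $(v_i)$ of $V$. For $n\ge 3$ let $\mathcal A(2n,1)$ be the arrangement in $\mathbb R^3$ of the $2n$ planes with normal vectors $$\Bigl(-\sin\tfrac{\pi k}{n},\ \cos\tfrac{\pi k}{n},\ 0\Bigr)\quad\text{and}\quad \Bigl(\cos\tfrac{\pi(2k+1)}{n},\ \sin\tfrac{\pi(2k+1)}{n},\ 1\Bigr),\qquad 0\le k\le n-1,$$ and for $m\ge 2$ let $\mathcal A(4m+1,1)=\mathcal A(4m,1)\cup\{(0,0,1)^\perp\}$. Put $\mathcal R(1)=\{\mathcal A(2n,1): n\ge 3\}$ and $\mathcal R(2)=\{\mathcal A(4m+1,1): m\ge 2\}$. \textbf{Theorem.} Every irreducible supersolvable simplicial $3$-arrangement is lattice equivalent to exactly one of the arrangements in $\mathcal R(1)\cup\mathcal R(2)$. Conversely, every $3$-arrangement that is lattice equivalent to an arrangement in $\mathcal R(1)\cup\mathcal R(2)$ (in particular every member of $\mathcal R(1)\cup\mathcal R(2)$ itself) is irreducible, supersolvable and simplicial. -/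

import Mathlib

/-- A (central) arrangement of hyperplanes in a vector space `V`: a finite set of
linear subspaces of codimension one. -/
@[ext]
structure HyperplaneArrangement (K V : Type*) [Field K] [AddCommGroup V] [Module K V] where
  /-- the hyperplanes of the arrangement -/
  hyperplanes : Set (Submodule K V)
  finite_hyperplanes : hyperplanes.Finite
  codim_eq_one : ∀ H ∈ hyperplanes, Module.finrank K (V ⧸ H) = 1

namespace HyperplaneArrangement

section Combinatorics

variable {K V W : Type*} [Field K] [AddCommGroup V] [Module K V] [AddCommGroup W] [Module K W]

/-- The set of all intersections of hyperplanes of `A`; the empty intersection is `V`. -/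
def intersections (A : HyperplaneArrangement K V) : Set (Submodule K V) :=
  {X | ∃ S ⊆ A.hyperplanes, X = sInf S}

/-- The intersection lattice `L(A)`, ordered by reverse inclusion. -/
abbrev IntersectionLattice (A : HyperplaneArrangement K V) : Type _ :=
  (A.intersections)ᵒᵈ

/-- Two arrangements are lattice equivalent if their intersection lattices are isomorphic. -/
def LatticeEquivalent (A : HyperplaneArrangement K V) (B : HyperplaneArrangement K W) : Prop :=
  Nonempty (A.IntersectionLattice ≃o B.IntersectionLattice)

/-- The center `T(A)`, the intersection of all hyperplanes. -/
def center (A : HyperplaneArrangement K V) : Submodule K V :=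
  sInf A.hyperplanes

/-- The rank of `A`, i.e. the codimension of its center. -/
noncomputable def rank (A : HyperplaneArrangement K V) : ℕ :=
  Module.finrank K (V ⧸ A.center)

/-- An element `X` of `L(A)` is modular if `X + Y` lies in `L(A)` for all `Y` in `L(A)`. -/
def IsModular (A : HyperplaneArrangement K V) (X : Submodule K V) : Prop :=
  X ∈ A.intersections ∧ ∀ Y ∈ A.intersections, X ⊔ Y ∈ A.intersections

/-- An arrangement in an `ℓ`-dimensional space is supersolvable if it has rank `ℓ` and there is
a maximal chain `V = X₀ < X₁ < ⋯ < X_ℓ = T(A)` in `L(A)` of modular elements.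
(The order of `L(A)` is reverse inclusion, so the chain is decreasing for inclusion.) -/
def IsSupersolvable (A : HyperplaneArrangement K V) : Prop :=
  A.rank = Module.finrank K V ∧
  ∃ X : Fin (Module.finrank K V + 1) → Submodule K V,
    X 0 = ⊤ ∧ X (Fin.last _) = A.center ∧ StrictAnti X ∧ ∀ i, A.IsModular (X i)

/-- `A` is the product `A₁ × A₂` with respect to an internal direct sum decomposition
`V = V₁ ⊕ V₂`, where `Aᵢ` is an arrangement in `Vᵢ`: the hyperplanes of `A` are the `H₁ ⊕ V₂`
with `H₁ ∈ A₁` and the `V₁ ⊕ H₂` with `H₂ ∈ A₂`. -/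
def IsProduct (A : HyperplaneArrangement K V) {V₁ V₂ : Submodule K V}
    (A₁ : HyperplaneArrangement K V₁) (A₂ : HyperplaneArrangement K V₂) : Prop :=
  IsCompl V₁ V₂ ∧
  A.hyperplanes =
    {H | ∃ H₁ ∈ A₁.hyperplanes, H = H₁.map V₁.subtype ⊔ V₂} ∪
    {H | ∃ H₂ ∈ A₂.hyperplanes, H = V₁ ⊔ H₂.map V₂.subtype}

/-- `A` is reducible if it is a product of two arrangements in non-zero spaces (the factors may
be empty arrangements, but not the `0`-dimensional arrangement). -/
def IsReducible (A : HyperplaneArrangement K V) : Prop :=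
  ∃ (V₁ V₂ : Submodule K V) (A₁ : HyperplaneArrangement K V₁) (A₂ : HyperplaneArrangement K V₂),
    V₁ ≠ ⊥ ∧ V₂ ≠ ⊥ ∧ A.IsProduct A₁ A₂

/-- An arrangement which is not reducible. -/
def IsIrreducible (A : HyperplaneArrangement K V) : Prop :=
  ¬ A.IsReducible

end Combinatorics

section Real

variable {V : Type*} [AddCommGroup V] [Module ℝ V]

/-- The complement of the union of all hyperplanes. -/
def complement (A : HyperplaneArrangement ℝ V) : Set V :=
  {x | ∀ H ∈ A.hyperplanes, x ∉ H}

/-- The chambers of `A`: the connected components of the complement. -/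
def chambers [TopologicalSpace V] (A : HyperplaneArrangement ℝ V) : Set (Set V) :=
  {C | ∃ x ∈ A.complement, C = connectedComponentIn A.complement x}

/-- An open simplicial cone: the set of all linear combinations with positive coefficients of
the vectors of some basis of `V`. -/
def IsOpenSimplicialCone (C : Set V) : Prop :=
  ∃ b : Module.Basis (Fin (Module.finrank ℝ V)) ℝ V, C = {x | ∀ i, 0 < b.repr x i}

/-- `A` is simplicial if every chamber is an open simplicial cone. -/
def IsSimplicial [TopologicalSpace V] (A : HyperplaneArrangement ℝ V) : Prop :=
  ∀ C ∈ A.chambers, IsOpenSimplicialCone C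

end Real

section Series

/-- The linear form `a₀ x₀ + a₁ x₁ + a₂ x₂` on `ℝ³`. -/
noncomputable def form (a : Fin 3 → ℝ) : (Fin 3 → ℝ) →ₗ[ℝ] ℝ :=
  ∑ i, a i • LinearMap.proj i

/-- The plane `a^⊥` in `ℝ³` with normal vector `a`. -/
noncomputable def perp (a : Fin 3 → ℝ) : Submodule ℝ (Fin 3 → ℝ) :=
  LinearMap.ker (form a)

theorem finrank_quotient_perp {a : Fin 3 → ℝ} (ha : a ≠ 0) :
    Module.finrank ℝ ((Fin 3 → ℝ) ⧸ perp a) = 1 := by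
  have hne : form a ≠ 0 := by
    intro h
    apply ha
    funext j
    have hj := LinearMap.congr_fun h (Pi.single j 1)
    simpa [form, Pi.single_apply] using hj
  have hs : Function.Surjective (form a) := LinearMap.surjective hne
  rw [perp, ((form a).quotKerEquivOfSurjective hs).finrank_eq, Module.finrank_self]

/-- `c_n(m) = cos (2 π m / (2 n))`. -/
noncomputable def c (n m : ℕ) : ℝ := Real.cos (2 * Real.pi * m / (2 * n))

/-- `s_n(m) = sin (2 π m / (2 n))`. -/
noncomputable def s (n m : ℕ) : ℝ := Real.sin (2 * Real.pi * m / (2 * n))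

/-- The arrangement `A(2n,1)` in `ℝ³`, with normal vectors `(-s_n(k), c_n(k), 0)` and
`(c_n(2k+1), s_n(2k+1), 1)` for `0 ≤ k < n`. -/
noncomputable def A2n (n : ℕ) : HyperplaneArrangement ℝ (Fin 3 → ℝ) where
  hyperplanes :=
    (fun k : ℕ => perp ![-s n k, c n k, 0]) '' Set.Iio n ∪
    (fun k : ℕ => perp ![c n (2 * k + 1), s n (2 * k + 1), 1]) '' Set.Iio n
  finite_hyperplanes := ((Set.finite_Iio n).image _).union ((Set.finite_Iio n).image _)
  codim_eq_one := by
    rintro H (⟨k, -, rfl⟩ | ⟨k, -, rfl⟩)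
    · apply finrank_quotient_perp
      intro h
      have h0 : s n k = 0 := by simpa using congrFun h 0
      have h1 : c n k = 0 := by simpa using congrFun h 1
      have h2 := Real.sin_sq_add_cos_sq (2 * Real.pi * (k : ℝ) / (2 * (n : ℝ)))
      rw [s] at h0
      rw [c] at h1
      rw [h0, h1] at h2
      norm_num at h2
    · apply finrank_quotient_perp
      intro h
      simpa using congrFun h 2

/-- The arrangement `A(4m+1,1) = A(4m,1) ∪ {(0,0,1)^⊥}` in `ℝ³`. -/
noncomputable def A4m1 (m : ℕ) : HyperplaneArrangement ℝ (Fin 3 → ℝ) where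
  hyperplanes := (A2n (2 * m)).hyperplanes ∪ {perp ![0, 0, 1]}
  finite_hyperplanes := (A2n (2 * m)).finite_hyperplanes.union (Set.finite_singleton _)
  codim_eq_one := by
    rintro H (h | rfl)
    · exact (A2n (2 * m)).codim_eq_one H h
    · apply finrank_quotient_perp
      intro h
      simpa using congrFun h 2

/-- The infinite series `R(1) = {A(2n,1) | n ≥ 3}`. -/
def R1 : Set (HyperplaneArrangement ℝ (Fin 3 → ℝ)) := {B | ∃ n : ℕ, 3 ≤ n ∧ B = A2n n}

/-- The infinite series `R(2) = {A(4m+1,1) | m ≥ 2}`. -/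
def R2 : Set (HyperplaneArrangement ℝ (Fin 3 → ℝ)) := {B | ∃ m : ℕ, 2 ≤ m ∧ B = A4m1 m}

end Series

end HyperplaneArrangement

namespace HyperplaneArrangement

open Module

/-! ### Incidence of planes determines the intersection lattice -/

section Incidence

variable {K V W : Type*} [Field K] [AddCommGroup V] [Module K V] [AddCommGroup W] [Module K W]

/-! In dimension three, supersolvability gives a modular line X. It lies in n of the planes, the
vertical ones, and any two of the other planes meet inside a vertical one (`ModularLine`). Take X as
the z-axis. The other planes are then graphs of linear forms, and their heights over the unit circle
are sinusoids a cos θ + b sin θ (`Fan`). Two of them cross only over vertical planes, once in each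
half turn. So over the sector between two consecutive vertical planes the graphs are linearly
ordered, and passing a vertical plane reverses each group of graphs that meet over it. This is a
`SortSystem`.

The chambers over a sector lie below all graphs, above all graphs, or between two adjacent ones. The
first two kinds are always simplicial. A chamber between adjacent graphs has four walls unless the
graphs meet over a side of the sector. Hence simplicial means `NeighboursMeet`.

Call c a cut over a vertical plane if the c lowest graphs are separated there from the others.
Adjacent graphs meet over exactly one side of their sector, so each interior position is alternately
a cut and not a cut (`isCut_succ`). If two neighbouring positions are cuts at the same times, the
graph between them keeps its rank forever. Half a turn reverses the order, so this is the middle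
graph (`eq_middle_of_not`). Everywhere else neighbouring positions have opposite status. Thus all
cuts are determined by the number of graphs, by whether there is such an exceptional middle
(`HasMiddle`), and by a phase that a shift of time by one step changes. The cuts and the initial
order determine the whole system, including n (`exists_equiv`), and the lattice only records which
graphs meet over which vertical plane. So an arrangement is lattice equivalent to the model with the
same invariants: A(2n,1) without a middle, A(4m+1,1) with one. Irreducibility is used only to obtain
three vertical planes and two graphs.

Conversely, a lattice equivalence transports the modular line of a model, from which irreducibility
and supersolvability are read off. Simpliciality is a count. Adjacent graphs meet over at most one
side of each sector, which bounds the total number of coincidences. Since every pair meets once per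
half turn and the oblique planes of the models have no triple lines, the bound is attained, and this
forces `NeighboursMeet`. The number of planes, 2n or 4m + 1, tells the models apart. -/

theorem finrank_hyperplane (A : HyperplaneArrangement K V) (hV : finrank K V = 3)
    {H : Submodule K V} (hH : H ∈ A.hyperplanes) : finrank K H = 2 := by
  have : FiniteDimensional K V := FiniteDimensional.of_finrank_pos (by omega)
  have h1 := A.codim_eq_one H hH
  have h2 := H.finrank_quotient_add_finrank
  omega

theorem hyperplane_ne_top (A : HyperplaneArrangement K V)
    {H : Submodule K V} (hH : H ∈ A.hyperplanes) : H ≠ ⊤ := by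
  rintro rfl
  have h1 := A.codim_eq_one _ hH
  have : finrank K (V ⧸ (⊤ : Submodule K V)) = 0 := by
    have : Subsingleton (V ⧸ (⊤ : Submodule K V)) := Submodule.Quotient.subsingleton_iff.2 rfl
    exact finrank_zero_of_subsingleton
  omega

theorem eq_top_of_hyperplane_lt (A : HyperplaneArrangement K V) (hV : finrank K V = 3)
    {H Y : Submodule K V} (hH : H ∈ A.hyperplanes) (h : H < Y) : Y = ⊤ := by
  have : FiniteDimensional K V := FiniteDimensional.of_finrank_pos (by omega)
  have h1 := A.finrank_hyperplane hV hH
  have h2 := Submodule.finrank_lt_finrank_of_lt h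
  have h3 := Submodule.finrank_le Y
  exact Submodule.eq_top_of_finrank_eq (by omega)

theorem eq_of_hyperplane_le (A : HyperplaneArrangement K V) (hV : finrank K V = 3)
    {H H' : Submodule K V} (hH : H ∈ A.hyperplanes) (hH' : H' ∈ A.hyperplanes) (h : H ≤ H') :
    H = H' := by
  rcases h.eq_or_lt with h | h
  · exact h
  · exact absurd (A.eq_top_of_hyperplane_lt hV hH h) (A.hyperplane_ne_top hH')

theorem finrank_inf_hyperplane (A : HyperplaneArrangement K V) (hV : finrank K V = 3)
    {H H' : Submodule K V} (hH : H ∈ A.hyperplanes) (hH' : H' ∈ A.hyperplanes) (h : H ≠ H') :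
    finrank K (H ⊓ H' : Submodule K V) = 1 := by
  have : FiniteDimensional K V := FiniteDimensional.of_finrank_pos (by omega)
  have h1 := A.finrank_hyperplane hV hH
  have h2 := A.finrank_hyperplane hV hH'
  have h3 := Submodule.finrank_sup_add_finrank_inf_eq H H'
  have h4 : H ⊔ H' = ⊤ := A.eq_top_of_hyperplane_lt hV hH
    (lt_of_le_of_ne le_sup_left fun e => h (A.eq_of_hyperplane_le hV hH' hH (by
      rw [e]; exact le_sup_right)).symm)
  rw [h4, finrank_top] at h3
  omega

theorem inf_inf_eq_bot_of_not_le (A : HyperplaneArrangement K V) (hV : finrank K V = 3)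
    {H₁ H₂ H₃ : Submodule K V} (h₁ : H₁ ∈ A.hyperplanes) (h₂ : H₂ ∈ A.hyperplanes)
    (h : H₁ ≠ H₂) (h' : ¬ H₁ ⊓ H₂ ≤ H₃) : H₁ ⊓ H₂ ⊓ H₃ = ⊥ := by
  have : FiniteDimensional K V := FiniteDimensional.of_finrank_pos (by omega)
  have h3 := A.finrank_inf_hyperplane hV h₁ h₂ h
  have h4 : H₁ ⊓ H₂ ⊓ H₃ < H₁ ⊓ H₂ := lt_of_le_of_ne inf_le_left fun e => h' (by
    rw [← e]; exact inf_le_right)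
  have h5 := Submodule.finrank_lt_finrank_of_lt h4
  exact Submodule.finrank_eq_zero.1 (by omega)

/-- In dimension three an intersection is already reached by at most three of its planes: one if it
is a plane, two if it is a line, three if it is zero. So the question reduces to which pairs of
planes meet inside which third plane. -/
theorem sInf_le_hyperplane_iff (A : HyperplaneArrangement K V) (hV : finrank K V = 3)
    {S : Set (Submodule K V)} (hS : S ⊆ A.hyperplanes) {H : Submodule K V}
    (hH : H ∈ A.hyperplanes) :
    sInf S ≤ H ↔ H ∈ S ∨ (∃ H₁ ∈ S, ∃ H₂ ∈ S, H₁ ≠ H₂ ∧ H₁ ⊓ H₂ ≤ H) ∨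
      ∃ H₁ ∈ S, ∃ H₂ ∈ S, ∃ H₃ ∈ S, H₁ ≠ H₂ ∧ ¬ H₁ ⊓ H₂ ≤ H₃ := by
  constructor
  · intro h
    by_cases h2 : ∃ H₁ ∈ S, ∃ H₂ ∈ S, H₁ ≠ H₂
    · obtain ⟨H₁, h₁, H₂, h₂, hne⟩ := h2
      by_cases h3 : ∃ H₃ ∈ S, ¬ H₁ ⊓ H₂ ≤ H₃
      · obtain ⟨H₃, h₃, h3⟩ := h3
        exact Or.inr (Or.inr ⟨H₁, h₁, H₂, h₂, H₃, h₃, hne, h3⟩)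
      · push Not at h3
        exact Or.inr (Or.inl ⟨H₁, h₁, H₂, h₂, hne, (le_sInf h3).trans h⟩)
    · push Not at h2
      rcases S.eq_empty_or_nonempty with rfl | ⟨H₁, h₁⟩
      · simp only [sInf_empty, top_le_iff] at h
        exact absurd h (A.hyperplane_ne_top hH)
      · have : S = {H₁} := by
          ext H'
          exact ⟨fun h' => (h2 _ h₁ _ h').symm, fun h' => by rw [h']; exact h₁⟩
        subst this
        rw [sInf_singleton] at h
        left
        rw [A.eq_of_hyperplane_le hV (hS h₁) hH h]
        rfl
  · rintro (h | ⟨H₁, h₁, H₂, h₂, -, h⟩ | ⟨H₁, h₁, H₂, h₂, H₃, h₃, hne, h⟩)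
    · exact sInf_le h
    · exact (le_inf (sInf_le h₁) (sInf_le h₂)).trans h
    · have h0 := A.inf_inf_eq_bot_of_not_le hV (hS h₁) (hS h₂) hne h
      have : sInf S ≤ ⊥ := by
        rw [← h0]
        exact le_inf (le_inf (sInf_le h₁) (sInf_le h₂)) (sInf_le h₃)
      exact this.trans bot_le

theorem sInf_image_le_iff (A : HyperplaneArrangement K V) (hV : finrank K V = 3)
    {I : Type*} {P : I → Submodule K V} (hP : P.Injective) (hPA : Set.range P = A.hyperplanes)
    (T : Set I) (k : I) :
    sInf (P '' T) ≤ P k ↔ k ∈ T ∨ (∃ i ∈ T, ∃ j ∈ T, i ≠ j ∧ P i ⊓ P j ≤ P k) ∨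
      ∃ i ∈ T, ∃ j ∈ T, ∃ l ∈ T, i ≠ j ∧ ¬ P i ⊓ P j ≤ P l := by
  rw [A.sInf_le_hyperplane_iff hV (by rw [← hPA]; exact Set.image_subset_range _ _)
    (by rw [← hPA]; exact Set.mem_range_self _)]
  simp only [Set.exists_mem_image, hP.mem_set_image, hP.ne_iff]

theorem mem_intersections_iff (A : HyperplaneArrangement K V) {I : Type*} {P : I → Submodule K V}
    (hPA : Set.range P = A.hyperplanes) {X : Submodule K V} :
    X ∈ A.intersections ↔ X = sInf (P '' {i | X ≤ P i}) := by
  constructor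
  · rintro ⟨S, hS, rfl⟩
    apply le_antisymm
    · apply le_sInf
      rintro _ ⟨i, hi, rfl⟩
      exact hi
    · apply le_sInf
      intro H hH
      obtain ⟨i, rfl⟩ : H ∈ Set.range P := by rw [hPA]; exact hS hH
      exact sInf_le ⟨i, sInf_le hH, rfl⟩
  · intro h
    exact ⟨_, by rw [← hPA]; exact Set.image_subset_range _ _, h⟩

/-- A lattice element is recovered from the set of planes containing it, and the incidences of pairs
decide which planes contain a given intersection. -/
theorem latticeEquivalent_of_incidence {A : HyperplaneArrangement K V}
    {B : HyperplaneArrangement K W} (hV : finrank K V = 3) (hW : finrank K W = 3)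
    {I : Type*} {P : I → Submodule K V} {Q : I → Submodule K W} (hP : P.Injective)
    (hQ : Q.Injective) (hPA : Set.range P = A.hyperplanes) (hQB : Set.range Q = B.hyperplanes)
    (h : ∀ i j k, i ≠ j → (P i ⊓ P j ≤ P k ↔ Q i ⊓ Q j ≤ Q k)) : A.LatticeEquivalent B := by
  have key : ∀ (T : Set I) (k : I), sInf (P '' T) ≤ P k ↔ sInf (Q '' T) ≤ Q k := by
    intro T k
    rw [A.sInf_image_le_iff hV hP hPA, B.sInf_image_le_iff hW hQ hQB]
    refine or_congr Iff.rfl (or_congr ?_ ?_)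
    · exact exists_congr fun i => and_congr_right fun _ => exists_congr fun j =>
        and_congr_right fun _ => and_congr_right fun hne => h i j k hne
    · exact exists_congr fun i => and_congr_right fun _ => exists_congr fun j =>
        and_congr_right fun _ => exists_congr fun l => and_congr_right fun _ =>
        and_congr_right fun hne => not_congr (h i j l hne)
  -- An element goes to the intersection of the planes on the other side whose indices belong to the
  -- planes containing it.
  have e : A.intersections ≃o B.intersections :=
    { toFun := fun X => ⟨sInf (Q '' {i | X.1 ≤ P i}),
        _, by rw [← hQB]; exact Set.image_subset_range _ _, rfl⟩
      invFun := fun Y => ⟨sInf (P '' {i | Y.1 ≤ Q i}),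
        _, by rw [← hPA]; exact Set.image_subset_range _ _, rfl⟩
      left_inv := by
        rintro ⟨X, hX⟩
        apply Subtype.ext
        have hX' := (A.mem_intersections_iff hPA).1 hX
        simp only [← key]
        rw [← hX', ← hX']
      right_inv := by
        rintro ⟨Y, hY⟩
        apply Subtype.ext
        have hY' := (B.mem_intersections_iff hQB).1 hY
        simp only [key]
        rw [← hY', ← hY']
      map_rel_iff' := by
        rintro ⟨X, hX⟩ ⟨Y, hY⟩
        have hX' := (A.mem_intersections_iff hPA).1 hX
        have hY' := (A.mem_intersections_iff hPA).1 hY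
        change sInf (Q '' {i | X ≤ P i}) ≤ sInf (Q '' {i | Y ≤ P i}) ↔ X ≤ Y
        constructor
        · intro hle
          rw [hY']
          apply le_sInf
          rintro _ ⟨i, hi, rfl⟩
          rw [hX', key]
          exact hle.trans (sInf_le ⟨i, hi, rfl⟩)
        · intro hle
          apply sInf_le_sInf
          apply Set.image_mono
          intro i hi
          exact hle.trans hi }
  exact ⟨e.dual⟩

theorem hyperplane_mem_intersections (A : HyperplaneArrangement K V) {H : Submodule K V}
    (hH : H ∈ A.hyperplanes) : H ∈ A.intersections :=
  ⟨{H}, by simpa using hH, by simp⟩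

theorem top_mem_intersections (A : HyperplaneArrangement K V) : ⊤ ∈ A.intersections :=
  ⟨∅, by simp, by simp⟩

theorem inf_mem_intersections (A : HyperplaneArrangement K V) {X Y : Submodule K V}
    (hX : X ∈ A.intersections) (hY : Y ∈ A.intersections) : X ⊓ Y ∈ A.intersections := by
  obtain ⟨S, hS, rfl⟩ := hX
  obtain ⟨T, hT, rfl⟩ := hY
  exact ⟨S ∪ T, Set.union_subset hS hT, sInf_union.symm⟩

theorem center_mem_intersections (A : HyperplaneArrangement K V) : A.center ∈ A.intersections :=
  ⟨A.hyperplanes, subset_rfl, rfl⟩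

/-- For inclusion, the hyperplanes are the coatoms of the set of intersections, a property that
every order isomorphism respects. -/
theorem mem_hyperplanes_iff_order (A : HyperplaneArrangement K V) (hV : finrank K V = 3)
    (X : A.intersections) :
    X.1 ∈ A.hyperplanes ↔ (∃ Y, X < Y) ∧ ∀ Y, X < Y → IsMax Y := by
  constructor
  · intro hX
    refine ⟨⟨⟨⊤, A.top_mem_intersections⟩, ?_⟩, ?_⟩
    · exact Subtype.mk_lt_mk.2 (lt_top_iff_ne_top.2 (A.hyperplane_ne_top hX))
    · rintro Y hY Z -
      have : Y.1 = ⊤ := A.eq_top_of_hyperplane_lt hV hX hY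
      change Z.1 ≤ Y.1
      rw [this]
      exact le_top
  · rintro ⟨⟨Y, hY⟩, h⟩
    obtain ⟨X, S, hS, rfl⟩ := X
    rcases S.eq_empty_or_nonempty with rfl | ⟨H, hH⟩
    · exfalso
      have : sInf ∅ < Y.1 := hY
      simp at this
    · have hle : sInf S ≤ H := sInf_le hH
      rcases hle.eq_or_lt with h1 | h1
      · change sInf S ∈ _
        rw [h1]
        exact hS hH
      · exfalso
        have hm := h ⟨H, A.hyperplane_mem_intersections (hS hH)⟩ h1
        have h2 : (⊤ : Submodule K V) ≤ H :=
          hm (b := ⟨⊤, A.top_mem_intersections⟩) (show H ≤ ⊤ from le_top)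
        exact A.hyperplane_ne_top (hS hH) (top_le_iff.1 h2)

/-- Converse of `latticeEquivalent_of_incidence`: the isomorphism sends hyperplanes to hyperplanes
and meets to meets, so a labelling of the planes of B can be carried over to A. -/
theorem LatticeEquivalent.exists_incidence {A : HyperplaneArrangement K V}
    {B : HyperplaneArrangement K W} (hAB : A.LatticeEquivalent B) (hV : finrank K V = 3)
    (hW : finrank K W = 3) {I : Type*} {Q : I → Submodule K W} (hQ : Q.Injective)
    (hQB : Set.range Q = B.hyperplanes) :
    ∃ P : I → Submodule K V, P.Injective ∧ Set.range P = A.hyperplanes ∧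
      ∀ i j k, P i ⊓ P j ≤ P k ↔ Q i ⊓ Q j ≤ Q k := by
  obtain ⟨e'⟩ := hAB
  let e : B.intersections ≃o A.intersections := e'.symm.dual
  have hyp : ∀ X : B.intersections, X.1 ∈ B.hyperplanes ↔ (e X).1 ∈ A.hyperplanes := by
    intro X
    rw [B.mem_hyperplanes_iff_order hW, A.mem_hyperplanes_iff_order hV]
    refine and_congr ?_ ?_
    · constructor
      · rintro ⟨Y, hY⟩
        exact ⟨e Y, e.lt_iff_lt.2 hY⟩
      · rintro ⟨Y, hY⟩
        exact ⟨e.symm Y, by rwa [← e.lt_iff_lt, e.apply_symm_apply]⟩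
    · constructor
      · intro h Y hY Z hZ
        have h1 := h (e.symm Y) (by rwa [← e.lt_iff_lt, e.apply_symm_apply])
          (b := e.symm Z) (e.symm.monotone hZ)
        simpa using h1
      · intro h Y hY Z hZ
        have h1 := h (e Y) (e.lt_iff_lt.2 hY) (b := e Z) (e.monotone hZ)
        simpa using h1
  have hQmem : ∀ i, Q i ∈ B.hyperplanes := fun i => by rw [← hQB]; exact Set.mem_range_self _
  let q : I → B.intersections := fun i => ⟨Q i, B.hyperplane_mem_intersections (hQmem i)⟩
  refine ⟨fun i => (e (q i)).1, ?_, ?_, ?_⟩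
  · intro i j hij
    have h1 : q i = q j := e.injective (Subtype.ext hij)
    exact hQ (congrArg Subtype.val h1)
  · apply Set.Subset.antisymm
    · rintro _ ⟨i, rfl⟩
      exact (hyp (q i)).1 (hQmem i)
    · intro H hH
      let X : A.intersections := ⟨H, A.hyperplane_mem_intersections hH⟩
      have h1 : (e.symm X).1 ∈ B.hyperplanes := by
        rw [hyp, e.apply_symm_apply]
        exact hH
      rw [← hQB] at h1
      obtain ⟨i, hi⟩ := h1
      refine ⟨i, ?_⟩
      have h2 : q i = e.symm X := Subtype.ext hi
      simp only [h2, e.apply_symm_apply]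
      rfl
  · intro i j k
    constructor
    · intro h
      let Y : B.intersections := ⟨Q i ⊓ Q j, B.inf_mem_intersections (q i).2 (q j).2⟩
      have h1 : e Y ≤ e (q i) := e.monotone (show Q i ⊓ Q j ≤ Q i from inf_le_left)
      have h2 : e Y ≤ e (q j) := e.monotone (show Q i ⊓ Q j ≤ Q j from inf_le_right)
      have h3 : e Y ≤ e (q k) := (le_inf (show (e Y).1 ≤ _ from h1) h2).trans h
      exact e.le_iff_le.1 h3
    · intro h
      let Y : A.intersections := ⟨(e (q i)).1 ⊓ (e (q j)).1,
        A.inf_mem_intersections (e (q i)).2 (e (q j)).2⟩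
      have h1 : Y ≤ e (q i) := show Y.1 ≤ _ from inf_le_left
      have h2 : Y ≤ e (q j) := show Y.1 ≤ _ from inf_le_right
      rw [← e.symm_apply_le] at h1 h2
      have h3 : e.symm Y ≤ q k := (le_inf (show (e.symm Y).1 ≤ _ from h1) h2).trans h
      rw [e.symm_apply_le] at h3
      exact h3

end Incidence

end HyperplaneArrangement

/-! ### Linear orders refining weak orders: ranks and cuts -/

section Ranks

variable {ι : Type*} [Fintype ι]

open scoped Classical in
/-- The number of indices whose value under `F` is smaller than that of `i`. -/
noncomputable def rankOf (F : ι → ℝ) (i : ι) : ℕ :=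
  (Finset.univ.filter fun j => F j < F i).card

open scoped Classical in
/-- The first `c` values of `v` are separated from the others. -/
def IsCut (v : ι → ℝ) (c : ℕ) : Prop :=
  ∃ x, (Finset.univ.filter fun j => v j < x).card = c

/-- The order defined by `F` refines the weak order defined by `v`. -/
def Refines (F v : ι → ℝ) : Prop :=
  ∀ i j, v i < v j → F i < F j

theorem rankOf_lt_rankOf {F : ι → ℝ} {i j : ι} : rankOf F i < rankOf F j ↔ F i < F j := by
  classical
  constructor
  · intro h
    by_contra h'
    refine absurd (Finset.card_le_card ?_) (not_le.2 h)
    intro k hk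
    simp only [Finset.mem_filter, Finset.mem_univ, true_and] at hk ⊢
    exact hk.trans_le (not_lt.1 h')
  · intro h
    apply Finset.card_lt_card
    rw [Finset.ssubset_iff_of_subset]
    · exact ⟨i, by simpa using h, by simp⟩
    · intro k hk
      simp only [Finset.mem_filter, Finset.mem_univ, true_and] at hk ⊢
      exact hk.trans h

theorem rankOf_le_rankOf {F : ι → ℝ} {i j : ι} : rankOf F i ≤ rankOf F j ↔ F i ≤ F j := by
  rw [← not_lt, rankOf_lt_rankOf, not_lt]

theorem rankOf_lt_card (F : ι → ℝ) (i : ι) : rankOf F i < Fintype.card ι := by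
  classical
  apply Finset.card_lt_card
  rw [Finset.ssubset_iff_of_subset (Finset.subset_univ _)]
  exact ⟨i, Finset.mem_univ _, by simp⟩

theorem rankOf_injective {F : ι → ℝ} (hF : F.Injective) : (rankOf F).Injective := by
  intro i j h
  exact hF (le_antisymm (rankOf_le_rankOf.1 h.le) (rankOf_le_rankOf.1 h.ge))

/-- The ranks with respect to an injective function enumerate the index set. -/
noncomputable def rankEquiv {F : ι → ℝ} (hF : F.Injective) : ι ≃ Fin (Fintype.card ι) :=
  Equiv.ofBijective (fun i => ⟨rankOf F i, rankOf_lt_card F i⟩) <| by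
    rw [Fintype.bijective_iff_injective_and_card]
    exact ⟨fun i j h => rankOf_injective hF (congrArg Fin.val h), by simp⟩

theorem exists_rankOf_eq {F : ι → ℝ} (hF : F.Injective) {c : ℕ} (hc : c < Fintype.card ι) :
    ∃ i, rankOf F i = c := by
  obtain ⟨i, hi⟩ := (rankEquiv hF).surjective ⟨c, hc⟩
  exact ⟨i, congrArg Fin.val hi⟩

theorem rankOf_neg {F : ι → ℝ} (hF : F.Injective) (i : ι) :
    rankOf (fun j => -F j) i + rankOf F i + 1 = Fintype.card ι := by
  classical
  have h1 := Finset.card_filter_add_card_filter_not (s := (Finset.univ : Finset ι)) (fun j => F j ≤ F i)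
  have h2 : (Finset.univ.filter fun j => F j ≤ F i) =
      insert i (Finset.univ.filter fun j => F j < F i) := by
    ext j
    simp only [Finset.mem_filter, Finset.mem_univ, true_and, Finset.mem_insert, le_iff_lt_or_eq,
      hF.eq_iff]
    exact or_comm
  rw [h2, Finset.card_insert_of_notMem (by simp)] at h1
  have h3 : rankOf (fun j => -F j) i = (Finset.univ.filter fun j => ¬ F j ≤ F i).card := by
    simp only [rankOf, neg_lt_neg_iff, not_le]
  rw [h3]
  simp only [Finset.card_univ] at h1
  unfold rankOf
  omega

-- The elements with value below x form an initial segment for F, and an initial segment is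
-- described by its size.
open scoped Classical in
theorem Refines.rankOf_lt_iff {F v : ι → ℝ} (h : Refines F v) {x : ℝ} {c : ℕ}
    (hc : (Finset.univ.filter fun j => v j < x).card = c) (i : ι) : rankOf F i < c ↔ v i < x := by
  constructor
  · intro hi
    by_contra hx
    refine absurd ?_ (not_le.2 hi)
    rw [← hc]
    apply Finset.card_le_card
    intro j hj
    simp only [Finset.mem_filter, Finset.mem_univ, true_and] at hj ⊢
    exact h _ _ (hj.trans_le (not_lt.1 hx))
  · intro hx
    rw [← hc]
    apply Finset.card_lt_card
    rw [Finset.ssubset_iff_of_subset]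
    · exact ⟨i, by simpa using hx, by simp⟩
    · intro j hj
      simp only [Finset.mem_filter, Finset.mem_univ, true_and] at hj ⊢
      by_contra hj'
      exact lt_asymm hj (h _ _ (hx.trans_le (not_lt.1 hj')))

/-- The classes of v are intervals for F. Two values differ exactly when a cut separates the ranks,
and the threshold `v j` provides one. -/
theorem Refines.eq_iff {F v : ι → ℝ} (h : Refines F v) {i j : ι}
    (hij : F i < F j) :
    v i = v j ↔ ∀ c, rankOf F i < c → c ≤ rankOf F j → ¬ IsCut v c := by
  constructor
  · rintro he c hi hj ⟨x, hc⟩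
    have h1 := (h.rankOf_lt_iff hc i).1 hi
    have h2 := mt (h.rankOf_lt_iff hc j).2 (not_lt.2 hj)
    rw [he] at h1
    exact h2 h1
  · intro H
    by_contra hne
    rcases lt_or_gt_of_ne hne with hlt | hlt
    · refine H _ ((h.rankOf_lt_iff rfl i).2 hlt) ?_ ⟨v j, rfl⟩
      rw [← not_lt, h.rankOf_lt_iff rfl j]
      exact lt_irrefl _
    · exact lt_asymm hij (h _ _ hlt)

theorem Refines.eq_iff_of_rankOf_succ {F v : ι → ℝ} (h : Refines F v) {i j : ι}
    {c : ℕ} (hi : rankOf F i = c) (hj : rankOf F j = c + 1) : v i = v j ↔ ¬ IsCut v (c + 1) := by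
  rw [h.eq_iff (rankOf_lt_rankOf.1 (by omega))]
  constructor
  · intro H
    exact H _ (by omega) (by omega)
  · intro H c' h1 h2
    obtain rfl : c' = c + 1 := by omega
    exact H

theorem Refines.rankOf_lt_iff_of_isCut {F G v : ι → ℝ} (h : Refines F v) (h' : Refines G v)
    {c : ℕ} (hc : IsCut v c) (i : ι) :
    rankOf F i < c ↔ rankOf G i < c := by
  obtain ⟨x, hx⟩ := hc
  rw [h.rankOf_lt_iff hx, h'.rankOf_lt_iff hx]

theorem isCut_zero (v : ι → ℝ) : IsCut v 0 := by
  classical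
  rcases isEmpty_or_nonempty ι with h | h
  · exact ⟨0, by simp⟩
  · obtain ⟨i, hi⟩ := Finite.exists_min v
    refine ⟨v i, ?_⟩
    rw [Finset.card_eq_zero, Finset.filter_eq_empty_iff]
    intro j _
    exact not_lt.2 (hi j)

theorem isCut_card (v : ι → ℝ) : IsCut v (Fintype.card ι) := by
  classical
  rcases isEmpty_or_nonempty ι with h | h
  · exact ⟨0, by simp⟩
  · obtain ⟨i, hi⟩ := Finite.exists_max v
    refine ⟨v i + 1, ?_⟩
    rw [Finset.filter_true_of_mem, Finset.card_univ]
    intro j _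
    linarith [hi j]

end Ranks

/-! ### Sort systems and the alternation of cuts -/

/-- A periodic sequence of linear orders on a finite set, where consecutive orders differ by the
reversal of the classes of a weak order, such that every pair is reversed exactly once in each
half period. The functions `F t` define the orders, the functions `v t` the weak orders. -/
structure SortSystem (ι : Type*) [Fintype ι] (n : ℕ) where
  v : ℤ → ι → ℝ
  F : ℤ → ι → ℝ
  inj : ∀ t, (F t).Injective
  refines_right : ∀ t, Refines (F t) (v t)
  refines_left : ∀ t, Refines (F t) (v (t + 1))
  flip : ∀ t i j, i ≠ j → v (t + 1) i = v (t + 1) j → F t i < F t j → F (t + 1) j < F (t + 1) i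
  antiperiodic_v : ∀ t i, v (t + n) i = -v t i
  antiperiodic_F : ∀ t i, F (t + n) i = -F t i
  meet : ∀ (t₀ : ℤ) (i j : ι), ∃ t : ℤ, t₀ ≤ t ∧ t < t₀ + n ∧ v t i = v t j
  once : ∀ (s t : ℤ) (i j : ι), i ≠ j → v s i = v s j → v t i = v t j → s < t → s + n ≤ t

namespace SortSystem

variable {ι : Type*} [Fintype ι] {n : ℕ} (S : SortSystem ι n)

/-- Neighbours in a linear order are equal in the preceding or in the following weak order. -/
def NeighboursMeet : Prop :=
  ∀ t i j, S.F t i < S.F t j → (∀ k, ¬ (S.F t i < S.F t k ∧ S.F t k < S.F t j)) →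
    S.v t i = S.v t j ∨ S.v (t + 1) i = S.v (t + 1) j

/-- The system shifted by `s`. -/
def shift (s : ℤ) : SortSystem ι n where
  v t := S.v (s + t)
  F t := S.F (s + t)
  inj t := S.inj _
  refines_right t := S.refines_right _
  refines_left t := by rw [← add_assoc]; exact S.refines_left _
  flip t i j := by rw [← add_assoc]; exact S.flip _ i j
  antiperiodic_v t i := by rw [← add_assoc]; exact S.antiperiodic_v _ i
  antiperiodic_F t i := by rw [← add_assoc]; exact S.antiperiodic_F _ i
  meet t₀ i j := by
    obtain ⟨t, h1, h2, h3⟩ := S.meet (s + t₀) i j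
    exact ⟨t - s, by omega, by omega, by rwa [add_sub_cancel]⟩
  once t t' i j hij h1 h2 h := by
    have := S.once _ _ i j hij h1 h2 (by omega)
    omega

theorem NeighboursMeet.shift {S : SortSystem ι n} (h : S.NeighboursMeet) (s : ℤ) :
    (S.shift s).NeighboursMeet := by
  intro t i j h1 h2
  have := h (s + t) i j h1 h2
  rwa [add_assoc] at this

theorem lt_iff_of_ne {t : ℤ} {i j : ι} (h : S.v (t + 1) i ≠ S.v (t + 1) j) :
    S.F t i < S.F t j ↔ S.F (t + 1) i < S.F (t + 1) j := by
  rcases lt_or_gt_of_ne h with h | h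
  · exact iff_of_true (S.refines_left _ _ _ h) (S.refines_right _ _ _ h)
  · exact iff_of_false (S.refines_left _ _ _ h).le.not_gt (S.refines_right _ _ _ h).le.not_gt

theorem lt_iff_of_eq {t : ℤ} {i j : ι} (hij : i ≠ j) (h : S.v (t + 1) i = S.v (t + 1) j) :
    S.F t i < S.F t j ↔ S.F (t + 1) j < S.F (t + 1) i := by
  refine ⟨S.flip t i j hij h, fun h1 => ?_⟩
  rcases lt_or_gt_of_ne ((S.inj t).ne hij) with h2 | h2
  · exact h2
  · exact absurd h1 (S.flip t j i hij.symm h.symm h2).le.not_gt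

variable {S}

/-- Position c separates the elements of ranks c - 1 and c. They are adjacent, so they meet at time
t or t + 1, and by `once` not at both. -/
theorem NeighboursMeet.isCut_succ (h : S.NeighboursMeet) (hn : 2 ≤ n) (t : ℤ) {c : ℕ} (hc : 0 < c)
    (hc' : c < Fintype.card ι) : IsCut (S.v (t + 1)) c ↔ ¬ IsCut (S.v t) c := by
  obtain ⟨d, rfl⟩ : ∃ d, c = d + 1 := ⟨c - 1, by omega⟩
  obtain ⟨i, hi⟩ := exists_rankOf_eq (S.inj t) (c := d) (by omega)
  obtain ⟨j, hj⟩ := exists_rankOf_eq (S.inj t) hc'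
  have h1 := (S.refines_right t).eq_iff_of_rankOf_succ hi hj
  have h2 := (S.refines_left t).eq_iff_of_rankOf_succ hi hj
  have hlt : S.F t i < S.F t j := rankOf_lt_rankOf.1 (by omega)
  rw [← h1, ← not_iff_not, ← h2]
  constructor
  · intro h3 h4
    have hij : i ≠ j := by rintro rfl; exact lt_irrefl _ hlt
    have := S.once _ _ i j hij h4 h3 (by omega)
    omega
  · intro h3
    refine (h t i j hlt ?_).resolve_left h3
    rintro k ⟨h4, h5⟩
    rw [← rankOf_lt_rankOf] at h4 h5
    omega

theorem NeighboursMeet.isCut_add_two (h : S.NeighboursMeet) (hn : 2 ≤ n) (t : ℤ) {c : ℕ}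
    (hc : 0 < c) (hc' : c < Fintype.card ι) : IsCut (S.v (t + 2)) c ↔ IsCut (S.v t) c := by
  rw [show t + 2 = t + 1 + 1 by ring, h.isCut_succ hn _ hc hc', h.isCut_succ hn _ hc hc', not_not]

/-- An element alone in its class keeps its rank. -/
theorem rankOf_succ_of_isCut {t : ℤ} {i : ι} {c : ℕ} (hi : rankOf (S.F t) i = c)
    (h1 : IsCut (S.v (t + 1)) c) (h2 : IsCut (S.v (t + 1)) (c + 1)) :
    rankOf (S.F (t + 1)) i = c := by
  have h3 := (S.refines_left t).rankOf_lt_iff_of_isCut (S.refines_right (t + 1)) h1 i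
  have h4 := (S.refines_left t).rankOf_lt_iff_of_isCut (S.refines_right (t + 1)) h2 i
  omega

/-- The middle element of a class of three elements keeps its rank. -/
theorem rankOf_succ_of_not_isCut {t : ℤ} {i : ι} {c : ℕ} (hi : rankOf (S.F t) i = c + 1)
    (hc : c + 2 < Fintype.card ι)
    (h0 : IsCut (S.v (t + 1)) c) (h1 : ¬ IsCut (S.v (t + 1)) (c + 1))
    (h2 : ¬ IsCut (S.v (t + 1)) (c + 2)) (h3 : IsCut (S.v (t + 1)) (c + 3)) :
    rankOf (S.F (t + 1)) i = c + 1 := by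
  obtain ⟨j, hj⟩ := exists_rankOf_eq (S.inj t) (c := c) (by omega)
  obtain ⟨k, hk⟩ := exists_rankOf_eq (S.inj t) hc
  have hji := ((S.refines_left t).eq_iff_of_rankOf_succ hj hi).2 h1
  have hik := ((S.refines_left t).eq_iff_of_rankOf_succ hi hk).2 h2
  have lji : S.F t j < S.F t i := rankOf_lt_rankOf.1 (by omega)
  have lik : S.F t i < S.F t k := rankOf_lt_rankOf.1 (by omega)
  have g1 := S.flip t j i (fun e => by subst e; exact lt_irrefl _ lji) hji lji
  have g2 := S.flip t i k (fun e => by subst e; exact lt_irrefl _ lik) hik lik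
  rw [← rankOf_lt_rankOf] at g1 g2
  have c0 := (S.refines_left t).rankOf_lt_iff_of_isCut (S.refines_right (t + 1)) h0 k
  have c3 := (S.refines_left t).rankOf_lt_iff_of_isCut (S.refines_right (t + 1)) h3 j
  omega

/-- A class has at most three elements. In a larger one, two adjacent inner elements are alone at
the next time, so they keep their ranks and meet again two steps later, too early for n ≥ 3. -/
theorem NeighboursMeet.not_three (h : S.NeighboursMeet) (hn : 3 ≤ n) {t : ℤ} {c : ℕ} (hc : 0 < c)
    (hc' : c + 2 < Fintype.card ι) (h0 : ¬ IsCut (S.v t) c) (h1 : ¬ IsCut (S.v t) (c + 1))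
    (h2 : ¬ IsCut (S.v t) (c + 2)) : False := by
  have hn2 : 2 ≤ n := by omega
  obtain ⟨i, hi⟩ := exists_rankOf_eq (S.inj t) (c := c) (by omega)
  obtain ⟨j, hj⟩ := exists_rankOf_eq (S.inj t) (c := c + 1) (by omega)
  have g0 := (h.isCut_succ hn2 t hc (by omega)).2 h0
  have g1 := (h.isCut_succ hn2 t (c := c + 1) (by omega) (by omega)).2 h1
  have g2 := (h.isCut_succ hn2 t (c := c + 2) (by omega) (by omega)).2 h2
  have hi' := rankOf_succ_of_isCut hi g0 g1
  have hj' := rankOf_succ_of_isCut hj g1 g2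
  have e0 := ((S.refines_right t).eq_iff_of_rankOf_succ hi hj).2 h1
  have e1 := ((S.refines_left (t + 1)).eq_iff_of_rankOf_succ hi' hj').2 (by
    rw [h.isCut_succ hn2 (t + 1) (by omega) (by omega), not_not]
    exact g1)
  have hij : i ≠ j := by rintro rfl; omega
  have := S.once _ _ i j hij e0 e1 (by omega)
  omega

theorem NeighboursMeet.isCut_of_three (h : S.NeighboursMeet) (hn : 3 ≤ n) {t : ℤ} {c : ℕ}
    (hc' : c + 2 < Fintype.card ι) (h1 : ¬ IsCut (S.v t) (c + 1))
    (h2 : ¬ IsCut (S.v t) (c + 2)) : IsCut (S.v t) c ∧ IsCut (S.v t) (c + 3) := by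
  constructor
  · by_contra h0
    rcases Nat.eq_zero_or_pos c with rfl | hc
    · exact h0 (isCut_zero _)
    · exact h.not_three hn hc hc' h0 h1 h2
  · by_contra h3
    rcases (show c + 3 ≤ Fintype.card ι by omega).eq_or_lt with hc | hc
    · exact h3 (hc ▸ isCut_card _)
    · exact h.not_three hn (c := c + 1) (by omega) (by omega) h1 h2 h3

/-- Only the middle position may fail to alternate. -/
theorem NeighboursMeet.eq_middle_of_not (h : S.NeighboursMeet) (hn : 3 ≤ n) {t : ℤ} {c : ℕ}
    (hc' : c + 2 < Fintype.card ι) (h1 : ¬ IsCut (S.v t) (c + 1))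
    (h2 : ¬ IsCut (S.v t) (c + 2)) : 2 * (c + 1) + 1 = Fintype.card ι := by
  have hn2 : 2 ≤ n := by omega
  obtain ⟨i, hi⟩ := exists_rankOf_eq (S.inj t) (c := c + 1) (by omega)
  -- Both positions switch at every step, so they stay in agreement.
  have same : ∀ m : ℕ, (IsCut (S.v (t + m)) (c + 1) ↔ IsCut (S.v (t + m)) (c + 2)) := by
    intro m
    induction m with
    | zero => simpa using iff_of_false h1 h2
    | succ m ihm =>
      rw [Nat.cast_succ, ← add_assoc, h.isCut_succ hn2 _ (by omega) (by omega),
        h.isCut_succ hn2 _ (by omega) (by omega), ihm]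
  -- The element between the two positions is at each time either alone or the middle of a class of
  -- three, so its rank never changes.
  have key : ∀ k : ℕ, rankOf (S.F (t + k)) i = c + 1 := by
    intro k
    induction k with
    | zero => simpa using hi
    | succ k ih =>
      rw [Nat.cast_succ, ← add_assoc]
      have hs := same (k + 1)
      rw [Nat.cast_succ, ← add_assoc] at hs
      by_cases g1 : IsCut (S.v (t + k + 1)) (c + 1)
      · exact rankOf_succ_of_isCut ih g1 (hs.1 g1)
      · have g2 := mt hs.2 g1
        obtain ⟨g0, g3⟩ := h.isCut_of_three hn hc' g1 g2
        exact rankOf_succ_of_not_isCut ih hc' g0 g1 g2 g3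
  -- After half a period the order is reversed, so the constant rank equals its own mirror image.
  have h3 := key n
  have h4 : S.F (t + n) = fun j => -S.F t j := funext fun j => S.antiperiodic_F t j
  rw [h4] at h3
  have h5 := rankOf_neg (S.inj t) i
  omega

variable (S) in
/-- There is a position where the cuts do not alternate. -/
def HasMiddle : Prop :=
  ∃ c, c + 2 < Fintype.card ι ∧ (IsCut (S.v 0) (c + 1) ↔ IsCut (S.v 0) (c + 2))

end SortSystem

/-! ### Classification of sort systems in which neighbours meet -/

namespace SortSystem

variable {ι : Type*} [Fintype ι] {n : ℕ} {S : SortSystem ι n}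

/-- All interior positions switch together, so whether two of them agree does not depend on time. In
particular `HasMiddle` is invariant under shifts. -/
theorem NeighboursMeet.isCut_iff_isCut (h : S.NeighboursMeet) (hn : 2 ≤ n) (t : ℤ) {c d : ℕ}
    (hc : 0 < c) (hd : 0 < d) (hc' : c < Fintype.card ι) (hd' : d < Fintype.card ι) :
    (IsCut (S.v t) c ↔ IsCut (S.v t) d) ↔ (IsCut (S.v 0) c ↔ IsCut (S.v 0) d) := by
  have step : ∀ t : ℤ, (IsCut (S.v (t + 1)) c ↔ IsCut (S.v (t + 1)) d) ↔
      (IsCut (S.v t) c ↔ IsCut (S.v t) d) := by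
    intro t
    rw [h.isCut_succ hn _ hc hc', h.isCut_succ hn _ hd hd', not_iff_not]
  induction t using Int.induction_on with
  | zero => exact Iff.rfl
  | succ t ih => exact (step _).trans ih
  | pred t ih =>
    have := step (-t - 1)
    rw [sub_add_cancel] at this
    exact this.symm.trans ih

/-- Without interior cuts at time t, all elements form one class at time t, and again at t + 2 by
alternation. Then two of them meet twice within less than half a period. -/
theorem NeighboursMeet.exists_isCut (h : S.NeighboursMeet) (hn : 3 ≤ n)
    (hι : 2 ≤ Fintype.card ι) (t : ℤ) : ∃ c, 0 < c ∧ c < Fintype.card ι ∧ IsCut (S.v t) c := by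
  by_contra H
  push Not at H
  obtain ⟨i, hi⟩ := exists_rankOf_eq (S.inj t) (c := 0) (by omega)
  obtain ⟨j, hj⟩ := exists_rankOf_eq (S.inj t) (c := 1) (by omega)
  have lij : S.F t i < S.F t j := rankOf_lt_rankOf.1 (by omega)
  have hij : i ≠ j := by rintro rfl; omega
  have h0 := ((S.refines_right t).eq_iff_of_rankOf_succ hi hj).2 (H _ (by omega) (by omega))
  have h2 : S.v (t + 2) i = S.v (t + 2) j := by
    have H2 : ∀ c, 0 < c → c < Fintype.card ι → ¬ IsCut (S.v (t + 2)) c := by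
      intro c hc hc'
      rw [h.isCut_add_two (by omega) _ hc hc']
      exact H c hc hc'
    rcases lt_or_gt_of_ne ((S.inj (t + 2)).ne hij) with h3 | h3
    · refine ((S.refines_right (t + 2)).eq_iff h3).2 fun c hc hc' => H2 c (by omega) ?_
      exact hc'.trans_lt (rankOf_lt_card _ _)
    · refine (((S.refines_right (t + 2)).eq_iff h3).2 fun c hc hc' => H2 c (by omega) ?_).symm
      exact hc'.trans_lt (rankOf_lt_card _ _)
  have := S.once _ _ i j hij h0 h2 (by omega)
  omega

theorem NeighboursMeet.exists_not_isCut (h : S.NeighboursMeet) (hn : 3 ≤ n)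
    (hι : 2 ≤ Fintype.card ι) (t : ℤ) : ∃ c, 0 < c ∧ c < Fintype.card ι ∧ ¬ IsCut (S.v t) c := by
  obtain ⟨c, h1, h2, h3⟩ := h.exists_isCut hn hι (t + 1)
  exact ⟨c, h1, h2, (h.isCut_succ (by omega) t h1 h2).1 h3⟩

theorem NeighboursMeet.exists_eq (h : S.NeighboursMeet) (hn : 3 ≤ n)
    (hι : 2 ≤ Fintype.card ι) (t : ℤ) : ∃ i j, i ≠ j ∧ S.v t i = S.v t j := by
  obtain ⟨c, h1, h2, h3⟩ := h.exists_not_isCut hn hι t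
  obtain ⟨d, rfl⟩ : ∃ d, c = d + 1 := ⟨c - 1, by omega⟩
  obtain ⟨i, hi⟩ := exists_rankOf_eq (S.inj t) (c := d) (by omega)
  obtain ⟨j, hj⟩ := exists_rankOf_eq (S.inj t) h2
  exact ⟨i, j, by rintro rfl; omega, ((S.refines_right t).eq_iff_of_rankOf_succ hi hj).2 h3⟩

theorem NeighboursMeet.three_le_card (h : S.NeighboursMeet) (hn : 3 ≤ n)
    (hι : 2 ≤ Fintype.card ι) : 3 ≤ Fintype.card ι := by
  by_contra H
  obtain ⟨c, h1, h2, h3⟩ := h.exists_isCut hn hι 0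
  obtain ⟨d, h4, h5, h6⟩ := h.exists_not_isCut hn hι 0
  obtain rfl : c = 1 := by omega
  obtain rfl : d = 1 := by omega
  exact h6 h3

theorem NeighboursMeet.middle_eq (h : S.NeighboursMeet) (hn : 3 ≤ n) {c : ℕ}
    (hc : c + 2 < Fintype.card ι) (hc' : IsCut (S.v 0) (c + 1) ↔ IsCut (S.v 0) (c + 2)) :
    2 * (c + 1) + 1 = Fintype.card ι := by
  by_cases h1 : IsCut (S.v 0) (c + 1)
  · refine h.eq_middle_of_not hn (t := 0 + 1) hc ?_ ?_
    · rwa [h.isCut_succ (by omega) _ (by omega) (by omega), not_not]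
    · rwa [h.isCut_succ (by omega) _ (by omega) (by omega), not_not, ← hc']
  · exact h.eq_middle_of_not hn hc h1 (by rwa [← hc'])

/-- Neighbouring positions agree at most around the centre. So the first position, the number of
elements and `HasMiddle` determine all cuts at time 0. -/
theorem NeighboursMeet.isCut_iff_isCut_succ (h : S.NeighboursMeet) (hn : 3 ≤ n) {c : ℕ}
    (hc : c + 2 < Fintype.card ι) :
    (IsCut (S.v 0) (c + 1) ↔ IsCut (S.v 0) (c + 2)) ↔
      S.HasMiddle ∧ 2 * (c + 1) + 1 = Fintype.card ι := by
  constructor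
  · intro h1
    exact ⟨⟨c, hc, h1⟩, h.middle_eq hn hc h1⟩
  · rintro ⟨⟨d, hd, h1⟩, h2⟩
    have := h.middle_eq hn hd h1
    obtain rfl : c = d := by omega
    exact h1

/-- Three elements are impossible: the only two interior positions would agree, although there must
be both a cut and a non-cut. -/
theorem NeighboursMeet.exists_card_eq_of_hasMiddle (h : S.NeighboursMeet) (hn : 3 ≤ n)
    (hS : S.HasMiddle) : ∃ m, 2 ≤ m ∧ Fintype.card ι = 2 * m + 1 := by
  obtain ⟨c, hc, h1⟩ := hS
  have h2 := h.middle_eq hn hc h1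
  refine ⟨c + 1, ?_, h2.symm⟩
  by_contra H
  obtain rfl : c = 0 := by omega
  obtain ⟨c, c1, c2, c3⟩ := h.exists_isCut hn (by omega) 0
  obtain ⟨d, d1, d2, d3⟩ := h.exists_not_isCut hn (by omega) 0
  rcases (show c = 1 ∨ c = 2 by omega) with rfl | rfl <;>
  rcases (show d = 1 ∨ d = 2 by omega) with rfl | rfl <;> simp_all

theorem NeighboursMeet.exists_triple (h : S.NeighboursMeet) (hn : 2 ≤ n) (hS : S.HasMiddle) :
    ∃ t i j k, i ≠ j ∧ i ≠ k ∧ j ≠ k ∧ S.v t i = S.v t j ∧ S.v t j = S.v t k := by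
  obtain ⟨c, hc, h1⟩ := hS
  obtain ⟨t, h2, h3⟩ : ∃ t, ¬ IsCut (S.v t) (c + 1) ∧ ¬ IsCut (S.v t) (c + 2) := by
    by_cases h2 : IsCut (S.v 0) (c + 1)
    · refine ⟨0 + 1, ?_, ?_⟩
      · rwa [h.isCut_succ (by omega) _ (by omega) (by omega), not_not]
      · rwa [h.isCut_succ (by omega) _ (by omega) (by omega), not_not, ← h1]
    · exact ⟨0, h2, by rwa [← h1]⟩
  obtain ⟨i, hi⟩ := exists_rankOf_eq (S.inj t) (c := c) (by omega)
  obtain ⟨j, hj⟩ := exists_rankOf_eq (S.inj t) (c := c + 1) (by omega)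
  obtain ⟨k, hk⟩ := exists_rankOf_eq (S.inj t) hc
  exact ⟨t, i, j, k, by rintro rfl; omega, by rintro rfl; omega, by rintro rfl; omega,
    ((S.refines_right t).eq_iff_of_rankOf_succ hi hj).2 h2,
    ((S.refines_right t).eq_iff_of_rankOf_succ hj hk).2 h3⟩

theorem iff_of_iff_iff_iff {p q p' q' : Prop} (h : (p' ↔ q') ↔ (p ↔ q)) (h' : p ↔ p') :
    q ↔ q' := by
  tauto

/-- At time 0 the pattern spreads from position 1 to the right; alternation then carries it to all
later times. -/
theorem NeighboursMeet.isCut_eq (h : S.NeighboursMeet) (hn : 3 ≤ n) {ι' : Type*} [Fintype ι']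
    {n' : ℕ} {S' : SortSystem ι' n'} (h' : S'.NeighboursMeet) (hn' : 3 ≤ n')
    (hcard : Fintype.card ι = Fintype.card ι') (hm : S.HasMiddle ↔ S'.HasMiddle)
    (h1 : IsCut (S.v 0) 1 ↔ IsCut (S'.v 0) 1) (t : ℕ) {c : ℕ} (hc : 0 < c)
    (hc' : c < Fintype.card ι) : IsCut (S.v t) c ↔ IsCut (S'.v t) c := by
  induction t with
  | succ t ih =>
    rw [Nat.cast_succ, h.isCut_succ (by omega) _ hc hc',
      h'.isCut_succ (by omega) _ hc (hcard ▸ hc'), ih]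
  | zero =>
    induction c, hc using Nat.le_induction with
    | base => exact h1
    | succ c hc ih =>
      obtain ⟨d, rfl⟩ : ∃ d, c = d + 1 := ⟨c - 1, by omega⟩
      have e1 := h.isCut_iff_isCut_succ hn (c := d) hc'
      have e2 := h'.isCut_iff_isCut_succ hn' (c := d) (by omega)
      have e3 := ih (by omega)
      rw [← hcard, ← hm, ← e1] at e2
      simp only [Nat.cast_zero] at e3 ⊢
      exact iff_of_iff_iff_iff e2 e3

theorem rankOf_eq_of_equiv {ι' : Type*} [Fintype ι'] {F : ι → ℝ} {F' : ι' → ℝ} (g : ι ≃ ι')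
    (h : ∀ i j, F i < F j ↔ F' (g i) < F' (g j)) (i : ι) : rankOf F' (g i) = rankOf F i := by
  classical
  unfold rankOf
  exact (Finset.card_equiv g fun j => by simp [h]).symm

/-- An order isomorphism between the initial orders of two systems with the same cuts is
compatible with all orders. -/
theorem equiv_of_isCut {ι' : Type*} [Fintype ι'] {n' : ℕ} {S' : SortSystem ι' n'} (g : ι ≃ ι')
    (h0 : ∀ i j, S.F 0 i < S.F 0 j ↔ S'.F 0 (g i) < S'.F 0 (g j))
    (hcut : ∀ (t : ℕ) (c : ℕ), 0 < c → c < Fintype.card ι →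
      (IsCut (S.v t) c ↔ IsCut (S'.v t) c)) (t : ℕ) :
    (∀ i j, S.F t i < S.F t j ↔ S'.F t (g i) < S'.F t (g j)) ∧
      ∀ i j, S.v (t + 1) i = S.v (t + 1) j ↔ S'.v (t + 1) (g i) = S'.v (t + 1) (g j) := by
  have step : ∀ t : ℕ, (∀ i j, S.F t i < S.F t j ↔ S'.F t (g i) < S'.F t (g j)) →
      ∀ i j, S.v (t + 1) i = S.v (t + 1) j ↔ S'.v (t + 1) (g i) = S'.v (t + 1) (g j) := by
    intro t ht
    have key : ∀ i j, S.F t i < S.F t j →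
        (S.v (t + 1) i = S.v (t + 1) j ↔ S'.v (t + 1) (g i) = S'.v (t + 1) (g j)) := by
      intro i j hij
      rw [(S.refines_left t).eq_iff hij, (S'.refines_left t).eq_iff ((ht i j).1 hij),
        rankOf_eq_of_equiv g ht, rankOf_eq_of_equiv g ht]
      refine forall_congr' fun c => forall_congr' fun h1 => forall_congr' fun h2 => ?_
      have := hcut (t + 1) c (by omega) (h2.trans_lt (rankOf_lt_card _ _))
      rw [Nat.cast_succ] at this
      rw [this]
    intro i j
    by_cases hij : i = j
    · subst hij; simp
    · rcases lt_or_gt_of_ne ((S.inj t).ne hij) with h | h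
      · exact key i j h
      · rw [eq_comm, key j i h, eq_comm]
  induction t with
  | zero => exact ⟨by simpa using h0, step 0 (by simpa using h0)⟩
  | succ t ih =>
    have : ∀ i j, S.F (t + 1 : ℕ) i < S.F (t + 1 : ℕ) j ↔
        S'.F (t + 1 : ℕ) (g i) < S'.F (t + 1 : ℕ) (g j) := by
      intro i j
      rw [Nat.cast_succ]
      by_cases hij : i = j
      · subst hij; simp
      · by_cases hv : S.v (t + 1) i = S.v (t + 1) j
        · rw [← S.lt_iff_of_eq (Ne.symm hij) hv.symm,
            ← S'.lt_iff_of_eq (g.injective.ne (Ne.symm hij)) ((ih.2 _ _).1 hv).symm]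
          exact ih.1 _ _
        · rw [← S.lt_iff_of_ne hv, ← S'.lt_iff_of_ne (mt (ih.2 _ _).2 hv)]
          exact ih.1 _ _
    exact ⟨this, step _ this⟩

/-- The half period can be read off the orders, being the time after which every pair is reversed.
-/
theorem NeighboursMeet.le_of_equiv {ι' : Type*} [Fintype ι'] {n' : ℕ} {S' : SortSystem ι' n'}
    (h' : S'.NeighboursMeet) (hn' : 3 ≤ n') (hι : 2 ≤ Fintype.card ι') (g : ι ≃ ι')
    (h0 : ∀ (t : ℕ) i j, S.F t i < S.F t j ↔ S'.F t (g i) < S'.F t (g j)) : n' ≤ n := by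
  by_contra hlt
  push Not at hlt
  obtain ⟨i', j', hne, hv⟩ := h'.exists_eq hn' hι (n + 1)
  obtain ⟨i, rfl⟩ := g.surjective i'
  obtain ⟨j, rfl⟩ := g.surjective j'
  -- If n < n', a pair that meets at time n + 1 in S' does not meet at times 1, …, n there, so its
  -- order is the same at times 0 and n. In S it is reversed at time n.
  have same : ∀ m : ℕ, m ≤ n → (S'.F m (g i) < S'.F m (g j) ↔ S'.F 0 (g i) < S'.F 0 (g j)) := by
    intro m
    induction m with
    | zero => simp
    | succ m ih =>
      intro hm
      rw [← ih (by omega), Nat.cast_succ, ← S'.lt_iff_of_ne]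
      intro hv'
      have := S'.once _ _ _ _ hne hv' hv (by omega)
      omega
  have h1 := same n le_rfl
  have e := h0 0 i j
  rw [← h0] at h1
  rw [Nat.cast_zero] at e
  rw [← e] at h1
  have h2 := S.antiperiodic_F 0
  simp only [zero_add] at h2
  rw [h2, h2, neg_lt_neg_iff] at h1
  rcases lt_or_gt_of_ne ((S.inj 0).ne (show i ≠ j from fun e => hne (congrArg g e))) with h3 | h3
  · exact lt_asymm h3 (h1.2 h3)
  · exact lt_asymm h3 (h1.1 h3)

/-- Two systems of the same size and the same type are isomorphic. -/
theorem NeighboursMeet.exists_equiv (h : S.NeighboursMeet) (hn : 3 ≤ n) {ι' : Type*} [Fintype ι']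
    {n' : ℕ} {S' : SortSystem ι' n'} (h' : S'.NeighboursMeet) (hn' : 3 ≤ n')
    (hι : 2 ≤ Fintype.card ι) (hcard : Fintype.card ι = Fintype.card ι')
    (hm : S.HasMiddle ↔ S'.HasMiddle) :
    n = n' ∧ ∃ (g : ι ≃ ι') (s : ℤ), ∀ (t : ℕ) i j,
      S.v (s + t + 1) i = S.v (s + t + 1) j ↔ S'.v (t + 1) (g i) = S'.v (t + 1) (g j) := by
  -- Position 1 switches at each step, so a shift by 0 or 1 aligns the phases.
  obtain ⟨s, hs⟩ : ∃ s : ℤ, IsCut (S.v s) 1 ↔ IsCut (S'.v 0) 1 := by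
    by_cases h1 : IsCut (S.v 0) 1 ↔ IsCut (S'.v 0) 1
    · exact ⟨0, h1⟩
    · refine ⟨0 + 1, ?_⟩
      rw [h.isCut_succ (by omega) _ (by omega) (by omega)]
      tauto
  let T := S.shift s
  have hT : T.NeighboursMeet := h.shift s
  have hTm : T.HasMiddle ↔ S'.HasMiddle := by
    rw [← hm]
    refine exists_congr fun c => and_congr_right fun hc => ?_
    exact h.isCut_iff_isCut (by omega) (s + 0) (by omega) (by omega) (by omega) (by omega)
  have hcut := hT.isCut_eq hn h' hn' hcard hTm (by
    change IsCut (S.v (s + 0)) 1 ↔ _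
    rw [add_zero, hs])
  -- Elements are matched by their rank at time 0.
  let g : ι ≃ ι' := (rankEquiv (T.inj 0)).trans
    ((finCongr hcard).trans (rankEquiv (S'.inj 0)).symm)
  have hg : ∀ i, rankOf (S'.F 0) (g i) = rankOf (T.F 0) i := by
    intro i
    have : rankEquiv (S'.inj 0) (g i) = finCongr hcard (rankEquiv (T.inj 0) i) := by
      simp [g]
    exact congrArg Fin.val this
  have h0 : ∀ i j, T.F 0 i < T.F 0 j ↔ S'.F 0 (g i) < S'.F 0 (g j) := by
    intro i j
    rw [← rankOf_lt_rankOf, ← rankOf_lt_rankOf, hg, hg]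
  have hiso := equiv_of_isCut g h0 fun t c => hcut t
  refine ⟨le_antisymm ?_ ?_, g, s, fun t i j => ?_⟩
  · refine hT.le_of_equiv hn hι g.symm (S := S') fun t i j => ?_
    rw [(hiso t).1]
    simp
  · exact h'.le_of_equiv hn' (hcard ▸ hι) g fun t => (hiso t).1
  · rw [add_assoc]
    exact (hiso t).2 i j

/-- The first and the last element at time 0 meet at time 0 or 1. Both weak orders are refined by
`S.F 0`, so everything in between is in the same class. -/
theorem exists_forall_eq_of_le_two [Nonempty ι] (S : SortSystem ι n) (hn : n ≤ 2) :
    ∃ t, ∀ i j, S.v t i = S.v t j := by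
  obtain ⟨a, ha⟩ := Finite.exists_min (S.F 0)
  obtain ⟨b, hb⟩ := Finite.exists_max (S.F 0)
  obtain ⟨t, h1, h2, h3⟩ := S.meet 0 a b
  refine ⟨t, ?_⟩
  have hr : Refines (S.F 0) (S.v t) := by
    rcases (show t = 0 ∨ t = 0 + 1 by omega) with rfl | rfl
    · exact S.refines_right 0
    · exact S.refines_left 0
  have key : ∀ i, S.v t i = S.v t a := by
    intro i
    apply le_antisymm
    · rw [h3]
      by_contra h
      exact absurd (hr _ _ (not_le.1 h)) (hb i).not_gt
    · by_contra h
      exact absurd (hr _ _ (not_le.1 h)) (ha i).not_gt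
  intro i j
  rw [key i, key j]

end SortSystem

/-! ### A counting criterion for neighbours to meet -/

section Counting

open Finset
-- Each class has exactly one first element.
open scoped Classical in
theorem card_filter_exists_lt_add_card_image {ι : Type*} [Fintype ι] {F : ι → ℝ}
    (hF : F.Injective) (w : ι → ℝ) :
    #{j | ∃ i, F i < F j ∧ w i = w j} + #(univ.image w) = Fintype.card ι := by
  rw [← card_univ, ← card_filter_add_card_filter_not (s := univ)
    (fun j => ∃ i, F i < F j ∧ w i = w j), Nat.add_left_cancel_iff]
  rw [← card_image_of_injOn (s := univ.filter fun j => ¬ ∃ i, F i < F j ∧ w i = w j) (f := w)]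
  · congr 1
    ext y
    simp only [mem_image, mem_univ, true_and, mem_filter]
    constructor
    · rintro ⟨j, rfl⟩
      obtain ⟨i, hi, hmin⟩ := exists_min_image (univ.filter fun i => w i = w j) F ⟨j, by simp⟩
      simp only [mem_filter, mem_univ, true_and] at hi hmin
      refine ⟨i, ?_, hi⟩
      rintro ⟨k, h1, h2⟩
      exact absurd h1 (hmin k (h2.trans hi)).not_gt
    · rintro ⟨j, -, rfl⟩
      exact ⟨j, rfl⟩
  · intro i hi j hj hij
    simp only [coe_filter, mem_univ, true_and, Set.mem_ofPred_eq, not_exists, not_and] at hi hj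
    by_contra hne
    rcases lt_or_gt_of_ne (hF.ne hne) with h | h
    · exact hj i h hij
    · exact hi j h hij.symm

-- A class of f elements contributes f² pairs, and f² + 2 = 3f for f = 1, 2.
open scoped Classical in
theorem card_filter_eq_add_two_mul_card_image {ι : Type*} (s : Finset ι) (w : ι → ℝ)
    (h : ∀ i ∈ s, ∀ j ∈ s, ∀ k ∈ s, i ≠ j → i ≠ k → j ≠ k → w i = w j → w j ≠ w k) :
    #{p ∈ s ×ˢ s | w p.1 = w p.2} + 2 * #(s.image w) = 3 * #s := by
  rw [card_eq_sum_card_image w s, card_eq_sum_card_fiberwise (f := fun p => w p.1)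
    (t := s.image w) (by
      intro p hp
      simp only [coe_filter, mem_product, Set.mem_ofPred_eq] at hp
      exact mem_coe.2 (mem_image_of_mem _ hp.1.1))]
  rw [card_eq_sum_ones, mul_sum, mul_sum, ← sum_add_distrib]
  apply sum_congr rfl
  intro y hy
  have h1 : {p ∈ {p ∈ s ×ˢ s | w p.1 = w p.2} | w p.1 = y} =
      {i ∈ s | w i = y} ×ˢ {i ∈ s | w i = y} := by
    ext p
    simp only [mem_filter, mem_product]
    constructor
    · rintro ⟨⟨⟨h1, h2⟩, h3⟩, h4⟩
      exact ⟨⟨h1, h4⟩, h2, h3 ▸ h4⟩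
    · rintro ⟨⟨h1, h2⟩, h3, h4⟩
      exact ⟨⟨⟨h1, h3⟩, h2.trans h4.symm⟩, h2⟩
  rw [h1, card_product]
  have h2 : 0 < #{i ∈ s | w i = y} := by
    obtain ⟨i, hi, rfl⟩ := mem_image.1 hy
    exact card_pos.2 ⟨i, by simp [hi]⟩
  have h3 : #{i ∈ s | w i = y} ≤ 2 := by
    by_contra h3
    obtain ⟨i, j, k, hi, hj, hk, hij, hik, hjk⟩ := two_lt_card_iff.1 (not_le.1 h3)
    simp only [mem_filter] at hi hj hk
    exact h i hi.1 j hj.1 k hk.1 hij hik hjk (hi.2.trans hj.2.symm) (hj.2.trans hk.2.symm)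
  rcases (show #{i ∈ s | w i = y} = 1 ∨ #{i ∈ s | w i = y} = 2 by omega) with h4 | h4 <;>
    simp [h4]

namespace SortSystem

variable {ι : Type*} [Fintype ι] {n : ℕ} (S : SortSystem ι n)

open scoped Classical in
/-- The number of elements that are not the first one of their class in the weak order `t`. -/
noncomputable def defect (t : ℤ) : ℕ :=
  #{j | ∃ i, S.F t i < S.F t j ∧ S.v t i = S.v t j}

open scoped Classical in
theorem defect_add_card_image (t : ℤ) :
    S.defect t + #(univ.image (S.v t)) = Fintype.card ι :=
  card_filter_exists_lt_add_card_image (S.inj t) _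

-- The defect is the number of elements minus the number of classes, so the order preceding the weak
-- order may be used instead of the following one.
open scoped Classical in
theorem defect_succ (t : ℤ) :
    S.defect (t + 1) = #{j | ∃ i, S.F t i < S.F t j ∧ S.v (t + 1) i = S.v (t + 1) j} := by
  have h1 := S.defect_add_card_image (t + 1)
  have h2 := card_filter_exists_lt_add_card_image (S.inj t) (S.v (t + 1))
  omega

theorem defect_add_period (t : ℤ) : S.defect (t + n) = S.defect t := by
  classical
  have h1 := S.defect_add_card_image (t + n)
  have h2 := S.defect_add_card_image t
  have h3 : #(univ.image (S.v (t + n))) = #(univ.image (S.v t)) := by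
    have : S.v (t + n) = Neg.neg ∘ S.v t := funext fun i => S.antiperiodic_v t i
    rw [this, ← image_image, card_image_of_injective _ neg_injective]
  omega

/-- Both defects are counted in the order `S.F t`. The two sets of non-first elements are disjoint
and miss the minimum. If they exhaust all other elements, each of these meets its immediate
predecessor at time t or t + 1. -/
theorem defect_add_defect_succ_le (hn : 2 ≤ n) (t : ℤ) :
    S.defect t + S.defect (t + 1) ≤ Fintype.card ι - 1 ∧
      (S.defect t + S.defect (t + 1) = Fintype.card ι - 1 → ∀ i j, S.F t i < S.F t j →
        (∀ k, ¬ (S.F t i < S.F t k ∧ S.F t k < S.F t j)) →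
        S.v t i = S.v t j ∨ S.v (t + 1) i = S.v (t + 1) j) := by
  classical
  rw [S.defect_succ, defect]
  set N : Finset ι := {j | ∃ i, S.F t i < S.F t j ∧ S.v t i = S.v t j} with hN
  set M : Finset ι := {j | ∃ i, S.F t i < S.F t j ∧ S.v (t + 1) i = S.v (t + 1) j} with hM
  have squeeze : ∀ w : ι → ℝ, Refines (S.F t) w → ∀ i j k, S.F t i ≤ S.F t k →
      S.F t k < S.F t j → w i = w j → w k = w j := by
    intro w hw i j k h1 h2 h3
    apply le_antisymm
    · exact not_lt.1 fun h => absurd (hw _ _ h) h2.not_gt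
    · rw [← h3]
      exact not_lt.1 fun h => absurd (hw _ _ h) h1.not_gt
  have hdisj : Disjoint N M := by
    rw [disjoint_left]
    intro j h1 h2
    simp only [hN, hM, mem_filter, mem_univ, true_and] at h1 h2
    obtain ⟨a, a1, a2⟩ := h1
    obtain ⟨b, b1, b2⟩ := h2
    -- The later of the two predecessors a, b lies, by convexity of classes, in the class of j at
    -- both times, contradicting `once`.
    obtain ⟨c, c1, c2, c3⟩ : ∃ c, S.F t c < S.F t j ∧ S.F t a ≤ S.F t c ∧ S.F t b ≤ S.F t c := by
      rcases le_total (S.F t a) (S.F t b) with h | h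
      · exact ⟨b, b1, h, le_rfl⟩
      · exact ⟨a, a1, le_rfl, h⟩
    have e1 := squeeze _ (S.refines_right t) _ _ _ c2 c1 a2
    have e2 := squeeze _ (S.refines_left t) _ _ _ c3 c1 b2
    have := S.once _ _ c j (fun e => by subst e; exact lt_irrefl _ c1) e1 e2 (by omega)
    omega
  rw [← card_union_of_disjoint hdisj]
  rcases isEmpty_or_nonempty ι with hι | hι
  · refine ⟨?_, fun _ i => hι.elim i⟩
    simp [eq_empty_of_isEmpty]
  obtain ⟨m, hm⟩ := Finite.exists_min (S.F t)
  have hmN : N ∪ M ⊆ univ.erase m := by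
    intro j hj
    simp only [hN, hM, mem_union, mem_filter, mem_univ, true_and] at hj
    rw [mem_erase]
    refine ⟨?_, mem_univ _⟩
    rintro rfl
    rcases hj with ⟨i, hi, -⟩ | ⟨i, hi, -⟩ <;> exact absurd hi (hm i).not_gt
  have hcard : #(univ.erase m) = Fintype.card ι - 1 := by
    rw [card_erase_of_mem (mem_univ _), card_univ]
  refine ⟨hcard ▸ card_le_card hmN, fun h i j hij hk => ?_⟩
  have heq := eq_of_subset_of_card_le hmN (by omega)
  have hj : j ∈ N ∪ M := by
    rw [heq, mem_erase]
    refine ⟨?_, mem_univ _⟩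
    rintro rfl
    exact absurd hij (hm i).not_gt
  simp only [hN, hM, mem_union, mem_filter, mem_univ, true_and] at hj
  have hle : ∀ k, S.F t k < S.F t j → S.F t k ≤ S.F t i := fun k h1 =>
    not_lt.1 fun h2 => hk k ⟨h2, h1⟩
  rcases hj with ⟨k, h1, h2⟩ | ⟨k, h1, h2⟩
  · exact Or.inl (squeeze _ (S.refines_right t) _ _ _ (hle k h1) hij h2)
  · exact Or.inr (squeeze _ (S.refines_left t) _ _ _ (hle k h1) hij h2)

/-- Summed over a half period, the defects of consecutive times are bounded by n (card - 1). If the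
total reaches this bound, every single inequality is an equality. -/
theorem neighboursMeet_of_sum_defect (hn : 2 ≤ n)
    (h : ∀ t : ℤ, n * (Fintype.card ι - 1) ≤ ∑ k ∈ range n, 2 * S.defect (t + k)) :
    S.NeighboursMeet := by
  intro t
  refine (S.defect_add_defect_succ_le hn t).2 ?_
  have h1 : ∑ k ∈ range n, 2 * S.defect (t + k) =
      ∑ k ∈ range n, (S.defect (t + k) + S.defect (t + k + 1)) := by
    have h2 := sum_range_succ (fun k : ℕ => S.defect (t + k)) n
    have h3 := sum_range_succ' (fun k : ℕ => S.defect (t + k)) n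
    rw [h2, S.defect_add_period] at h3
    simp only [Nat.cast_zero, add_zero, Nat.cast_succ, ← add_assoc] at h3
    rw [sum_add_distrib, ← mul_sum]
    omega
  have h2 : ∀ k ∈ range n, S.defect (t + k) + S.defect (t + k + 1) ≤ Fintype.card ι - 1 :=
    fun k _ => (S.defect_add_defect_succ_le hn (t + k)).1
  have h3 := (sum_eq_sum_iff_of_le h2).1 (le_antisymm (sum_le_sum h2) (by
    rw [← h1]
    simpa using h t)) 0 (by simp; omega)
  simpa using h3

open scoped Classical in
theorem card_filter_meet (t : ℤ) {i j : ι} (hij : i ≠ j) :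
    #{k ∈ range n | S.v (t + (k : ℕ)) i = S.v (t + (k : ℕ)) j} = 1 := by
  rw [card_eq_one]
  obtain ⟨u, h1, h2, h3⟩ := S.meet t i j
  refine ⟨(u - t).toNat, ?_⟩
  ext k
  simp only [mem_filter, mem_range, mem_singleton]
  constructor
  · rintro ⟨hk, he⟩
    rcases lt_trichotomy (t + k) u with h | h | h
    · have := S.once _ _ i j hij he h3 h
      omega
    · omega
    · have := S.once _ _ i j hij h3 he h
      omega
  · rintro rfl
    rw [Int.toNat_of_nonneg (by omega), add_sub_cancel]
    exact ⟨by omega, h3⟩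

-- During a half period a pair of distinct elements coincides once, while a diagonal pair is counted
-- n times.
open scoped Classical in
theorem sum_card_filter_eq (s : Finset ι) (t : ℤ) :
    ∑ k ∈ range n, #{p ∈ s ×ˢ s | S.v (t + k) p.1 = S.v (t + k) p.2} + #s =
      #s * (n + #s) := by
  simp only [card_filter]
  rw [sum_comm, sum_product]
  have h1 : ∀ i ∈ s, ∑ j ∈ s, ∑ k ∈ range n,
      (if S.v (t + (k : ℕ)) (i, j).1 = S.v (t + (k : ℕ)) (i, j).2 then 1 else 0) + 1 =
      n + #s := by
    intro i hi
    rw [← add_sum_erase s _ hi]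
    have h2 : ∀ j ∈ s.erase i, ∑ k ∈ range n,
        (if S.v (t + (k : ℕ)) (i, j).1 = S.v (t + (k : ℕ)) (i, j).2 then 1 else 0) = 1 := by
      intro j hj
      rw [← card_filter]
      exact S.card_filter_meet t (ne_of_mem_erase hj).symm
    rw [sum_congr rfl h2]
    simp only [if_true, sum_const, card_range, smul_eq_mul, mul_one, card_erase_of_mem hi]
    have := card_pos.2 ⟨i, hi⟩
    omega
  have h2 := sum_congr rfl h1
  rw [sum_add_distrib] at h2
  simpa using h2

open scoped Classical in
theorem sum_two_mul_card_image (s : Finset ι) (hs : #s = n) (t : ℤ)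
    (h : ∀ t, ∀ i ∈ s, ∀ j ∈ s, ∀ k ∈ s, i ≠ j → i ≠ k → j ≠ k → S.v t i = S.v t j →
      S.v t j ≠ S.v t k) :
    ∑ k ∈ range n, 2 * #(s.image (S.v (t + k))) = n * n + n := by
  have h1 := S.sum_card_filter_eq s t
  have h2 : ∑ k ∈ range n, (#{p ∈ s ×ˢ s | S.v (t + (k : ℕ)) p.1 = S.v (t + (k : ℕ)) p.2} +
      2 * #(s.image (S.v (t + (k : ℕ))))) = ∑ k ∈ range n, 3 * #s :=
    sum_congr rfl fun k _ => card_filter_eq_add_two_mul_card_image s _ (h _)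
  rw [sum_add_distrib, sum_const, card_range, smul_eq_mul, hs] at h2
  rw [hs] at h1
  nlinarith

/-- With classes of size at most two, twice the number of classes sums to n² + n over a half period.
So twice the defect sums to 2n² - (n² + n) = n(n - 1), the value needed. -/
theorem neighboursMeet_of_no_triple (hn : 2 ≤ n) (hcard : Fintype.card ι = n)
    (h : ∀ t i j k, i ≠ j → i ≠ k → j ≠ k → S.v t i = S.v t j → S.v t j ≠ S.v t k) :
    S.NeighboursMeet := by
  classical
  refine S.neighboursMeet_of_sum_defect hn fun t => ?_
  have h1 := S.sum_two_mul_card_image univ (by rw [card_univ, hcard]) t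
    fun t i _ j _ k _ => h t i j k
  have h2 : ∑ k ∈ range n, (2 * S.defect (t + (k : ℕ)) +
      2 * #(univ.image (S.v (t + (k : ℕ))))) = ∑ k ∈ range n, 2 * n :=
    sum_congr rfl fun k _ => by rw [← mul_add, S.defect_add_card_image, hcard]
  rw [sum_add_distrib, sum_const, card_range, smul_eq_mul, h1] at h2
  rw [hcard]
  obtain ⟨m, rfl⟩ : ∃ m, n = m + 1 := ⟨n - 1, by omega⟩
  simp only [add_tsub_cancel_right]
  nlinarith

/-- The n ordinary elements are counted as before. The additional element o contributes one more
defect at each time when it meets another element. This happens at least n / 2 times, since it meets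
n elements, at most two at once. -/
theorem neighboursMeet_of_no_triple_of_ne (hn : 2 ≤ n) (hcard : Fintype.card ι = n + 1) (o : ι)
    (h : ∀ t i j k, i ≠ o → j ≠ o → k ≠ o → i ≠ j → i ≠ k → j ≠ k → S.v t i = S.v t j →
      S.v t j ≠ S.v t k) : S.NeighboursMeet := by
  classical
  refine S.neighboursMeet_of_sum_defect hn fun t => ?_
  set s : Finset ι := univ.erase o with hs
  have hsn : #s = n := by rw [hs, card_erase_of_mem (mem_univ _), card_univ, hcard]; rfl
  have hso : ∀ i, i ∈ s ↔ i ≠ o := by simp [hs]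
  have h1 := S.sum_two_mul_card_image s hsn t fun t i hi j hj k hk =>
    h t i j k ((hso i).1 hi) ((hso j).1 hj) ((hso k).1 hk)
  -- Indicator of the times at which o is not alone in its class.
  let m : ℕ → ℕ := fun k => if ∃ i ∈ s, S.v (t + k) i = S.v (t + k) o then 1 else 0
  have h2 : ∀ k ∈ range n, 2 * n + 2 * m k ≤
      2 * S.defect (t + k) + 2 * #(s.image (S.v (t + k))) := by
    intro k _
    have e1 := S.defect_add_card_image (t + k)
    have e2 : univ.image (S.v (t + k)) = insert (S.v (t + k) o) (s.image (S.v (t + k))) := by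
      rw [← image_insert, hs, insert_erase (mem_univ _)]
    by_cases hm : ∃ i ∈ s, S.v (t + k) i = S.v (t + k) o
    · have e3 : m k = 1 := if_pos hm
      obtain ⟨i, hi, he⟩ := hm
      rw [insert_eq_of_mem (by rw [← he]; exact mem_image_of_mem _ hi)] at e2
      rw [e2] at e1
      omega
    · have e3 : m k = 0 := if_neg hm
      have := card_insert_le (S.v (t + k) o) (s.image (S.v (t + k)))
      rw [← e2] at this
      omega
  have h3 : n ≤ ∑ k ∈ range n, 2 * m k := by
    have hcover : s ⊆ (range n).biUnion fun k => {i ∈ s | S.v (t + k) i = S.v (t + k) o} := by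
      intro i hi
      obtain ⟨u, u1, u2, u3⟩ := S.meet t i o
      rw [mem_biUnion]
      refine ⟨(u - t).toNat, by simp; omega, ?_⟩
      rw [mem_filter, Int.toNat_of_nonneg (by omega), add_sub_cancel]
      exact ⟨hi, u3⟩
    calc n = #s := hsn.symm
      _ ≤ _ := card_le_card hcover
      _ ≤ _ := card_biUnion_le
      _ ≤ _ := sum_le_sum fun k _ => ?_
    by_cases hm : ∃ i ∈ s, S.v (t + k) i = S.v (t + k) o
    · have e3 : m k = 1 := if_pos hm
      rw [e3]
      by_contra hlt
      obtain ⟨i, j, l, hi, hj, hl, hij, hil, hjl⟩ := two_lt_card_iff.1 (not_le.1 hlt)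
      simp only [mem_filter, hso] at hi hj hl
      exact h _ i j l hi.1 hj.1 hl.1 hij hil hjl (hi.2.trans hj.2.symm) (hj.2.trans hl.2.symm)
    · rw [filter_eq_empty_iff.2 fun i hi he => hm ⟨i, hi, he⟩]
      simp
  have h4 := sum_le_sum h2
  simp only [sum_add_distrib] at h4
  rw [h1, sum_const, card_range, smul_eq_mul] at h4
  rw [hcard]
  simp only [add_tsub_cancel_right]
  nlinarith

end SortSystem

end Counting

namespace HyperplaneArrangement

open Module Real

/-! ### Fans: heights of graphs over the circle of directions -/

section Forms

variable {V : Type*} [AddCommGroup V] [Module ℝ V]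

/-- The form `y cos θ - x sin θ` in the coordinates given by `Φ`. -/
noncomputable def verticalForm (Φ : V ≃ₗ[ℝ] ℝ × ℝ × ℝ) (θ : ℝ) : V →ₗ[ℝ] ℝ :=
  (cos θ • (LinearMap.fst ℝ ℝ ℝ ∘ₗ LinearMap.snd ℝ ℝ (ℝ × ℝ)) -
    sin θ • LinearMap.fst ℝ ℝ (ℝ × ℝ)) ∘ₗ Φ.toLinearMap

/-- The form `z - a x - b y` in the coordinates given by `Φ`. -/
noncomputable def graphForm (Φ : V ≃ₗ[ℝ] ℝ × ℝ × ℝ) (a b : ℝ) : V →ₗ[ℝ] ℝ :=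
  (LinearMap.snd ℝ ℝ ℝ ∘ₗ LinearMap.snd ℝ ℝ (ℝ × ℝ) - a • LinearMap.fst ℝ ℝ (ℝ × ℝ) -
    b • (LinearMap.fst ℝ ℝ ℝ ∘ₗ LinearMap.snd ℝ ℝ (ℝ × ℝ))) ∘ₗ Φ.toLinearMap

theorem verticalForm_apply (Φ : V ≃ₗ[ℝ] ℝ × ℝ × ℝ) (θ : ℝ) (p : V) :
    verticalForm Φ θ p = cos θ * (Φ p).2.1 - sin θ * (Φ p).1 := by
  simp [verticalForm]

theorem graphForm_apply (Φ : V ≃ₗ[ℝ] ℝ × ℝ × ℝ) (a b : ℝ) (p : V) :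
    graphForm Φ a b p = (Φ p).2.2 - a * (Φ p).1 - b * (Φ p).2.1 := by
  simp [graphForm]

/-- Coordinates in which the hyperplanes of `A` containing a modular line are the vertical planes
of angles `α t`, and the other hyperplanes are the graphs of linear forms meeting over the vertical
planes. -/
structure Fan (A : HyperplaneArrangement ℝ V) (n : ℕ) (ι : Type*) where
  Φ : V ≃ₗ[ℝ] ℝ × ℝ × ℝ
  α : ℤ → ℝ
  a : ι → ℝ
  b : ι → ℝ
  strictMono : StrictMono α
  period : ∀ t, α (t + n) = α t + π
  mem_iff : ∀ H, H ∈ A.hyperplanes ↔ (∃ t, H = LinearMap.ker (verticalForm Φ (α t))) ∨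
    ∃ i, H = LinearMap.ker (graphForm Φ (a i) (b i))
  inj : ∀ i j, a i = a j → b i = b j → i = j
  meet : ∀ i j, ∃ t, a i * cos (α t) + b i * sin (α t) = a j * cos (α t) + b j * sin (α t)

namespace Fan

variable {A : HyperplaneArrangement ℝ V} {n : ℕ} {ι : Type*} (S : Fan A n ι)

/-- The height of the `i`-th graph over the point of angle `θ` of the unit circle. -/
noncomputable def height (i : ι) (θ : ℝ) : ℝ := S.a i * cos θ + S.b i * sin θ

/-- The angle in the middle between two consecutive vertical planes. -/
noncomputable def mid (t : ℤ) : ℝ := (S.α t + S.α (t + 1)) / 2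

theorem height_add_pi (i : ι) (θ : ℝ) : S.height i (θ + π) = -S.height i θ := by
  simp only [height, cos_add_pi, sin_add_pi]
  ring

theorem height_add_int_mul_pi (i : ι) (θ : ℝ) (k : ℤ) :
    S.height i (θ + k * π) = (-1) ^ k * S.height i θ := by
  simp only [height, cos_add_int_mul_pi, sin_add_int_mul_pi]
  ring

theorem pos (S : Fan A n ι) : 0 < n := by
  rcases Nat.eq_zero_or_pos n with rfl | h
  · have := S.period 0
    simp [pi_ne_zero] at this
  · exact h

theorem period_mul (t k : ℤ) : S.α (t + k * n) = S.α t + k * π := by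
  induction k using Int.induction_on with
  | zero => simp
  | succ k ih =>
    rw [show t + (k + 1) * n = t + k * n + n by ring, S.period, ih]
    push_cast
    ring
  | pred k ih =>
    have := S.period (t + (-k - 1) * n)
    rw [show t + (-k - 1) * n + n = t + -k * n by ring, ih] at this
    push_cast at this ⊢
    linarith

theorem lt_mid (t : ℤ) : S.α t < S.mid t := by
  have := S.strictMono (show t < t + 1 by omega)
  unfold mid
  linarith

theorem mid_lt (t : ℤ) : S.mid t < S.α (t + 1) := by
  have := S.strictMono (show t < t + 1 by omega)
  unfold mid
  linarith

theorem lt_add_pi {s t : ℤ} (h : t < s + n) : S.α t < S.α s + π := by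
  rw [← S.period]
  exact S.strictMono h

theorem le_add_pi {s t : ℤ} (h : t ≤ s + n) : S.α t ≤ S.α s + π := by
  rw [← S.period]
  exact S.strictMono.monotone h

/-- The difference of two heights is a sinusoid vanishing at the angle of a vertical plane, so it is
determined by this zero and a factor. Normalizing the zero to s ≤ t < s + n makes the signs over
sector t immediate. -/
theorem exists_sub_eq {i j : ι} (hij : i ≠ j) (t : ℤ) :
    ∃ (s : ℤ) (C : ℝ), C ≠ 0 ∧ s ≤ t ∧ t < s + n ∧
      ∀ θ, S.height j θ - S.height i θ = C * sin (θ - S.α s) := by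
  obtain ⟨u, hu⟩ := S.meet i j
  have hn : (0 : ℤ) < n := by exact_mod_cast S.pos
  -- Translation of the zero u by multiples of the half period into the window of length n ending at
  -- t.
  set s : ℤ := u + (t - u) / n * n with hs
  have h1 := Int.emod_add_mul_ediv (t - u) n
  have h2 := Int.emod_nonneg (t - u) hn.ne'
  have h3 := Int.emod_lt_of_pos (t - u) hn
  have h4 : (n : ℤ) * ((t - u) / n) = (t - u) / n * n := mul_comm _ _
  have hzero : S.height j (S.α s) - S.height i (S.α s) = 0 := by
    rw [hs, S.period_mul, S.height_add_int_mul_pi, S.height_add_int_mul_pi, ← mul_sub]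
    have : S.height j (S.α u) - S.height i (S.α u) = 0 := by
      unfold height
      linarith
    rw [this, mul_zero]
  unfold height at hzero
  -- The factor is the derivative of the height difference at its zero.
  refine ⟨s, (S.b j - S.b i) * cos (S.α s) - (S.a j - S.a i) * sin (S.α s), ?_, by omega, by omega,
    fun θ => ?_⟩
  · intro hC
    have e := sin_sq_add_cos_sq (S.α s)
    have h5 : S.b j - S.b i = 0 := by
      linear_combination (-(S.b j - S.b i)) * e + cos (S.α s) * hC + sin (S.α s) * hzero
    have h6 : S.a j - S.a i = 0 := by
      linear_combination (-(S.a j - S.a i)) * e - sin (S.α s) * hC + cos (S.α s) * hzero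
    exact hij (S.inj i j (by linarith) (by linarith))
  · have e := sin_sq_add_cos_sq (S.α s)
    unfold height
    rw [sin_sub]
    linear_combination (-(S.a j - S.a i) * cos θ - (S.b j - S.b i) * sin θ) * e
      + (cos θ * cos (S.α s) + sin θ * sin (S.α s)) * hzero

theorem eq_of_sin_eq_zero {s t : ℤ} (h1 : s ≤ t) (h2 : t < s + n)
    (h : sin (S.α t - S.α s) = 0) : s = t := by
  by_contra hne
  have h3 := S.strictMono (lt_of_le_of_ne h1 hne)
  have h4 := S.lt_add_pi h2
  exact (sin_pos_of_pos_of_lt_pi (by linarith) (by linarith)).ne' h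

theorem exists_sub_eq_of_height_eq {i j : ι} (hij : i ≠ j) {t : ℤ}
    (h : S.height i (S.α t) = S.height j (S.α t)) :
    ∃ C : ℝ, C ≠ 0 ∧ ∀ θ, S.height j θ - S.height i θ = C * sin (θ - S.α t) := by
  obtain ⟨s, C, hC, h1, h2, h3⟩ := S.exists_sub_eq hij t
  have h4 := h3 (S.α t)
  rw [h, sub_self] at h4
  obtain rfl := S.eq_of_sin_eq_zero h1 h2 ((mul_eq_zero.1 h4.symm).resolve_left hC)
  exact ⟨C, hC, h3⟩

/-- The sequence of orders of the graphs over the sectors between the vertical planes. -/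
noncomputable def sortSystem [Fintype ι] : SortSystem ι n where
  v t i := S.height i (S.α t)
  F t i := S.height i (S.mid t)
  inj t := by
    intro i j h
    by_contra hij
    obtain ⟨s, C, hC, h1, h2, h3⟩ := S.exists_sub_eq hij t
    have h4 := h3 (S.mid t)
    simp only at h
    rw [h, sub_self] at h4
    have h5 := (mul_eq_zero.1 h4.symm).resolve_left hC
    have h6 := S.strictMono.monotone h1
    have h7 := S.le_add_pi (show t + 1 ≤ s + n by omega)
    have := S.lt_mid t
    have := S.mid_lt t
    exact (sin_pos_of_pos_of_lt_pi (by linarith) (by linarith)).ne' h5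
  refines_right t i j h := by
    have hij : i ≠ j := by rintro rfl; exact lt_irrefl _ h
    obtain ⟨s, C, hC, h1, h2, h3⟩ := S.exists_sub_eq hij t
    have h4 := h3 (S.α t)
    have h6 := S.strictMono.monotone h1
    have h7 := S.le_add_pi (show t + 1 ≤ s + n by omega)
    have h8 := S.lt_mid t
    have h9 := S.mid_lt t
    have h10 : 0 ≤ sin (S.α t - S.α s) := sin_nonneg_of_nonneg_of_le_pi (by linarith) (by linarith)
    have h11 : 0 < C := by
      by_contra hneg
      nlinarith [mul_nonneg (neg_nonneg.2 (not_lt.1 hneg)) h10]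
    have := mul_pos h11 (sin_pos_of_pos_of_lt_pi (x := S.mid t - S.α s) (by linarith) (by linarith))
    have := h3 (S.mid t)
    linarith
  refines_left t i j h := by
    have hij : i ≠ j := by rintro rfl; exact lt_irrefl _ h
    obtain ⟨s, C, hC, h1, h2, h3⟩ := S.exists_sub_eq hij t
    have h4 := h3 (S.α (t + 1))
    have h6 := S.strictMono.monotone h1
    have h7 := S.le_add_pi (show t + 1 ≤ s + n by omega)
    have h8 := S.lt_mid t
    have h9 := S.mid_lt t
    have h10 : 0 ≤ sin (S.α (t + 1) - S.α s) :=
      sin_nonneg_of_nonneg_of_le_pi (by linarith) (by linarith)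
    have h11 : 0 < C := by
      by_contra hneg
      nlinarith [mul_nonneg (neg_nonneg.2 (not_lt.1 hneg)) h10]
    have := mul_pos h11 (sin_pos_of_pos_of_lt_pi (x := S.mid t - S.α s) (by linarith) (by linarith))
    have := h3 (S.mid t)
    linarith
  flip t i j hij h h' := by
    obtain ⟨C, hC, h3⟩ := S.exists_sub_eq_of_height_eq hij h
    have h4 := h3 (S.mid t)
    have h5 := h3 (S.mid (t + 1))
    have := S.pos
    have h6 := S.le_add_pi (show t + 1 ≤ t + n by omega)
    have h7 := S.le_add_pi (show t + 1 + 1 ≤ t + 1 + n by omega)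
    have h8 := S.lt_mid t
    have h9 := S.mid_lt t
    have h10 := S.lt_mid (t + 1)
    have h11 := S.mid_lt (t + 1)
    have h12 := sin_neg_of_neg_of_neg_pi_lt (x := S.mid t - S.α (t + 1)) (by linarith) (by linarith)
    have h13 := sin_pos_of_pos_of_lt_pi (x := S.mid (t + 1) - S.α (t + 1)) (by linarith)
      (by linarith)
    have h14 : C < 0 := by
      by_contra hneg
      nlinarith [mul_nonneg (not_lt.1 hneg) (neg_nonneg.2 h12.le)]
    have := mul_neg_of_neg_of_pos h14 h13
    linarith
  antiperiodic_v t i := by rw [S.period, S.height_add_pi]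
  antiperiodic_F t i := by
    rw [← S.height_add_pi, mid, mid, show t + (n : ℤ) + 1 = t + 1 + n by ring, S.period, S.period]
    congr 1
    ring
  meet t₀ i j := by
    by_cases hij : i = j
    · have := S.pos
      exact ⟨t₀, le_rfl, by omega, by rw [hij]⟩
    · obtain ⟨s, C, hC, h1, h2, h3⟩ := S.exists_sub_eq hij (t₀ + n - 1)
      have h4 := h3 (S.α s)
      rw [sub_self, sin_zero, mul_zero] at h4
      exact ⟨s, by omega, by omega, by linarith⟩
  once s t i j hij h h' hst := by
    obtain ⟨C, hC, h3⟩ := S.exists_sub_eq_of_height_eq hij h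
    by_contra hlt
    have h4 := h3 (S.α t)
    rw [h', sub_self] at h4
    have := S.eq_of_sin_eq_zero hst.le (not_le.1 hlt) ((mul_eq_zero.1 h4.symm).resolve_left hC)
    omega

end Fan

end Forms

end HyperplaneArrangement

namespace HyperplaneArrangement

open Module Real

/-! ### Simplicial cones and chambers cut out by linear forms -/

section Cones

variable {V : Type*} [AddCommGroup V] [Module ℝ V]

/-- Three forms without common zero are coordinates; the generators of the cone are the dual basis.
-/
theorem isOpenSimplicialCone_of_forms (hV : finrank ℝ V = 3) (w : Fin 3 → V →ₗ[ℝ] ℝ)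
    (hw : ∀ y, (∀ m, w m y = 0) → y = 0) : IsOpenSimplicialCone {y | ∀ m, 0 < w m y} := by
  have : FiniteDimensional ℝ V := FiniteDimensional.of_finrank_pos (by omega)
  have hinj : Function.Injective (LinearMap.pi w) := by
    rw [← LinearMap.ker_eq_bot, LinearMap.ker_eq_bot']
    intro y hy
    exact hw y fun m => congrFun hy m
  let e : V ≃ₗ[ℝ] Fin 3 → ℝ := LinearMap.linearEquivOfInjective (LinearMap.pi w) hinj (by simp [hV])
  refine ⟨(Basis.ofEquivFun e).reindex (finCongr hV.symm), ?_⟩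
  ext y
  simp only [Set.mem_ofPred_eq, Basis.repr_reindex_apply, Basis.ofEquivFun_repr_apply]
  constructor
  · intro h i
    exact h _
  · intro h m
    exact h (finCongr hV.symm m)

/-- Used to pass from the open cone to its closure, by adding small multiples of an inner point. -/
theorem nonneg_of_forall_pos {a c : ℝ} (h : ∀ ε > 0, 0 < a + ε * c) : 0 ≤ a := by
  by_contra ha
  have ha := not_le.1 ha
  have h1 := h 1 one_pos
  have hc : 0 < c := by linarith
  have h2 := h (-a / c) (div_pos (by linarith) hc)
  rw [div_mul_cancel₀ _ hc.ne'] at h2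
  linarith

/-- A cone over a quadrilateral is not simplicial. -/
theorem not_isOpenSimplicialCone_of_forms (hV : finrank ℝ V = 3) (w₀ w₁ : Bool → V →ₗ[ℝ] ℝ)
    (hne : ∃ y, ∀ p, 0 < w₀ p y ∧ 0 < w₁ p y)
    (hP : ∀ p q, ∃ P, P ≠ 0 ∧ w₀ p P = 0 ∧ w₁ q P = 0 ∧ 0 ≤ w₀ (!p) P ∧ 0 ≤ w₁ (!q) P)
    (h₀ : ∀ q y, (∀ p, w₀ p y = 0) → w₁ q y = 0 → y = 0)
    (h₁ : ∀ p y, w₀ p y = 0 → (∀ q, w₁ q y = 0) → y = 0) :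
    ¬ IsOpenSimplicialCone {y | ∀ p, 0 < w₀ p y ∧ 0 < w₁ p y} := by
  rintro ⟨b, hb⟩
  have hC : ∀ y, (∀ p, 0 < w₀ p y ∧ 0 < w₁ p y) ↔ ∀ m, 0 < b.repr y m := fun y =>
    Set.ext_iff.1 hb y
  obtain ⟨Q, hQ⟩ := hne
  have hQ' := (hC Q).1 hQ
  have hbasis : ∀ m p, 0 ≤ w₀ p (b m) ∧ 0 ≤ w₁ p (b m) := by
    intro m p
    have key : ∀ ε > (0 : ℝ), ∀ p, 0 < w₀ p (b m + ε • Q) ∧ 0 < w₁ p (b m + ε • Q) := by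
      intro ε hε
      rw [hC]
      intro k
      have := mul_pos hε (hQ' k)
      have h2 : 0 ≤ (b.repr (b m)) k := by
        rw [Basis.repr_self, Finsupp.single_apply]
        split_ifs <;> norm_num
      simp only [map_add, map_smul, Finsupp.add_apply, Finsupp.smul_apply, smul_eq_mul]
      linarith
    constructor
    · apply nonneg_of_forall_pos (c := w₀ p Q)
      intro ε hε
      simpa using (key ε hε p).1
    · apply nonneg_of_forall_pos (c := w₁ p Q)
      intro ε hε
      simpa using (key ε hε p).2
  -- A corner P has nonnegative coordinates in the basis. A wall form is nonnegative on the basis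
  -- and zero at P, so it vanishes on each basis vector that occurs in P.
  have hray : ∀ p q, ∃ m, w₀ p (b m) = 0 ∧ w₁ q (b m) = 0 := by
    intro p q
    obtain ⟨P, hP0, e1, e2, e3, e4⟩ := hP p q
    have hpos : ∀ m, 0 ≤ b.repr P m := by
      intro m
      apply nonneg_of_forall_pos (c := b.repr Q m)
      intro ε hε
      have h2 : ∀ p, 0 < w₀ p (P + ε • Q) ∧ 0 < w₁ p (P + ε • Q) := by
        intro p'
        have g1 := mul_pos hε (hQ p').1
        have g2 := mul_pos hε (hQ p').2
        have g3 : 0 ≤ w₀ p' P := by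
          rcases Bool.eq_or_eq_not p' p with h | h <;> rw [h]
          exacts [e1.ge, e3]
        have g4 : 0 ≤ w₁ p' P := by
          rcases Bool.eq_or_eq_not p' q with h | h <;> rw [h]
          exacts [e2.ge, e4]
        simp only [map_add, map_smul, smul_eq_mul]
        constructor <;> linarith
      have h3 := (hC _).1 h2 m
      simpa using h3
    obtain ⟨m, hm⟩ : ∃ m, b.repr P m ≠ 0 := by
      by_contra H
      push Not at H
      exact hP0 (b.repr.map_eq_zero_iff.1 (Finsupp.ext H))
    have hsum : ∀ w : V →ₗ[ℝ] ℝ, (∀ k, 0 ≤ w (b k)) → w P = 0 → w (b m) = 0 := by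
      intro w hw hwP
      rw [← b.sum_repr P, map_sum] at hwP
      simp only [map_smul, smul_eq_mul] at hwP
      have := (Finset.sum_eq_zero_iff_of_nonneg fun k _ => mul_nonneg (hpos k) (hw k)).1 hwP m
        (Finset.mem_univ _)
      exact (mul_eq_zero.1 this).resolve_left hm
    exact ⟨m, hsum _ (fun k => (hbasis k p).1) e1, hsum _ (fun k => (hbasis k q).2) e2⟩
  choose m hm using hray
  -- Four corners but three basis vectors: one basis vector serves two corners and lies on at least
  -- three walls, so it is zero.
  obtain ⟨⟨p, q⟩, ⟨p', q'⟩, hne, heq⟩ := Fintype.exists_ne_map_eq_of_card_lt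
    (fun x : Bool × Bool => m x.1 x.2) (by simp [hV])
  simp only at heq
  have f1 := hm p q
  have f2 := hm p' q'
  rw [← heq] at f2
  by_cases hp : p = p'
  · have hq : q' = !q := by
      rcases Bool.eq_or_eq_not q' q with h | h
      · exact absurd (by rw [hp, h]) hne
      · exact h
    refine b.ne_zero _ (h₁ p _ f1.1 fun r => ?_)
    rcases Bool.eq_or_eq_not r q with h | h
    · rw [h]; exact f1.2
    · rw [h, ← hq]; exact f2.2
  · have hp' : p' = !p := by
      rcases Bool.eq_or_eq_not p' p with h | h
      · exact absurd h.symm hp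
      · exact h
    refine b.ne_zero _ (h₀ q _ (fun r => ?_) f1.2)
    rcases Bool.eq_or_eq_not r p with h | h
    · rw [h]; exact f1.1
    · rw [h, ← hp']; exact f2.1

variable [TopologicalSpace V] [IsTopologicalAddGroup V] [ContinuousSMul ℝ V] [T2Space V]

/-- By the intermediate value theorem the component crosses no wall; the cone itself is convex,
hence connected. -/
theorem connectedComponentIn_complement_eq [FiniteDimensional ℝ V] (A : HyperplaneArrangement ℝ V)
    {κ : Type*} (w : κ → V →ₗ[ℝ] ℝ) (hw : ∀ k, ∃ H ∈ A.hyperplanes, ∀ y, w k y = 0 → y ∈ H)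
    (hsub : {y | ∀ k, 0 < w k y} ⊆ A.complement) {x : V} (hx : ∀ k, 0 < w k x) :
    connectedComponentIn A.complement x = {y | ∀ k, 0 < w k y} := by
  have hxC : x ∈ A.complement := hsub hx
  apply Set.Subset.antisymm
  · intro y hy k
    by_contra hneg
    have hc := isPreconnected_connectedComponentIn (x := x) (F := A.complement)
    obtain ⟨z, hz, hz0⟩ := hc.intermediate_value hy (mem_connectedComponentIn hxC)
      (w k).continuous_of_finiteDimensional.continuousOn ⟨not_lt.1 hneg, (hx k).le⟩
    obtain ⟨H, hH, hH'⟩ := hw k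
    exact connectedComponentIn_subset _ _ hz H hH (hH' z hz0)
  · have hconv : Convex ℝ {y | ∀ k, 0 < w k y} := by
      intro y hy z hz r s hr hs hrs k
      simp only [map_add, map_smul, smul_eq_mul]
      have h1 := hy k
      have h2 := hz k
      rcases hr.eq_or_lt with h3 | h3
      · have : s = 1 := by linarith
        subst this
        rw [← h3]
        linarith
      · exact add_pos_of_pos_of_nonneg (mul_pos h3 h1) (mul_nonneg hs h2.le)
    exact hconv.isPreconnected.subset_connectedComponentIn hx hsub

end Cones

/-! ### Chambers over a sector: simplicial implies that neighbours meet -/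

namespace Fan

variable {V : Type*} [AddCommGroup V] [Module ℝ V] {A : HyperplaneArrangement ℝ V} {n : ℕ}
  {ι : Type*} (S : Fan A n ι)

/-- The form defining the vertical plane `t`. -/
noncomputable abbrev U (t : ℤ) : V →ₗ[ℝ] ℝ := verticalForm S.Φ (S.α t)

/-- The form defining the `i`-th graph. -/
noncomputable abbrev G (i : ι) : V →ₗ[ℝ] ℝ := graphForm S.Φ (S.a i) (S.b i)

theorem ker_U_mem (t : ℤ) : LinearMap.ker (S.U t) ∈ A.hyperplanes :=
  (S.mem_iff _).2 (Or.inl ⟨t, rfl⟩)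

theorem ker_G_mem (i : ι) : LinearMap.ker (S.G i) ∈ A.hyperplanes :=
  (S.mem_iff _).2 (Or.inr ⟨i, rfl⟩)

theorem mem_complement_iff (p : V) :
    p ∈ A.complement ↔ (∀ t, S.U t p ≠ 0) ∧ ∀ i, S.G i p ≠ 0 := by
  constructor
  · intro h
    exact ⟨fun t => h _ (S.ker_U_mem t), fun i => h _ (S.ker_G_mem i)⟩
  · rintro ⟨h1, h2⟩ H hH
    rcases (S.mem_iff H).1 hH with ⟨t, rfl⟩ | ⟨i, rfl⟩
    · exact h1 t
    · exact h2 i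

theorem finrank_eq_three (S : Fan A n ι) : finrank ℝ V = 3 := by
  rw [S.Φ.finrank_eq]
  simp

/-- The point of angle `θ` and height `z`. -/
noncomputable def point (θ z : ℝ) : V := S.Φ.symm (cos θ, sin θ, z)

theorem U_point (t : ℤ) (θ z : ℝ) : S.U t (S.point θ z) = sin (θ - S.α t) := by
  simp only [U, point, verticalForm_apply, LinearEquiv.apply_symm_apply, sin_sub]
  ring

theorem G_point (i : ι) (θ z : ℝ) : S.G i (S.point θ z) = z - S.height i θ := by
  simp only [G, point, graphForm_apply, LinearEquiv.apply_symm_apply, height]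
  ring

theorem point_ne_zero (θ z : ℝ) : S.point θ z ≠ 0 := by
  intro h
  have h1 : ((cos θ, sin θ, z) : ℝ × ℝ × ℝ) = 0 := (S.Φ.symm.map_eq_zero_iff).1 h
  have h2 : cos θ = 0 := congrArg Prod.fst h1
  have h3 : sin θ = 0 := congrArg (fun q => q.2.1) h1
  have := sin_sq_add_cos_sq θ
  rw [h2, h3] at this
  norm_num at this

theorem sin_pos {s t : ℤ} (h1 : s < t) (h2 : t < s + n) : 0 < sin (S.α t - S.α s) := by
  have := S.strictMono h1
  have := S.lt_add_pi h2
  exact sin_pos_of_pos_of_lt_pi (by linarith) (by linarith)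

/-- Over a sector, `S.U t` and `-S.U (t + 1)` are positive. The identity therefore reduces the
comparison of two graphs to their heights over the two sides. -/
theorem sin_mul_sub (t : ℤ) (i j : ι) (p : V) :
    sin (S.α (t + 1) - S.α t) * (S.G i p - S.G j p) =
      -S.U (t + 1) p * (S.height j (S.α t) - S.height i (S.α t)) +
        S.U t p * (S.height j (S.α (t + 1)) - S.height i (S.α (t + 1))) := by
  simp only [verticalForm_apply, graphForm_apply, height, sin_sub]
  ring

theorem sin_mul_U (s t : ℤ) (p : V) :
    sin (S.α (t + 1) - S.α t) * S.U s p =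
      sin (S.α (t + 1) - S.α s) * S.U t p + sin (S.α s - S.α t) * S.U (t + 1) p := by
  simp only [verticalForm_apply, sin_sub]
  ring

theorem U_add_mul (t k : ℤ) (p : V) : S.U (t + k * n) p = (-1) ^ k * S.U t p := by
  simp only [verticalForm_apply, S.period_mul, cos_add_int_mul_pi, sin_add_int_mul_pi]
  ring

theorem eq_zero_of_forms (hn : 2 ≤ n) (t : ℤ) (i : ι) {p : V} (h1 : S.U t p = 0)
    (h2 : S.U (t + 1) p = 0) (h3 : S.G i p = 0) : p = 0 := by
  have hs := S.sin_pos (show t < t + 1 by omega) (by omega)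
  simp only [verticalForm_apply, graphForm_apply] at h1 h2 h3
  rw [sin_sub] at hs
  have hx : (S.Φ p).1 = 0 := by
    refine (mul_eq_zero.1 ?_).resolve_left hs.ne'
    linear_combination cos (S.α (t + 1)) * h1 - cos (S.α t) * h2
  have hy : (S.Φ p).2.1 = 0 := by
    refine (mul_eq_zero.1 ?_).resolve_left hs.ne'
    linear_combination sin (S.α (t + 1)) * h1 - sin (S.α t) * h2
  rw [hx, hy] at h3
  have hz : (S.Φ p).2.2 = 0 := by linarith
  exact S.Φ.map_eq_zero_iff.1 (Prod.ext hx (Prod.ext hy hz))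

theorem U_ne_zero (hn : 2 ≤ n) {t : ℤ} {p : V} (h1 : 0 < S.U t p) (h2 : S.U (t + 1) p < 0)
    (s : ℤ) : S.U s p ≠ 0 := by
  have hδ := S.sin_pos (show t < t + 1 by omega) (by omega)
  have hn' : (0 : ℤ) < n := by omega
  have e1 := Int.emod_add_mul_ediv (s - t) n
  have e2 := Int.emod_nonneg (s - t) hn'.ne'
  have e3 := Int.emod_lt_of_pos (s - t) hn'
  have e4 : (n : ℤ) * ((s - t) / n) = (s - t) / n * n := mul_comm _ _
  obtain ⟨u, k, rfl, h3, h4⟩ : ∃ u k : ℤ, s = u + k * n ∧ t ≤ u ∧ u < t + n :=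
    ⟨t + (s - t) % n, (s - t) / n, by omega, by omega, by omega⟩
  rw [S.U_add_mul]
  refine mul_ne_zero (zpow_ne_zero _ (by norm_num)) ?_
  rcases h3.eq_or_lt with rfl | h3
  · exact h1.ne'
  · have h5 := S.sin_mul_U u t p
    have h6 := mul_neg_of_pos_of_neg (S.sin_pos h3 h4) h2
    have h7 : sin (S.α (t + 1) - S.α u) ≤ 0 := by
      have := S.strictMono.monotone (show t + 1 ≤ u by omega)
      have := S.lt_add_pi (show u < t + 1 + n by omega)
      exact sin_nonpos_of_nonpos_of_neg_pi_le (by linarith) (by linarith)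
    have h8 := mul_nonneg (neg_nonneg.2 h7) h1.le
    intro h0
    rw [h0] at h5
    linarith

/-- In polar coordinates around the axis, t is the last index whose angle is at most that of p. -/
theorem exists_sector {p : V} (h : ∀ t, S.U t p ≠ 0) :
    ∃ t, 0 < S.U t p ∧ S.U (t + 1) p < 0 := by
  obtain ⟨r, θ, hr, hx, hy⟩ : ∃ r θ : ℝ, 0 ≤ r ∧ (S.Φ p).1 = r * cos θ ∧ (S.Φ p).2.1 = r * sin θ :=
    ⟨‖(⟨(S.Φ p).1, (S.Φ p).2.1⟩ : ℂ)‖, Complex.arg ⟨(S.Φ p).1, (S.Φ p).2.1⟩, norm_nonneg _,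
      by rw [Complex.norm_mul_cos_arg], by rw [Complex.norm_mul_sin_arg]⟩
  have hU : ∀ t, S.U t p = r * sin (θ - S.α t) := by
    intro t
    simp only [verticalForm_apply, hx, hy, sin_sub]
    ring
  have hr' : 0 < r := by
    refine hr.lt_of_ne ?_
    rintro rfl
    exact h 0 (by rw [hU, zero_mul])
  have hα : ∀ k : ℤ, S.α (k * n) = S.α 0 + k * π := by
    intro k
    have := S.period_mul 0 k
    rwa [zero_add] at this
  have hbd : ∃ u : ℤ, ∀ t, S.α t ≤ θ → t ≤ u := by
    obtain ⟨k, hk⟩ := exists_int_gt ((θ - S.α 0) / π)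
    refine ⟨k * n, fun t ht => ?_⟩
    by_contra hlt
    have h1 := S.strictMono (not_le.1 hlt)
    rw [hα] at h1
    rw [div_lt_iff₀ pi_pos] at hk
    linarith
  have hex : ∃ t, S.α t ≤ θ := by
    obtain ⟨k, hk⟩ := exists_int_lt ((θ - S.α 0) / π)
    refine ⟨k * n, ?_⟩
    rw [lt_div_iff₀ pi_pos] at hk
    rw [hα]
    linarith
  obtain ⟨t, ht, hmax⟩ := Int.exists_greatest_of_bdd hbd hex
  have hn := S.pos
  have h1 : θ < S.α (t + 1) := by
    by_contra hle
    have := hmax _ (not_lt.1 hle)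
    omega
  have h2 : S.α t < θ := by
    refine ht.lt_of_ne fun e => h t ?_
    rw [hU, e, sub_self, sin_zero, mul_zero]
  have h3 := S.le_add_pi (show t + 1 ≤ t + n by omega)
  refine ⟨t, ?_, ?_⟩
  · rw [hU]
    exact mul_pos hr' (sin_pos_of_pos_of_lt_pi (by linarith) (by linarith))
  · rw [hU]
    exact mul_neg_of_pos_of_neg hr' (sin_neg_of_neg_of_neg_pi_lt (by linarith) (by linarith))

theorem U_mid (t : ℤ) (z : ℝ) :
    0 < S.U t (S.point (S.mid t) z) ∧ S.U (t + 1) (S.point (S.mid t) z) < 0 := by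
  have h1 := S.lt_mid t
  have h2 := S.mid_lt t
  have := S.pos
  have h3 := S.le_add_pi (show t + 1 ≤ t + n by omega)
  rw [U_point, U_point]
  exact ⟨sin_pos_of_pos_of_lt_pi (by linarith) (by linarith),
    sin_neg_of_neg_of_neg_pi_lt (by linarith) (by linarith)⟩

section Simplicial

variable [Fintype ι]

/-- The order measured at the middle angle holds over the whole sector: two graphs are weakly
ordered over both sides, and by `once` strictly over at least one. -/
theorem G_lt_G (hn : 2 ≤ n) {t : ℤ} {p : V} (h1 : 0 < S.U t p) (h2 : S.U (t + 1) p < 0)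
    {i j : ι} (hij : S.sortSystem.F t i < S.sortSystem.F t j) : S.G j p < S.G i p := by
  have hδ := S.sin_pos (show t < t + 1 by omega) (by omega)
  have hne : i ≠ j := by rintro rfl; exact lt_irrefl _ hij
  have h3 : S.sortSystem.v t i ≤ S.sortSystem.v t j :=
    not_lt.1 fun h => lt_asymm hij (S.sortSystem.refines_right t _ _ h)
  have h4 : S.sortSystem.v (t + 1) i ≤ S.sortSystem.v (t + 1) j :=
    not_lt.1 fun h => lt_asymm hij (S.sortSystem.refines_left t _ _ h)
  have key := S.sin_mul_sub t i j p
  have h5 : 0 < -S.U (t + 1) p * (S.height j (S.α t) - S.height i (S.α t)) +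
        S.U t p * (S.height j (S.α (t + 1)) - S.height i (S.α (t + 1))) := by
    rcases h3.eq_or_lt with h3' | h3'
    · have h4' : S.sortSystem.v (t + 1) i < S.sortSystem.v (t + 1) j := by
        refine h4.lt_of_ne fun h4' => ?_
        have := S.sortSystem.once _ _ i j hne h3' h4' (by omega)
        omega
      exact add_pos_of_nonneg_of_pos (mul_nonneg (by linarith) (sub_nonneg.2 h3))
        (mul_pos h1 (sub_pos.2 h4'))
    · exact add_pos_of_pos_of_nonneg (mul_pos (by linarith) (sub_pos.2 h3'))
        (mul_nonneg h1.le (sub_nonneg.2 h4))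
  rw [← key] at h5
  have := pos_of_mul_pos_right h5 hδ.le
  linarith

theorem G_le_G (hn : 2 ≤ n) {t : ℤ} {p : V} (h1 : 0 < S.U t p) (h2 : S.U (t + 1) p < 0)
    {i j : ι} (hij : S.sortSystem.F t i ≤ S.sortSystem.F t j) : S.G j p ≤ S.G i p := by
  rcases hij.eq_or_lt with h | h
  · rw [S.sortSystem.inj t h]
  · exact (S.G_lt_G hn h1 h2 h).le

variable [TopologicalSpace V] [IsTopologicalAddGroup V] [ContinuousSMul ℝ V] [T2Space V]

/-- If adjacent graphs met over neither side of the sector, the chamber between them would be a cone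
over a quadrilateral, with corners where each graph meets each side. -/
theorem neighboursMeet_of_isSimplicial (hn : 2 ≤ n) (hA : A.IsSimplicial) :
    S.sortSystem.NeighboursMeet := by
  have hV := S.finrank_eq_three
  have : FiniteDimensional ℝ V := FiniteDimensional.of_finrank_pos (by omega)
  intro t i j hij hadj
  by_contra hno
  push Not at hno
  have hδ := S.sin_pos (show t < t + 1 by omega) (by omega)
  have d0 : S.height i (S.α t) < S.height j (S.α t) := lt_of_le_of_ne
    (not_lt.1 fun h => lt_asymm hij (S.sortSystem.refines_right t _ _ h)) hno.1
  have d1 : S.height i (S.α (t + 1)) < S.height j (S.α (t + 1)) := lt_of_le_of_ne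
    (not_lt.1 fun h => lt_asymm hij (S.sortSystem.refines_left t _ _ h)) hno.2
  let w₀ : Bool → V →ₗ[ℝ] ℝ := fun p => if p then S.U t else -S.U (t + 1)
  let w₁ : Bool → V →ₗ[ℝ] ℝ := fun p => if p then S.G i else -S.G j
  let w : Bool × Bool → V →ₗ[ℝ] ℝ := fun x => if x.1 then w₀ x.2 else w₁ x.2
  have hw : ∀ y, (∀ k, 0 < w k y) ↔ 0 < S.U t y ∧ S.U (t + 1) y < 0 ∧ 0 < S.G i y ∧ S.G j y < 0 := by
    intro y
    simp only [w, w₀, w₁, Prod.forall, Bool.forall_bool]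
    simp only [Bool.false_eq_true, if_false, if_true, LinearMap.neg_apply, neg_pos]
    tauto
  have hmid : ∀ k, 0 < w k (S.point (S.mid t) ((S.height i (S.mid t) + S.height j (S.mid t)) / 2)) := by
    rw [hw]
    have hij' : S.height i (S.mid t) < S.height j (S.mid t) := hij
    refine ⟨(S.U_mid t _).1, (S.U_mid t _).2, ?_, ?_⟩ <;> rw [G_point] <;> linarith
  have hsub : {y | ∀ k, 0 < w k y} ⊆ A.complement := by
    intro y hy
    obtain ⟨g1, g2, g3, g4⟩ := (hw y).1 hy
    rw [S.mem_complement_iff]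
    refine ⟨S.U_ne_zero hn g1 g2, fun k => ?_⟩
    rcases le_or_gt (S.sortSystem.F t k) (S.sortSystem.F t i) with h | h
    · exact (g3.trans_le (S.G_le_G hn g1 g2 h)).ne'
    · have h' : S.sortSystem.F t j ≤ S.sortSystem.F t k := not_lt.1 fun h' => hadj k ⟨h, h'⟩
      exact ((S.G_le_G hn g1 g2 h').trans_lt g4).ne
  have hcomp := A.connectedComponentIn_complement_eq w (by
    rintro ⟨p, q⟩
    cases p <;> cases q
    · exact ⟨_, S.ker_G_mem j, fun y hy => by simpa [w, w₁] using hy⟩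
    · exact ⟨_, S.ker_G_mem i, fun y hy => by simpa [w, w₁] using hy⟩
    · exact ⟨_, S.ker_U_mem (t + 1), fun y hy => by simpa [w, w₀] using hy⟩
    · exact ⟨_, S.ker_U_mem t, fun y hy => by simpa [w, w₀] using hy⟩) hsub hmid
  have hcone := hA _ ⟨_, hsub hmid, rfl⟩
  rw [hcomp] at hcone
  have hset : {y | ∀ k, 0 < w k y} = {y | ∀ p, 0 < w₀ p y ∧ 0 < w₁ p y} := by
    ext y
    simp only [w, Set.mem_ofPred_eq, Prod.forall, Bool.forall_bool]
    simp only [Bool.false_eq_true, if_false, if_true]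
    tauto
  rw [hset] at hcone
  refine not_isOpenSimplicialCone_of_forms hV w₀ w₁ ?_ ?_ ?_ ?_ hcone
  · exact ⟨_, (Set.ext_iff.1 hset _).1 hmid⟩
  · intro p q
    have hs : sin (S.α t - S.α (t + 1)) = -sin (S.α (t + 1) - S.α t) := by rw [← sin_neg, neg_sub]
    cases p <;> cases q
    · refine ⟨S.point (S.α (t + 1)) (S.height j (S.α (t + 1))), S.point_ne_zero _ _, ?_, ?_, ?_, ?_⟩ <;>
        simp only [w₀, w₁, Bool.not_false, Bool.false_eq_true, if_false, if_true,
          LinearMap.neg_apply, U_point, G_point, sub_self, sin_zero, neg_zero] <;> linarith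
    · refine ⟨S.point (S.α (t + 1)) (S.height i (S.α (t + 1))), S.point_ne_zero _ _, ?_, ?_, ?_, ?_⟩ <;>
        simp only [w₀, w₁, Bool.not_false, Bool.not_true, Bool.false_eq_true, if_false, if_true,
          LinearMap.neg_apply, U_point, G_point, sub_self, sin_zero, neg_zero] <;> linarith
    · refine ⟨S.point (S.α t) (S.height j (S.α t)), S.point_ne_zero _ _, ?_, ?_, ?_, ?_⟩ <;>
        simp only [w₀, w₁, Bool.not_false, Bool.not_true, Bool.false_eq_true, if_false, if_true,
          LinearMap.neg_apply, U_point, G_point, sub_self, sin_zero, neg_zero] <;> linarith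
    · refine ⟨S.point (S.α t) (S.height i (S.α t)), S.point_ne_zero _ _, ?_, ?_, ?_, ?_⟩ <;>
        simp only [w₀, w₁, Bool.not_true, Bool.false_eq_true, if_false, if_true,
          LinearMap.neg_apply, U_point, G_point, sub_self, sin_zero] <;> linarith
  · intro q y h0 h1
    have e1 : S.U t y = 0 := h0 true
    have e2 : S.U (t + 1) y = 0 := by simpa [w₀] using h0 false
    cases q
    · exact S.eq_zero_of_forms hn t j e1 e2 (by simpa [w₁] using h1)
    · exact S.eq_zero_of_forms hn t i e1 e2 h1
  · intro p y h0 h1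
    have e1 : S.G i y = 0 := h1 true
    have e2 : S.G j y = 0 := by simpa [w₁] using h1 false
    have key := S.sin_mul_sub t i j y
    rw [e1, e2, sub_self, mul_zero] at key
    cases p
    · have e3 : S.U (t + 1) y = 0 := by simpa [w₀] using h0
      rw [e3, neg_zero, zero_mul, zero_add] at key
      have e4 := (mul_eq_zero.1 key.symm).resolve_right (by linarith)
      exact S.eq_zero_of_forms hn t i e4 e3 e1
    · have e3 : S.U t y = 0 := h0
      rw [e3, zero_mul, add_zero] at key
      have e4 := (mul_eq_zero.1 key.symm).resolve_right (by linarith)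
      exact S.eq_zero_of_forms hn t i e3 (neg_eq_zero.1 e4) e1

end Simplicial

end Fan

end HyperplaneArrangement

namespace HyperplaneArrangement

open Module Real

/-! ### Neighbours that meet give simplicial chambers -/

namespace Fan

variable {V : Type*} [AddCommGroup V] [Module ℝ V] {A : HyperplaneArrangement ℝ V} {n : ℕ}
  {ι : Type*} (S : Fan A n ι)

variable [TopologicalSpace V] [IsTopologicalAddGroup V] [ContinuousSMul ℝ V] [T2Space V]

theorem isOpenSimplicialCone_of_forms (S : Fan A n ι) (w₁ w₂ w₃ : V →ₗ[ℝ] ℝ)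
    (h₁ : ∃ H ∈ A.hyperplanes, ∀ y, w₁ y = 0 → y ∈ H)
    (h₂ : ∃ H ∈ A.hyperplanes, ∀ y, w₂ y = 0 → y ∈ H)
    (h₃ : ∃ H ∈ A.hyperplanes, ∀ y, w₃ y = 0 → y ∈ H)
    (hker : ∀ y, w₁ y = 0 → w₂ y = 0 → w₃ y = 0 → y = 0) {x : V} (x₁ : 0 < w₁ x) (x₂ : 0 < w₂ x)
    (x₃ : 0 < w₃ x) (hsub : ∀ y, 0 < w₁ y → 0 < w₂ y → 0 < w₃ y → y ∈ A.complement) :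
    IsOpenSimplicialCone (connectedComponentIn A.complement x) := by
  have hV := S.finrank_eq_three
  have : FiniteDimensional ℝ V := FiniteDimensional.of_finrank_pos (by omega)
  rw [A.connectedComponentIn_complement_eq ![w₁, w₂, w₃]
    (Fin.forall_fin_succ.2 ⟨h₁, Fin.forall_fin_succ.2 ⟨h₂, Fin.forall_fin_succ.2 ⟨h₃, nofun⟩⟩⟩)
    (fun y hy => hsub y (hy 0) (hy 1) (hy 2))
    (Fin.forall_fin_succ.2 ⟨x₁, Fin.forall_fin_succ.2 ⟨x₂, Fin.forall_fin_succ.2 ⟨x₃, nofun⟩⟩⟩)]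
  exact HyperplaneArrangement.isOpenSimplicialCone_of_forms hV _
    fun y hy => hker y (hy 0) (hy 1) (hy 2)

/-- A chamber below or above all graphs is bounded by two sides and one graph. Between adjacent
graphs, the side over which they meet is not a wall, so three walls remain. -/
theorem isSimplicial_of_neighboursMeet [Fintype ι] [Nonempty ι] (hn : 2 ≤ n)
    (h : S.sortSystem.NeighboursMeet) : A.IsSimplicial := by
  classical
  rintro C ⟨x, hx, rfl⟩
  obtain ⟨hxU, hxG⟩ := (S.mem_complement_iff x).1 hx
  obtain ⟨t, ht₁, ht₂⟩ := S.exists_sector hxU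
  have kerU : ∀ t, ∃ H ∈ A.hyperplanes, ∀ y, S.U t y = 0 → y ∈ H :=
    fun t => ⟨_, S.ker_U_mem t, fun y hy => hy⟩
  have kerG : ∀ i, ∃ H ∈ A.hyperplanes, ∀ y, S.G i y = 0 → y ∈ H :=
    fun i => ⟨_, S.ker_G_mem i, fun y hy => hy⟩
  have kerU' : ∀ t, ∃ H ∈ A.hyperplanes, ∀ y, (-S.U t) y = 0 → y ∈ H :=
    fun t => ⟨_, S.ker_U_mem t, fun y hy => neg_eq_zero.1 hy⟩
  have kerG' : ∀ i, ∃ H ∈ A.hyperplanes, ∀ y, (-S.G i) y = 0 → y ∈ H :=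
    fun i => ⟨_, S.ker_G_mem i, fun y hy => neg_eq_zero.1 hy⟩
  have hx₂ : 0 < (-S.U (t + 1)) x := neg_pos.2 ht₂
  by_cases hlow : ∃ i, 0 < S.G i x
  swap
  · push Not at hlow
    obtain ⟨j, hj⟩ := Finite.exists_min (S.sortSystem.F t)
    refine S.isOpenSimplicialCone_of_forms (S.U t) (-S.U (t + 1)) (-S.G j) (kerU _) (kerU' _)
      (kerG' _) ?_ ht₁ hx₂ (neg_pos.2 ((hlow j).lt_of_ne (hxG j))) ?_
    · intro y h1 h2 h3
      exact S.eq_zero_of_forms hn t j h1 (neg_eq_zero.1 h2) (neg_eq_zero.1 h3)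
    · intro y h1 h2 h3
      rw [LinearMap.neg_apply, neg_pos] at h2 h3
      rw [S.mem_complement_iff]
      exact ⟨S.U_ne_zero hn h1 h2, fun k => ((S.G_le_G hn h1 h2 (hj k)).trans_lt h3).ne⟩
  by_cases hup : ∃ j, S.G j x < 0
  swap
  · push Not at hup
    obtain ⟨i, hi⟩ := Finite.exists_max (S.sortSystem.F t)
    refine S.isOpenSimplicialCone_of_forms (S.U t) (-S.U (t + 1)) (S.G i) (kerU _) (kerU' _)
      (kerG _) ?_ ht₁ hx₂ ((hup i).lt_of_ne' (hxG i)) ?_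
    · intro y h1 h2 h3
      exact S.eq_zero_of_forms hn t i h1 (neg_eq_zero.1 h2) h3
    · intro y h1 h2 h3
      rw [LinearMap.neg_apply, neg_pos] at h2
      rw [S.mem_complement_iff]
      exact ⟨S.U_ne_zero hn h1 h2, fun k => (h3.trans_le (S.G_le_G hn h1 h2 (hi k))).ne'⟩
  obtain ⟨i, hi, himax⟩ := Finset.exists_max_image (Finset.univ.filter fun i => 0 < S.G i x)
    (S.sortSystem.F t) (by obtain ⟨i, hi⟩ := hlow; exact ⟨i, by simpa using hi⟩)
  obtain ⟨j, hj, hjmin⟩ := Finset.exists_min_image (Finset.univ.filter fun j => S.G j x < 0)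
    (S.sortSystem.F t) (by obtain ⟨j, hj⟩ := hup; exact ⟨j, by simpa using hj⟩)
  simp only [Finset.mem_filter, Finset.mem_univ, true_and] at hi himax hj hjmin
  have hij : S.sortSystem.F t i < S.sortSystem.F t j := by
    by_contra hle
    have := S.G_le_G hn ht₁ ht₂ (not_lt.1 hle)
    linarith
  have hcases : ∀ k, S.sortSystem.F t k ≤ S.sortSystem.F t i ∨
      S.sortSystem.F t j ≤ S.sortSystem.F t k := fun k =>
    (lt_or_gt_of_ne (hxG k)).symm.imp (himax k) (hjmin k)
  have hsub : ∀ y, 0 < S.U t y → S.U (t + 1) y < 0 → 0 < S.G i y → S.G j y < 0 →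
      y ∈ A.complement := by
    intro y h1 h2 h3 h4
    rw [S.mem_complement_iff]
    refine ⟨S.U_ne_zero hn h1 h2, fun k => ?_⟩
    rcases hcases k with hk | hk
    · exact (h3.trans_le (S.G_le_G hn h1 h2 hk)).ne'
    · exact ((S.G_le_G hn h1 h2 hk).trans_lt h4).ne
  have hδ := S.sin_pos (show t < t + 1 by omega) (by omega)
  have hne : i ≠ j := by rintro rfl; exact lt_irrefl _ hij
  have key := S.sin_mul_sub t i j
  have hadj := h t i j hij fun k hk => by
    rcases hcases k with h1 | h1
    · exact h1.not_gt hk.1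
    · exact h1.not_gt hk.2
  have honce : S.sortSystem.v t i = S.sortSystem.v t j →
      S.sortSystem.v (t + 1) i ≠ S.sortSystem.v (t + 1) j := fun e1 e2 => by
    have := S.sortSystem.once _ _ i j hne e1 e2 (by omega)
    omega
  rcases hadj with he | he
  · have d1 : S.height i (S.α (t + 1)) < S.height j (S.α (t + 1)) := lt_of_le_of_ne
      (not_lt.1 fun h => lt_asymm hij (S.sortSystem.refines_left t _ _ h)) (honce he)
    have d0 : S.height j (S.α t) - S.height i (S.α t) = 0 := sub_eq_zero.2 he.symm
    -- Now the difference of the two graph forms is a positive multiple of `S.U t`, so the two graph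
    -- inequalities imply the one for this side.
    simp only [d0, mul_zero, zero_add] at key
    refine S.isOpenSimplicialCone_of_forms (-S.U (t + 1)) (S.G i) (-S.G j) (kerU' _) (kerG _)
      (kerG' _) ?_ hx₂ hi (neg_pos.2 hj) ?_
    · intro y h1 h2 h3
      have e := key y
      rw [h2, neg_eq_zero.1 h3, sub_self, mul_zero] at e
      exact S.eq_zero_of_forms hn t i ((mul_eq_zero.1 e.symm).resolve_right (sub_pos.2 d1).ne')
        (neg_eq_zero.1 h1) h2
    · intro y h1 h2 h3
      rw [LinearMap.neg_apply, neg_pos] at h1 h3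
      refine hsub y (pos_of_mul_pos_left ?_ (sub_pos.2 d1).le) h1 h2 h3
      rw [← key]
      exact mul_pos hδ (by linarith)
  · have d0 : S.height i (S.α t) < S.height j (S.α t) := lt_of_le_of_ne
      (not_lt.1 fun h => lt_asymm hij (S.sortSystem.refines_right t _ _ h))
      fun e => honce e he
    have d1 : S.height j (S.α (t + 1)) - S.height i (S.α (t + 1)) = 0 := sub_eq_zero.2 he.symm
    simp only [d1, mul_zero, add_zero] at key
    refine S.isOpenSimplicialCone_of_forms (S.U t) (S.G i) (-S.G j) (kerU _) (kerG _)
      (kerG' _) ?_ ht₁ hi (neg_pos.2 hj) ?_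
    · intro y h1 h2 h3
      have e := key y
      rw [h2, neg_eq_zero.1 h3, sub_self, mul_zero] at e
      exact S.eq_zero_of_forms hn t i h1
        (neg_eq_zero.1 ((mul_eq_zero.1 e.symm).resolve_right (sub_pos.2 d0).ne')) h2
    · intro y h1 h2 h3
      rw [LinearMap.neg_apply, neg_pos] at h3
      refine hsub y h1 (neg_pos.1 (pos_of_mul_pos_left ?_ (sub_pos.2 d0).le)) h2 h3
      rw [← key]
      exact mul_pos hδ (by linarith)

end Fan

end HyperplaneArrangement

/-! ### Incidence in a fan -/

namespace HyperplaneArrangement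

open Module Real

/-- Incidence between vertical planes and graphs, in terms of the relation of meeting over a
vertical plane. -/
def Incidence {n : ℕ} {ι : Type*} (r : Fin n → ι → ι → Prop) :
    Fin n ⊕ ι → Fin n ⊕ ι → Fin n ⊕ ι → Prop
  | .inl _, .inl _, .inl _ => True
  | .inl _, .inl _, .inr _ => False
  | .inl k, .inr _, .inl m => k = m
  | .inl k, .inr i, .inr j => r k i j
  | .inr _, .inl k, .inl m => k = m
  | .inr i, .inl k, .inr j => r k i j
  | .inr i, .inr j, .inl m => r m i j
  | .inr i, .inr j, .inr l => ∃ k, r k i j ∧ r k i l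

theorem incidence_congr {n : ℕ} {ι ι' : Type*} {r : Fin n → ι → ι → Prop}
    {r' : Fin n → ι' → ι' → Prop} (g : ι → ι') (h : ∀ k i j, r k i j ↔ r' k (g i) (g j))
    (x y z : Fin n ⊕ ι) :
    Incidence r x y z ↔ Incidence r' (Sum.map id g x) (Sum.map id g y) (Sum.map id g z) := by
  rcases x with x | x <;> rcases y with y | y <;> rcases z with z | z <;>
    simp [Incidence, h]

section

variable {V : Type*} [AddCommGroup V] [Module ℝ V] {A : HyperplaneArrangement ℝ V}

/-- The meet of two planes is a line, so one nonzero point of it decides containment. -/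
theorem inf_le_iff_mem (hV : finrank ℝ V = 3) {H₁ H₂ : Submodule ℝ V} (h₁ : H₁ ∈ A.hyperplanes)
    (h₂ : H₂ ∈ A.hyperplanes) (hne : H₁ ≠ H₂) {p : V} (hp : p ≠ 0) (hp₁ : p ∈ H₁) (hp₂ : p ∈ H₂)
    (K : Submodule ℝ V) : H₁ ⊓ H₂ ≤ K ↔ p ∈ K := by
  refine ⟨fun h => h ⟨hp₁, hp₂⟩, fun h q hq => ?_⟩
  have h1 := A.finrank_inf_hyperplane hV h₁ h₂ hne
  obtain ⟨c, hc⟩ := (finrank_eq_one_iff_of_nonzero' (⟨p, hp₁, hp₂⟩ : (H₁ ⊓ H₂ : Submodule ℝ V))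
    (fun e => hp (congrArg Subtype.val e))).1 h1 ⟨q, hq⟩
  have h2 : c • p = q := congrArg Subtype.val hc
  rw [← h2]
  exact K.smul_mem c h

theorem exists_form_of_hyperplane {H : Submodule ℝ V} (hH : H ∈ A.hyperplanes) :
    ∃ φ : V →ₗ[ℝ] ℝ, LinearMap.ker φ = H := by
  have h1 := A.codim_eq_one H hH
  have : FiniteDimensional ℝ (V ⧸ H) := FiniteDimensional.of_finrank_pos (by omega)
  let e : (V ⧸ H) ≃ₗ[ℝ] ℝ := LinearEquiv.ofFinrankEq _ _ (by rw [h1, finrank_self])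
  exact ⟨e.toLinearMap ∘ₗ H.mkQ, by rw [LinearEquiv.ker_comp, Submodule.ker_mkQ]⟩

end

namespace Fan

variable {V : Type*} [AddCommGroup V] [Module ℝ V] {A : HyperplaneArrangement ℝ V} {n : ℕ}
  {ι : Type*} (S : Fan A n ι)

/-- The hyperplanes of `A`, where the numbering of the vertical planes starts with `s`. -/
noncomputable def plane (s : ℤ) : Fin n ⊕ ι → Submodule ℝ V
  | .inl k => LinearMap.ker (S.U (s + (k : ℕ) + 1))
  | .inr i => LinearMap.ker (S.G i)

theorem vertex_U (t : ℤ) : S.Φ.symm (0, 0, 1) ∈ LinearMap.ker (S.U t) := by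
  simp [verticalForm_apply]

theorem vertex_G (i : ι) : S.Φ.symm (0, 0, 1) ∉ LinearMap.ker (S.G i) := by
  simp [graphForm_apply]

theorem vertex_ne_zero : S.Φ.symm (0, 0, 1) ≠ 0 := by
  intro h
  have := S.Φ.symm.map_eq_zero_iff.1 h
  simp at this

theorem point_mem_U {s t : ℤ} (h1 : s < t + n) (h2 : t < s + n) (z : ℝ) :
    S.point (S.α t) z ∈ LinearMap.ker (S.U s) ↔ s = t := by
  rw [LinearMap.mem_ker, U_point]
  constructor
  · intro h
    rcases le_total s t with h3 | h3
    · exact S.eq_of_sin_eq_zero h3 h2 h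
    · refine (S.eq_of_sin_eq_zero h3 h1 ?_).symm
      rw [← neg_sub, sin_neg, h, neg_zero]
  · rintro rfl
    rw [sub_self, sin_zero]

theorem point_mem_G (t : ℤ) (i j : ι) :
    S.point (S.α t) (S.height i (S.α t)) ∈ LinearMap.ker (S.G j) ↔
      S.height i (S.α t) = S.height j (S.α t) := by
  rw [LinearMap.mem_ker, G_point, sub_eq_zero]

theorem plane_mem (s : ℤ) (x : Fin n ⊕ ι) : S.plane s x ∈ A.hyperplanes := by
  rcases x with k | i
  · exact S.ker_U_mem _
  · exact S.ker_G_mem _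

theorem ker_G_injective : Function.Injective fun i => LinearMap.ker (S.G i) := by
  intro i j h
  simp only at h
  have h1 : S.Φ.symm (1, 0, S.a i) ∈ LinearMap.ker (S.G j) := by
    rw [← h]; simp [graphForm_apply]
  have h2 : S.Φ.symm (0, 1, S.b i) ∈ LinearMap.ker (S.G j) := by
    rw [← h]; simp [graphForm_apply]
  simp only [LinearMap.mem_ker, graphForm_apply, LinearEquiv.apply_symm_apply] at h1 h2
  exact S.inj i j (by linarith) (by linarith)

theorem plane_injective (s : ℤ) : Function.Injective (S.plane s) := by
  rintro (k | i) (l | j) h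
  · have h1 : S.point (S.α (s + (k : ℕ) + 1)) 0 ∈ LinearMap.ker (S.U (s + (k : ℕ) + 1)) := by
      simp [U_point]
    change LinearMap.ker (S.U (s + (k : ℕ) + 1)) = LinearMap.ker (S.U (s + (l : ℕ) + 1)) at h
    rw [h, S.point_mem_U (by omega) (by omega)] at h1
    congr 1
    ext
    omega
  · exact absurd (h ▸ S.vertex_U _ : _ ∈ S.plane s (.inr j)) (S.vertex_G j)
  · exact absurd (h ▸ S.vertex_U _ : _ ∈ S.plane s (.inr i)) (S.vertex_G i)
  · rw [S.ker_G_injective h]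

theorem ker_U_add_mul (t k : ℤ) : LinearMap.ker (S.U (t + k * n)) = LinearMap.ker (S.U t) := by
  ext p
  rw [LinearMap.mem_ker, LinearMap.mem_ker, S.U_add_mul, mul_eq_zero,
    or_iff_right (zpow_ne_zero _ (by norm_num))]

theorem exists_ker_U_eq (s t : ℤ) :
    ∃ k : Fin n, LinearMap.ker (S.U t) = LinearMap.ker (S.U (s + (k : ℕ) + 1)) := by
  have hn : (0 : ℤ) < n := by exact_mod_cast S.pos
  have e1 := Int.emod_add_mul_ediv (t - s - 1) n
  have e2 := Int.emod_nonneg (t - s - 1) hn.ne'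
  have e3 := Int.emod_lt_of_pos (t - s - 1) hn
  refine ⟨⟨((t - s - 1) % n).toNat, by omega⟩, ?_⟩
  have e4 : (n : ℤ) * ((t - s - 1) / n) = (t - s - 1) / n * n := mul_comm _ _
  have e5 : t = s + ((t - s - 1) % n).toNat + 1 + (t - s - 1) / n * n := by omega
  conv_lhs => rw [e5]
  exact S.ker_U_add_mul _ _

theorem range_plane (s : ℤ) : Set.range (S.plane s) = A.hyperplanes := by
  apply Set.Subset.antisymm
  · rintro _ ⟨x, rfl⟩
    exact S.plane_mem s x
  · intro H hH
    rcases (S.mem_iff H).1 hH with ⟨t, rfl⟩ | ⟨i, rfl⟩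
    · obtain ⟨k, hk⟩ := S.exists_ker_U_eq s t
      exact ⟨.inl k, hk.symm⟩
    · exact ⟨.inr i, rfl⟩

theorem exists_height_eq (s : ℤ) (i j : ι) : ∃ k : Fin n,
    S.height i (S.α (s + (k : ℕ) + 1)) = S.height j (S.α (s + (k : ℕ) + 1)) := by
  by_cases hij : i = j
  · exact ⟨⟨0, S.pos⟩, by rw [hij]⟩
  · obtain ⟨u, C, hC, h1, h2, h3⟩ := S.exists_sub_eq hij (s + n)
    refine ⟨⟨(u - s - 1).toNat, by omega⟩, ?_⟩
    have h4 : s + ((u - s - 1).toNat : ℤ) + 1 = u := by omega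
    simp only [h4]
    have h5 := h3 (S.α u)
    rw [sub_self, sin_zero, mul_zero] at h5
    linarith

/-- Each meet is tested on one point: the axis for two vertical planes, otherwise the point of a
graph over the relevant vertical plane. The offset s + k + 1 fits the times t + 1 compared in
`SortSystem.NeighboursMeet.exists_equiv`. -/
theorem plane_inf_le_iff (s : ℤ) {x y : Fin n ⊕ ι} (hxy : x ≠ y) (z : Fin n ⊕ ι) :
    S.plane s x ⊓ S.plane s y ≤ S.plane s z ↔
      Incidence (fun k i j => S.height i (S.α (s + (k : ℕ) + 1)) =
        S.height j (S.α (s + (k : ℕ) + 1))) x y z := by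
  have hV := S.finrank_eq_three
  have hne := (S.plane_injective s).ne hxy
  have key := fun (p : V) (h0 : p ≠ 0) (h1 : p ∈ S.plane s x) (h2 : p ∈ S.plane s y) =>
    inf_le_iff_mem hV (S.plane_mem s x) (S.plane_mem s y) hne h0 h1 h2 (S.plane s z)
  have memU : ∀ (k m : Fin n) (c : ℝ),
      S.point (S.α (s + (k : ℕ) + 1)) c ∈ S.plane s (.inl m) ↔ k = m := by
    intro k m c
    change _ ∈ LinearMap.ker _ ↔ _
    rw [S.point_mem_U (by omega) (by omega), Fin.ext_iff]
    omega
  have memG : ∀ (k : Fin n) (i j : ι),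
      S.point (S.α (s + (k : ℕ) + 1)) (S.height i (S.α (s + (k : ℕ) + 1))) ∈ S.plane s (.inr j) ↔
        S.height i (S.α (s + (k : ℕ) + 1)) = S.height j (S.α (s + (k : ℕ) + 1)) :=
    fun k i j => S.point_mem_G _ i j
  rcases x with k | i <;> rcases y with l | j
  · rw [key _ S.vertex_ne_zero (S.vertex_U _) (S.vertex_U _)]
    rcases z with m | h
    · exact iff_of_true (S.vertex_U _) trivial
    · exact iff_of_false (S.vertex_G _) id
  · rw [key _ (S.point_ne_zero _ _) ((memU k k _).2 rfl) ((memG k j j).2 rfl)]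
    rcases z with m | h
    · exact memU k m _
    · exact memG k j h
  · rw [key _ (S.point_ne_zero _ _) ((memG l i i).2 rfl) ((memU l l _).2 rfl)]
    rcases z with m | h
    · exact memU l m _
    · exact memG l i h
  · obtain ⟨k, hk⟩ := S.exists_height_eq s i j
    have key' := fun k hk => key _ (S.point_ne_zero _ _) ((memG k i i).2 rfl) ((memG k i j).2 hk)
    rcases z with m | h
    · constructor
      · intro h1
        rw [key' k hk, memU] at h1
        exact h1 ▸ hk
      · intro h1
        rw [key' m h1, memU]
    · constructor
      · intro h1
        rw [key' k hk, memG] at h1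
        exact ⟨k, hk, h1⟩
      · rintro ⟨m, h1, h2⟩
        rw [key' m h1, memG]
        exact h2

/-- Arrangements whose graphs meet over corresponding vertical planes are lattice equivalent. -/
theorem latticeEquivalent {W : Type*} [AddCommGroup W] [Module ℝ W]
    {B : HyperplaneArrangement ℝ W} {ι' : Type*} (T : Fan B n ι') (g : ι ≃ ι') (s u : ℤ)
    (h : ∀ (t : ℕ) i j, S.height i (S.α (s + t + 1)) = S.height j (S.α (s + t + 1)) ↔
      T.height (g i) (T.α (u + t + 1)) = T.height (g j) (T.α (u + t + 1))) :
    A.LatticeEquivalent B := by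
  have hg : Function.Injective (Sum.map (id : Fin n → Fin n) g) :=
    Function.injective_id.sumMap g.injective
  refine latticeEquivalent_of_incidence S.finrank_eq_three T.finrank_eq_three (P := S.plane s)
    (Q := T.plane u ∘ Sum.map id g) (S.plane_injective s)
    ((T.plane_injective u).comp hg) (S.range_plane s) ?_ ?_
  · rw [Set.range_comp, (Function.surjective_id.sumMap g.surjective).range_eq, Set.image_univ,
      T.range_plane]
  · intro x y z hxy
    rw [S.plane_inf_le_iff s hxy, Function.comp_apply, Function.comp_apply, Function.comp_apply,
      T.plane_inf_le_iff u (hg.ne hxy)]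
    exact incidence_congr g (fun k i j => h k i j) x y z

end Fan

/-! ### From a modular line to a fan -/

section Construction

/-- The angles in [0, π) are sorted and repeated with period π; division with remainder by their
number splits an index into angle and half turn. -/
theorem exists_periodic_enumeration (Z : Finset ℝ) (hne : Z.Nonempty)
    (hZ : ∀ θ ∈ Z, 0 ≤ θ ∧ θ < π) :
    ∃ α : ℤ → ℝ, StrictMono α ∧ (∀ t, α (t + Z.card) = α t + π) ∧
      ∀ θ, (∃ t, α t = θ) ↔ ∃ k : ℤ, θ - k * π ∈ Z := by
  have hn : 0 < Z.card := hne.card_pos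
  have hn' : (0 : ℤ) < Z.card := by exact_mod_cast hn
  let e : Fin Z.card ↪o ℝ := Z.orderEmbOfFin rfl
  have he : ∀ r, e r ∈ Z := fun r => Z.orderEmbOfFin_mem rfl r
  have hlt : ∀ t : ℤ, (t % Z.card).toNat < Z.card := fun t => by
    have := Int.emod_nonneg t hn'.ne'
    have := Int.emod_lt_of_pos t hn'
    omega
  let α : ℤ → ℝ := fun t => e ⟨(t % Z.card).toNat, hlt t⟩ + ((t / Z.card : ℤ) : ℝ) * π
  have hα : ∀ (q : ℤ) (r : Fin Z.card), α ((r : ℕ) + q * Z.card) = e r + q * π := by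
    intro q r
    have h1 : ((r : ℕ) + q * Z.card : ℤ) % Z.card = (r : ℕ) := by
      rw [Int.add_mul_emod_self_right]
      exact Int.emod_eq_of_lt (by omega) (by omega)
    have h2 : ((r : ℕ) + q * Z.card : ℤ) / Z.card = q := by
      rw [Int.add_mul_ediv_right _ _ hn'.ne', Int.ediv_eq_zero_of_lt (by omega) (by omega), zero_add]
    simp only [α, h1, h2, Int.toNat_natCast]
  have hdecomp : ∀ t : ℤ, ∃ (q : ℤ) (r : Fin Z.card), t = (r : ℕ) + q * Z.card := by
    intro t
    refine ⟨t / Z.card, ⟨(t % Z.card).toNat, hlt t⟩, ?_⟩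
    simp only
    rw [Int.toNat_of_nonneg (Int.emod_nonneg t hn'.ne'), mul_comm, Int.emod_add_mul_ediv]
  refine ⟨α, strictMono_int_of_lt_succ fun t => ?_, fun t => ?_, fun θ => ?_⟩
  · obtain ⟨q, r, rfl⟩ := hdecomp t
    rw [hα]
    by_cases hr : (r : ℕ) + 1 < Z.card
    · have h1 := hα q ⟨r + 1, hr⟩
      simp only [Nat.cast_succ] at h1
      rw [show ((r : ℕ) : ℤ) + q * Z.card + 1 = (r : ℕ) + 1 + q * Z.card by ring, h1]
      have : e r < e ⟨r + 1, hr⟩ := e.strictMono (Fin.lt_def.2 (by simp))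
      linarith
    · have h1 := hα (q + 1) ⟨0, hn⟩
      have h2 : ((r : ℕ) : ℤ) + q * Z.card + 1 = ((0 : ℕ) : ℤ) + (q + 1) * Z.card := by
        have : ((r : ℕ) : ℤ) + 1 = Z.card := by omega
        rw [add_mul, ← this]
        push_cast
        ring
      rw [h2, h1]
      have h3 := hZ _ (he r)
      have h4 := hZ _ (he ⟨0, hn⟩)
      push_cast
      linarith
  · obtain ⟨q, r, rfl⟩ := hdecomp t
    rw [show ((r : ℕ) : ℤ) + q * Z.card + Z.card = (r : ℕ) + (q + 1) * Z.card by ring, hα, hα]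
    push_cast
    ring
  · constructor
    · rintro ⟨t, rfl⟩
      obtain ⟨q, r, rfl⟩ := hdecomp t
      refine ⟨q, ?_⟩
      rw [hα, add_sub_cancel_right]
      exact he r
    · rintro ⟨k, hk⟩
      have : θ - k * π ∈ Set.range e := by
        rw [Finset.range_orderEmbOfFin]
        exact hk
      obtain ⟨r, hr⟩ := this
      exact ⟨(r : ℕ) + k * Z.card, by rw [hα, hr]; ring⟩

variable {V : Type*} [AddCommGroup V] [Module ℝ V] {A : HyperplaneArrangement ℝ V}

theorem form_eq (Φ : V ≃ₗ[ℝ] ℝ × ℝ × ℝ) (φ : V →ₗ[ℝ] ℝ) (p : V) :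
    φ p = φ (Φ.symm (1, 0, 0)) * (Φ p).1 + φ (Φ.symm (0, 1, 0)) * (Φ p).2.1 +
      φ (Φ.symm (0, 0, 1)) * (Φ p).2.2 := by
  have h : p = (Φ p).1 • Φ.symm (1, 0, 0) + (Φ p).2.1 • Φ.symm (0, 1, 0) +
      (Φ p).2.2 • Φ.symm (0, 0, 1) := by
    apply Φ.injective
    simp
  conv_lhs => rw [h]
  simp only [map_add, map_smul, smul_eq_mul]
  ring

theorem ker_verticalForm_add_mul (Φ : V ≃ₗ[ℝ] ℝ × ℝ × ℝ) (θ : ℝ) (k : ℤ) :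
    LinearMap.ker (verticalForm Φ (θ + k * π)) = LinearMap.ker (verticalForm Φ θ) := by
  ext p
  simp only [LinearMap.mem_ker, verticalForm_apply, cos_add_int_mul_pi, sin_add_int_mul_pi]
  rw [show (-1 : ℝ) ^ k * cos θ * (Φ p).2.1 - (-1) ^ k * sin θ * (Φ p).1 =
    (-1) ^ k * (cos θ * (Φ p).2.1 - sin θ * (Φ p).1) by ring, mul_eq_zero,
    or_iff_right (zpow_ne_zero _ (by norm_num))]

theorem exists_ker_eq_ker_verticalForm (Φ : V ≃ₗ[ℝ] ℝ × ℝ × ℝ) {φ : V →ₗ[ℝ] ℝ}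
    (hφ : φ ≠ 0) (h : φ (Φ.symm (0, 0, 1)) = 0) :
    ∃ θ, (0 ≤ θ ∧ θ < π) ∧ LinearMap.ker φ = LinearMap.ker (verticalForm Φ θ) := by
  set a := φ (Φ.symm (1, 0, 0)) with ha
  set b := φ (Φ.symm (0, 1, 0)) with hb
  -- Polar coordinates of (b, -a), matching the coefficients of cos θ · y - sin θ · x.
  obtain ⟨r, θ, hr, hx, hy⟩ : ∃ r θ : ℝ, 0 ≤ r ∧ b = r * cos θ ∧ -a = r * sin θ :=
    ⟨‖(⟨b, -a⟩ : ℂ)‖, Complex.arg ⟨b, -a⟩, norm_nonneg _,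
      by rw [Complex.norm_mul_cos_arg], by rw [Complex.norm_mul_sin_arg]⟩
  have hφ' : ∀ p, φ p = r * verticalForm Φ θ p := by
    intro p
    rw [form_eq Φ φ p, h, verticalForm_apply, ← ha, ← hb, hx, show a = -(r * sin θ) by linarith]
    ring
  have hr' : r ≠ 0 := by
    rintro rfl
    exact hφ (LinearMap.ext fun p => by rw [hφ', zero_mul]; rfl)
  refine ⟨θ - ⌊θ / π⌋ * π, ⟨Int.sub_floor_div_mul_nonneg θ pi_pos,
    Int.sub_floor_div_mul_lt θ pi_pos⟩, ?_⟩
  rw [← ker_verticalForm_add_mul Φ _ ⌊θ / π⌋, sub_add_cancel]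
  ext p
  rw [LinearMap.mem_ker, LinearMap.mem_ker, hφ', mul_eq_zero, or_iff_right hr']

theorem exists_ker_eq_ker_graphForm (Φ : V ≃ₗ[ℝ] ℝ × ℝ × ℝ) {φ : V →ₗ[ℝ] ℝ}
    (h : φ (Φ.symm (0, 0, 1)) ≠ 0) :
    ∃ a b, LinearMap.ker φ = LinearMap.ker (graphForm Φ a b) := by
  set c := φ (Φ.symm (0, 0, 1)) with hc
  refine ⟨-φ (Φ.symm (1, 0, 0)) / c, -φ (Φ.symm (0, 1, 0)) / c, ?_⟩
  ext p
  have h1 : φ p = c * graphForm Φ (-φ (Φ.symm (1, 0, 0)) / c) (-φ (Φ.symm (0, 1, 0)) / c) p := by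
    rw [form_eq Φ φ p, graphForm_apply, ← hc]
    field_simp
    ring
  rw [LinearMap.mem_ker, LinearMap.mem_ker, h1, mul_eq_zero, or_iff_right h]

/-- A numbering of the hyperplanes of `A` in which the first `n` hyperplanes contain a common
modular line, which is not contained in the others. -/
structure ModularLine (A : HyperplaneArrangement ℝ V) (n : ℕ) (ι : Type*) where
  P : Fin n ⊕ ι → Submodule ℝ V
  injective : P.Injective
  range_eq : Set.range P = A.hyperplanes
  inf_le : ∀ s t u, s ≠ t → P (.inl s) ⊓ P (.inl t) ≤ P (.inl u)
  not_inf_le : ∀ s t i, s ≠ t → ¬ P (.inl s) ⊓ P (.inl t) ≤ P (.inr i)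
  exists_inf_le : ∀ i j, i ≠ j → ∃ t, P (.inr i) ⊓ P (.inr j) ≤ P (.inl t)

theorem ModularLine.mem {n : ℕ} {ι : Type*} (M : ModularLine A n ι) (x : Fin n ⊕ ι) :
    M.P x ∈ A.hyperplanes := by
  rw [← M.range_eq]
  exact Set.mem_range_self x

theorem ModularLine.exists_fan (hV : finrank ℝ V = 3) {n : ℕ} {ι : Type*} [Nonempty ι]
    (M : ModularLine A n ι) (hn : 2 ≤ n) :
    ∃ S : Fan A n ι, ∀ i, LinearMap.ker (S.G i) = M.P (.inr i) := by
  classical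
  have : FiniteDimensional ℝ V := FiniteDimensional.of_finrank_pos (by omega)
  let k0 : Fin n := ⟨0, by omega⟩
  let k1 : Fin n := ⟨1, by omega⟩
  have h01 : k0 ≠ k1 := by simp [k0, k1, Fin.ext_iff]
  obtain ⟨i0⟩ := ‹Nonempty ι›
  -- Coordinates vanishing on two vertical planes and on one other plane: the modular line becomes
  -- the third axis.
  obtain ⟨x, hx⟩ := exists_form_of_hyperplane (M.mem (.inl k0))
  obtain ⟨y, hy⟩ := exists_form_of_hyperplane (M.mem (.inl k1))
  obtain ⟨z, hz⟩ := exists_form_of_hyperplane (M.mem (.inr i0))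
  have hne : M.P (.inl k0) ≠ M.P (.inl k1) := M.injective.ne (by simpa using h01)
  have hbot := A.inf_inf_eq_bot_of_not_le hV (M.mem _) (M.mem _) hne (M.not_inf_le k0 k1 i0 h01)
  rw [← hx, ← hy, ← hz] at hbot
  have hinj : Function.Injective (x.prod (y.prod z)) := by
    rw [← LinearMap.ker_eq_bot, LinearMap.ker_prod, LinearMap.ker_prod, ← inf_assoc, hbot]
  let Φ : V ≃ₗ[ℝ] ℝ × ℝ × ℝ := LinearMap.linearEquivOfInjective _ hinj (by simp [hV])
  have hΦ : ∀ p, Φ p = (x p, y p, z p) := fun p => rfl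
  set v : V := Φ.symm (0, 0, 1) with hv
  have hv' := hΦ v
  rw [hv, Φ.apply_symm_apply, ← hv] at hv'
  have hv0 : v ≠ 0 := by
    intro h
    rw [h] at hv'
    simp at hv'
  have hinf := inf_le_iff_mem hV (M.mem (.inl k0)) (M.mem (.inl k1)) hne hv0
    (by rw [← hx]; exact (congrArg Prod.fst hv').symm)
    (by rw [← hy]; exact (congrArg (fun q => q.2.1) hv').symm)
  have hvert : ∀ k : Fin n, ∃ θ, (0 ≤ θ ∧ θ < π) ∧
      M.P (.inl k) = LinearMap.ker (verticalForm Φ θ) := by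
    intro k
    obtain ⟨φ, hφ⟩ := exists_form_of_hyperplane (M.mem (.inl k))
    rw [← hφ]
    apply exists_ker_eq_ker_verticalForm
    · rintro rfl
      exact A.hyperplane_ne_top (M.mem (.inl k)) (by rw [← hφ, LinearMap.ker_zero])
    · rw [← LinearMap.mem_ker, hφ, ← hv, ← hinf]
      exact M.inf_le k0 k1 k h01
  have hgraph : ∀ i : ι, ∃ a b, M.P (.inr i) = LinearMap.ker (graphForm Φ a b) := by
    intro i
    obtain ⟨φ, hφ⟩ := exists_form_of_hyperplane (M.mem (.inr i))
    rw [← hφ]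
    apply exists_ker_eq_ker_graphForm
    rw [Ne, ← LinearMap.mem_ker, hφ, ← hv, ← hinf]
    exact M.not_inf_le k0 k1 i h01
  choose θ hθ hPθ using hvert
  choose a b hab using hgraph
  have hθinj : Function.Injective θ := by
    intro k l h
    have : M.P (.inl k) = M.P (.inl l) := by rw [hPθ, hPθ, h]
    simpa using M.injective this
  have hcard : (Finset.univ.image θ).card = n := by
    rw [Finset.card_image_of_injective _ hθinj, Finset.card_univ, Fintype.card_fin]
  obtain ⟨α, h1, h2, h3⟩ := exists_periodic_enumeration (Finset.univ.image θ)
    ⟨θ k0, Finset.mem_image_of_mem _ (Finset.mem_univ _)⟩ (by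
      intro t ht
      obtain ⟨k, -, rfl⟩ := Finset.mem_image.1 ht
      exact hθ k)
  rw [hcard] at h2
  have hα : ∀ k, ∃ t, M.P (.inl k) = LinearMap.ker (verticalForm Φ (α t)) := by
    intro k
    obtain ⟨t, ht⟩ := (h3 (θ k)).2 ⟨0, by simp⟩
    exact ⟨t, by rw [ht, hPθ]⟩
  have hα' : ∀ t, ∃ k, LinearMap.ker (verticalForm Φ (α t)) = M.P (.inl k) := by
    intro t
    obtain ⟨m, hm⟩ := (h3 (α t)).1 ⟨t, rfl⟩
    obtain ⟨k, -, hk⟩ := Finset.mem_image.1 hm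
    refine ⟨k, ?_⟩
    rw [hPθ, hk, ← ker_verticalForm_add_mul Φ (α t - m * π) m, sub_add_cancel]
  refine ⟨⟨Φ, α, a, b, h1, h2, ?_, ?_, ?_⟩, fun i => (hab i).symm⟩
  · intro H
    rw [← M.range_eq]
    constructor
    · rintro ⟨k | i, rfl⟩
      · exact Or.inl (hα k)
      · exact Or.inr ⟨i, hab i⟩
    · rintro (⟨t, rfl⟩ | ⟨i, rfl⟩)
      · obtain ⟨k, hk⟩ := hα' t
        exact ⟨_, hk.symm⟩
      · exact ⟨_, hab i⟩
  · intro i j h4 h5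
    have : M.P (.inr i) = M.P (.inr j) := by rw [hab, hab, h4, h5]
    simpa using M.injective this
  · intro i j
    by_cases hij : i = j
    · exact ⟨0, by rw [hij]⟩
    obtain ⟨k, hk⟩ := M.exists_inf_le i j hij
    obtain ⟨t, ht⟩ := hα k
    refine ⟨t, ?_⟩
    have hne' : M.P (.inr i) ≠ M.P (.inr j) := M.injective.ne (by simpa using hij)
    have hne'' : M.P (.inr i) ≠ M.P (.inl k) := M.injective.ne (by simp)
    set p : V := Φ.symm (cos (α t), sin (α t), a i * cos (α t) + b i * sin (α t)) with hp
    have hp0 : p ≠ 0 := by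
      intro h
      have h6 := Φ.symm.map_eq_zero_iff.1 (hp ▸ h)
      have h7 : cos (α t) = 0 := congrArg Prod.fst h6
      have h8 : sin (α t) = 0 := congrArg (fun q => q.2.1) h6
      have := sin_sq_add_cos_sq (α t)
      rw [h7, h8] at this
      norm_num at this
    -- The line common to graphs i and j is all of graph i over the vertical plane k, so the point p
    -- of graph i lies on graph j as well.
    have hle : M.P (.inr i) ⊓ M.P (.inl k) ≤ M.P (.inr j) := by
      have h6 : M.P (.inr i) ⊓ M.P (.inr j) = M.P (.inr i) ⊓ M.P (.inl k) := by
        apply Submodule.eq_of_le_of_finrank_eq (le_inf inf_le_left hk)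
        rw [A.finrank_inf_hyperplane hV (M.mem _) (M.mem _) hne',
          A.finrank_inf_hyperplane hV (M.mem _) (M.mem _) hne'']
      rw [← h6]
      exact inf_le_right
    have hmem := (inf_le_iff_mem hV (M.mem _) (M.mem _) hne'' hp0 (by
      rw [hab, LinearMap.mem_ker, graphForm_apply, hp, Φ.apply_symm_apply]; simp) (by
      rw [ht, LinearMap.mem_ker, verticalForm_apply, hp, Φ.apply_symm_apply]
      simp only
      ring) _).1 hle
    rw [hab, LinearMap.mem_ker, graphForm_apply, hp, Φ.apply_symm_apply] at hmem
    simp only at hmem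
    linarith

end Construction

end HyperplaneArrangement

namespace HyperplaneArrangement

open Module

universe u

variable {V : Type u} [AddCommGroup V] [Module ℝ V] {A : HyperplaneArrangement ℝ V}

/-! ### Reducibility in dimension three -/

section Reducible

/-- An arrangement all of whose hyperplanes but one contain a common line is reducible. -/
theorem isReducible_of_forall_mem (hV : finrank ℝ V = 3) {H₀ : Submodule ℝ V}
    (hH₀ : H₀ ∈ A.hyperplanes) {p : V} (hp : p ∉ H₀)
    (h : ∀ H ∈ A.hyperplanes, H = H₀ ∨ p ∈ H) : A.IsReducible := by
  have : FiniteDimensional ℝ V := FiniteDimensional.of_finrank_pos (by omega)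
  have hp0 : p ≠ 0 := by rintro rfl; exact hp H₀.zero_mem
  have f0 := A.finrank_hyperplane hV hH₀
  have f1 : finrank ℝ (ℝ ∙ p) = 1 := finrank_span_singleton hp0
  have hcompl : IsCompl (ℝ ∙ p) H₀ :=
    (Submodule.isCompl_span_singleton_of_isCoatom_of_notMem
      ⟨A.hyperplane_ne_top hH₀, fun Y hY => A.eq_top_of_hyperplane_lt hV hH₀ hY⟩ hp).symm
  let A₁ : HyperplaneArrangement ℝ (ℝ ∙ p) :=
    { hyperplanes := {⊥}
      finite_hyperplanes := Set.finite_singleton _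
      codim_eq_one := by
        rintro _ rfl
        have := (⊥ : Submodule ℝ (ℝ ∙ p)).finrank_quotient_add_finrank
        rw [finrank_bot, f1] at this
        exact this }
  let A₂ : HyperplaneArrangement ℝ H₀ :=
    { hyperplanes := (fun H => H.comap H₀.subtype) '' {H ∈ A.hyperplanes | H ≠ H₀}
      finite_hyperplanes := (A.finite_hyperplanes.subset fun H hH => hH.1).image _
      codim_eq_one := by
        rintro _ ⟨H, ⟨hH, hne⟩, rfl⟩
        have h1 := (H.comap H₀.subtype).finrank_quotient_add_finrank
        have h2 := H₀.finrank_map_subtype_eq (H.comap H₀.subtype)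
        rw [Submodule.map_comap_subtype, A.finrank_inf_hyperplane hV hH₀ hH hne.symm] at h2
        simp only at h1 ⊢
        omega }
  refine ⟨ℝ ∙ p, H₀, A₁, A₂, ?_, ?_, hcompl, ?_⟩
  · simpa using hp0
  · rintro rfl
    simp at f0
  · have hsup : ∀ H ∈ A.hyperplanes, H ≠ H₀ →
        (ℝ ∙ p) ⊔ (H.comap H₀.subtype).map H₀.subtype = H := by
      intro H hH hne
      rw [Submodule.map_comap_subtype, ← sup_inf_assoc_of_le, hcompl.sup_eq_top, top_inf_eq]
      rw [Submodule.span_singleton_le_iff_mem]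
      exact (h H hH).resolve_left hne
    ext H
    constructor
    · intro hH
      by_cases hne : H = H₀
      · exact Or.inl ⟨⊥, rfl, by rw [Submodule.map_bot, bot_sup_eq, hne]⟩
      · exact Or.inr ⟨_, ⟨H, ⟨hH, hne⟩, rfl⟩, (hsup H hH hne).symm⟩
    · rintro (⟨_, rfl, rfl⟩ | ⟨_, ⟨H', ⟨hH', hne⟩, rfl⟩, rfl⟩)
      · rw [Submodule.map_bot, bot_sup_eq]
        exact hH₀
      · simp only
        rw [hsup H' hH' hne]
        exact hH'

/-- The summands have dimensions 1 and 2. Every plane contains one of them, and a plane containing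
the two-dimensional summand equals it. -/
theorem IsReducible.exists_finrank_eq (hV : finrank ℝ V = 3) (h : A.IsReducible) :
    ∃ Y W : Submodule ℝ V, finrank ℝ Y = 1 ∧ finrank ℝ W = 2 ∧
      ∀ H ∈ A.hyperplanes, H = W ∨ Y ≤ H := by
  have : FiniteDimensional ℝ V := FiniteDimensional.of_finrank_pos (by omega)
  obtain ⟨V₁, V₂, A₁, A₂, h1, h2, hc, hA⟩ := h
  have h3 := Submodule.finrank_add_eq_of_isCompl hc
  have p1 : 0 < finrank ℝ V₁ := Nat.pos_of_ne_zero (mt Submodule.finrank_eq_zero.1 h1)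
  have p2 : 0 < finrank ℝ V₂ := Nat.pos_of_ne_zero (mt Submodule.finrank_eq_zero.1 h2)
  have hle : ∀ H ∈ A.hyperplanes, V₂ ≤ H ∨ V₁ ≤ H := by
    intro H hH
    rw [hA] at hH
    rcases hH with ⟨H₁, -, rfl⟩ | ⟨H₂, -, rfl⟩
    · exact Or.inl le_sup_right
    · exact Or.inr le_sup_left
  have heq : ∀ W : Submodule ℝ V, finrank ℝ W = 2 → ∀ H ∈ A.hyperplanes, W ≤ H → H = W :=
    fun W hW H hH hWH => (Submodule.eq_of_le_of_finrank_eq hWH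
      (by rw [hW, A.finrank_hyperplane hV hH])).symm
  rcases (show finrank ℝ V₁ = 1 ∧ finrank ℝ V₂ = 2 ∨ finrank ℝ V₁ = 2 ∧ finrank ℝ V₂ = 1 by omega)
    with ⟨d1, d2⟩ | ⟨d1, d2⟩
  · exact ⟨V₁, V₂, d1, d2, fun H hH => (hle H hH).imp_left (heq _ d2 H hH)⟩
  · exact ⟨V₂, V₁, d2, d1, fun H hH => (hle H hH).symm.imp_left (heq _ d1 H hH)⟩

/-- In a product at most one plane avoids the line Y. With three vertical planes and two others, Y
lies in two vertical planes and in another plane, whose intersection is zero. -/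
theorem ModularLine.isIrreducible (hV : finrank ℝ V = 3) {n : ℕ} {ι : Type*}
    (M : ModularLine A n ι) (hn : 3 ≤ n) (hι : Nontrivial ι) : A.IsIrreducible := by
  intro hred
  obtain ⟨Y, W, hY, hW, h⟩ := hred.exists_finrank_eq hV
  have hdich : ∀ x y, x ≠ y → Y ≤ M.P x ∨ Y ≤ M.P y := by
    intro x y hxy
    rcases h _ (M.mem x) with h1 | h1
    · refine Or.inr ((h _ (M.mem y)).resolve_left fun h2 => hxy (M.injective (h1.trans h2.symm)))
    · exact Or.inl h1
  have hex : ∃ s t : Fin n, s ≠ t ∧ Y ≤ M.P (.inl s) ∧ Y ≤ M.P (.inl t) := by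
    let k0 : Fin n := ⟨0, by omega⟩
    let k1 : Fin n := ⟨1, by omega⟩
    let k2 : Fin n := ⟨2, by omega⟩
    have h01 : k0 ≠ k1 := by simp [k0, k1, Fin.ext_iff]
    have h02 : k0 ≠ k2 := by simp [k0, k2, Fin.ext_iff]
    have h12 : k1 ≠ k2 := by simp [k1, k2, Fin.ext_iff]
    rcases hdich (.inl k0) (.inl k1) (by simpa using h01) with g | g
    · rcases hdich (.inl k1) (.inl k2) (by simpa using h12) with g' | g'
      · exact ⟨k0, k1, h01, g, g'⟩
      · exact ⟨k0, k2, h02, g, g'⟩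
    · rcases hdich (.inl k0) (.inl k2) (by simpa using h02) with g' | g'
      · exact ⟨k0, k1, h01, g', g⟩
      · exact ⟨k1, k2, h12, g, g'⟩
  obtain ⟨s, t, hst, hs, ht⟩ := hex
  obtain ⟨i, hi⟩ : ∃ i, Y ≤ M.P (.inr i) := by
    obtain ⟨i, j, hij⟩ := hι
    rcases hdich (.inr i) (.inr j) (by simpa using hij) with g | g
    exacts [⟨i, g⟩, ⟨j, g⟩]
  have hbot := A.inf_inf_eq_bot_of_not_le hV (M.mem (.inl s)) (M.mem (.inl t))
    (M.injective.ne (by simpa using hst)) (M.not_inf_le s t i hst)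
  have : Y = ⊥ := le_bot_iff.1 (hbot ▸ le_inf (le_inf hs ht) hi)
  rw [this, finrank_bot] at hY
  omega

end Reducible

/-! ### Supersolvability and modular lines -/

section Supersolvable

/-- The chain is indexed by `Fin (finrank ℝ V + 1)`, so the dimension is generalized before it is
replaced by 3. -/
theorem isSupersolvable_iff (hV : finrank ℝ V = 3) :
    A.IsSupersolvable ↔ A.rank = 3 ∧ ∃ X : Fin 4 → Submodule ℝ V,
      X 0 = ⊤ ∧ X (Fin.last 3) = A.center ∧ StrictAnti X ∧ ∀ i, A.IsModular (X i) := by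
  have key : ∀ d, d = 3 → ((∃ X : Fin (d + 1) → Submodule ℝ V,
      X 0 = ⊤ ∧ X (Fin.last d) = A.center ∧ StrictAnti X ∧ ∀ i, A.IsModular (X i)) ↔
      ∃ X : Fin 4 → Submodule ℝ V,
      X 0 = ⊤ ∧ X (Fin.last 3) = A.center ∧ StrictAnti X ∧ ∀ i, A.IsModular (X i)) := by
    rintro d rfl
    rfl
  exact and_congr (by rw [hV]) (key _ hV)

/-- The chain is the whole space, a vertical plane, the common line X, zero. Only X needs an
argument: any other line of the lattice lies in a vertical plane, which is then its sum with X. -/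
theorem ModularLine.isSupersolvable (hV : finrank ℝ V = 3) {n : ℕ} {ι : Type*} [Nonempty ι]
    (M : ModularLine A n ι) (hn : 2 ≤ n) : A.IsSupersolvable := by
  have : FiniteDimensional ℝ V := FiniteDimensional.of_finrank_pos (by omega)
  let k0 : Fin n := ⟨0, by omega⟩
  let k1 : Fin n := ⟨1, by omega⟩
  have h01 : k0 ≠ k1 := by simp [k0, k1, Fin.ext_iff]
  obtain ⟨i0⟩ := ‹Nonempty ι›
  have hne : M.P (.inl k0) ≠ M.P (.inl k1) := M.injective.ne (by simpa using h01)
  have hbot := A.inf_inf_eq_bot_of_not_le hV (M.mem _) (M.mem _) hne (M.not_inf_le k0 k1 i0 h01)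
  have hcenter : A.center = ⊥ := by
    rw [← le_bot_iff, ← hbot]
    exact le_inf (le_inf (sInf_le (M.mem _)) (sInf_le (M.mem _))) (sInf_le (M.mem _))
  set X := M.P (.inl k0) ⊓ M.P (.inl k1) with hX
  have fX : finrank ℝ X = 1 := A.finrank_inf_hyperplane hV (M.mem _) (M.mem _) hne
  have hXle : ∀ t, X ≤ M.P (.inl t) := fun t => M.inf_le k0 k1 t h01
  have hXmem : X ∈ A.intersections := A.inf_mem_intersections
    (A.hyperplane_mem_intersections (M.mem _)) (A.hyperplane_mem_intersections (M.mem _))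
  have hbotmem : ⊥ ∈ A.intersections := hcenter ▸ A.center_mem_intersections
  have modHyp : ∀ H ∈ A.hyperplanes, A.IsModular H := by
    intro H hH
    refine ⟨A.hyperplane_mem_intersections hH, fun Y hY => ?_⟩
    rcases (le_sup_left : H ≤ H ⊔ Y).eq_or_lt with h | h
    · rw [← h]
      exact A.hyperplane_mem_intersections hH
    · rw [A.eq_top_of_hyperplane_lt hV hH h]
      exact A.top_mem_intersections
  have modX : A.IsModular X := by
    refine ⟨hXmem, fun Y hY => ?_⟩
    by_cases hXY : X ≤ Y
    · rwa [sup_eq_right.2 hXY]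
    by_cases hYX : Y ≤ X
    · rwa [sup_eq_left.2 hYX]
    have hYX' : X < X ⊔ Y := left_lt_sup.2 hYX
    obtain ⟨T, hT, rfl⟩ := hY
    by_cases h2 : ∃ H₁ ∈ T, ∃ H₂ ∈ T, H₁ ≠ H₂
    · obtain ⟨H₁, hT₁, H₂, hT₂, hne12⟩ := h2
      obtain ⟨t, ht⟩ : ∃ t, sInf T ≤ M.P (.inl t) := by
        obtain ⟨x, rfl⟩ : H₁ ∈ Set.range M.P := M.range_eq ▸ hT hT₁
        obtain ⟨y, rfl⟩ : H₂ ∈ Set.range M.P := M.range_eq ▸ hT hT₂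
        rcases x with s | i
        · exact ⟨s, sInf_le hT₁⟩
        rcases y with s | j
        · exact ⟨s, sInf_le hT₂⟩
        obtain ⟨t, ht⟩ := M.exists_inf_le i j fun e => hne12 (by rw [e])
        exact ⟨t, (le_inf (sInf_le hT₁) (sInf_le hT₂)).trans ht⟩
      have h3 : X ⊔ sInf T = M.P (.inl t) := by
        apply Submodule.eq_of_le_of_finrank_le (sup_le (hXle t) ht)
        have := Submodule.finrank_lt_finrank_of_lt hYX'
        rw [A.finrank_hyperplane hV (M.mem _)]
        omega
      rw [h3]
      exact A.hyperplane_mem_intersections (M.mem _)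
    · push Not at h2
      rcases T.eq_empty_or_nonempty with rfl | ⟨H, hH⟩
      · exact absurd (by rw [sInf_empty]; exact le_top) hXY
      · have h3 : T = {H} := Set.eq_singleton_iff_unique_mem.2 ⟨hH, fun H' hH' => h2 _ hH' _ hH⟩
        rw [h3, sInf_singleton, sup_comm]
        exact (modHyp H (hT hH)).2 X hXmem
  have modBot : A.IsModular ⊥ := ⟨hbotmem, fun Y hY => by rwa [bot_sup_eq]⟩
  have modTop : A.IsModular ⊤ := ⟨A.top_mem_intersections, fun Y hY => by
    rw [top_sup_eq]; exact A.top_mem_intersections⟩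
  rw [isSupersolvable_iff hV]
  constructor
  · have := (⊥ : Submodule ℝ V).finrank_quotient_add_finrank
    rw [finrank_bot] at this
    rw [rank, hcenter]
    omega
  · refine ⟨![⊤, M.P (.inl k0), X, ⊥], rfl, hcenter.symm, ?_, ?_⟩
    · rw [Fin.strictAnti_iff_succ_lt]
      refine Fin.forall_fin_succ.2 ⟨?_, Fin.forall_fin_succ.2 ⟨?_, Fin.forall_fin_succ.2 ⟨?_, nofun⟩⟩⟩
      · exact lt_top_iff_ne_top.2 (A.hyperplane_ne_top (M.mem _))
      · refine lt_of_le_of_ne (hXle k0) fun e => ?_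
        have := A.finrank_hyperplane hV (M.mem (.inl k0))
        have e' : X = M.P (.inl k0) := e
        rw [← e'] at this
        omega
      · refine bot_lt_iff_ne_bot.2 fun e => ?_
        have e' : X = ⊥ := e
        rw [e', finrank_bot] at fX
        omega
    · exact Fin.forall_fin_succ.2 ⟨modTop, Fin.forall_fin_succ.2 ⟨modHyp _ (M.mem _),
        Fin.forall_fin_succ.2 ⟨modX, Fin.forall_fin_succ.2 ⟨modBot, nofun⟩⟩⟩⟩

theorem IsSupersolvable.exists_isModular (hV : finrank ℝ V = 3) (h : A.IsSupersolvable) :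
    A.center = ⊥ ∧ ∃ X : Submodule ℝ V, finrank ℝ X = 1 ∧ A.IsModular X := by
  have : FiniteDimensional ℝ V := FiniteDimensional.of_finrank_pos (by omega)
  obtain ⟨hr, X, h0, h3, hX, hmod⟩ := (isSupersolvable_iff hV).1 h
  have hc : A.center = ⊥ := by
    have := A.center.finrank_quotient_add_finrank
    rw [rank] at hr
    exact Submodule.finrank_eq_zero.1 (by omega)
  refine ⟨hc, X 2, ?_, hmod 2⟩
  have g1 := Submodule.finrank_lt_finrank_of_lt (hX (show (0 : Fin 4) < 1 by decide))
  have g2 := Submodule.finrank_lt_finrank_of_lt (hX (show (1 : Fin 4) < 2 by decide))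
  have g3 := Submodule.finrank_lt_finrank_of_lt (hX (show (2 : Fin 4) < Fin.last 3 by decide))
  rw [h0, finrank_top, hV] at g1
  omega

theorem IsSupersolvable.exists_modularLine (hV : finrank ℝ V = 3) (h : A.IsSupersolvable) :
    ∃ (n : ℕ) (ι : Type u) (_ : Fintype ι) (_ : Nonempty ι) (_ : ModularLine A n ι), 2 ≤ n := by
  classical
  have : FiniteDimensional ℝ V := FiniteDimensional.of_finrank_pos (by omega)
  obtain ⟨hc, X, fX, hXmem, hX⟩ := h.exists_isModular hV
  have hfin := A.finite_hyperplanes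
  let Vert := {H // H ∈ A.hyperplanes ∧ X ≤ H}
  let ι := {H // H ∈ A.hyperplanes ∧ ¬ X ≤ H}
  have : Finite Vert := (hfin.subset fun H hH => hH.1).to_subtype
  have : Finite ι := (hfin.subset fun H hH => hH.1).to_subtype
  have : Fintype Vert := Fintype.ofFinite _
  have : Fintype ι := Fintype.ofFinite _
  have hι : Nonempty ι := by
    by_contra hno
    have : X ≤ A.center := le_sInf fun H hH => by
      by_contra hle
      exact hno ⟨H, hH, hle⟩
    rw [hc, le_bot_iff] at this
    rw [this, finrank_bot] at fX
    omega
  have hVert : 2 ≤ Fintype.card Vert := by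
    obtain ⟨T, hT, hTX⟩ := hXmem
    rw [Nat.succ_le_iff, Fintype.one_lt_card_iff]
    by_contra hno
    push Not at hno
    rcases T.eq_empty_or_nonempty with rfl | ⟨H, hH⟩
    · rw [sInf_empty] at hTX
      rw [hTX, finrank_top] at fX
      omega
    · have h3 : T = {H} := Set.eq_singleton_iff_unique_mem.2 ⟨hH, fun H' hH' =>
        congrArg Subtype.val (hno ⟨H', hT hH', hTX ▸ sInf_le hH'⟩ ⟨H, hT hH, hTX ▸ sInf_le hH⟩)⟩
      rw [h3, sInf_singleton] at hTX
      have := A.finrank_hyperplane hV (hT hH)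
      rw [← hTX] at this
      omega
  let e : Fin (Fintype.card Vert) ≃ Vert := (Fintype.equivFin Vert).symm
  let P : Fin (Fintype.card Vert) ⊕ ι → Submodule ℝ V := Sum.elim (fun k => (e k).1) Subtype.val
  have hinf : ∀ s t, s ≠ t → P (.inl s) ⊓ P (.inl t) = X := by
    intro s t hst
    refine (Submodule.eq_of_le_of_finrank_eq (le_inf (e s).2.2 (e t).2.2) ?_).symm
    rw [fX]
    exact (A.finrank_inf_hyperplane hV (e s).2.1 (e t).2.1 fun h =>
      hst (e.injective (Subtype.ext h))).symm
  refine ⟨Fintype.card Vert, ι, inferInstance, hι, ⟨P, ?_, ?_, ?_, ?_, ?_⟩, hVert⟩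
  · rintro (k | i) (l | j) hkl
    · rw [e.injective (Subtype.ext hkl)]
    · have hkl' : (e k).1 = j.1 := hkl
      exact absurd (hkl' ▸ (e k).2.2) j.2.2
    · have hkl' : i.1 = (e l).1 := hkl
      exact absurd (hkl' ▸ (e l).2.2) i.2.2
    · rw [Subtype.ext (a1 := i) (a2 := j) hkl]
  · apply Set.Subset.antisymm
    · rintro _ ⟨k | i, rfl⟩
      · exact (e k).2.1
      · exact i.2.1
    · intro H hH
      by_cases hle : X ≤ H
      · refine ⟨.inl (e.symm ⟨H, hH, hle⟩), ?_⟩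
        change (e (e.symm _)).1 = H
        rw [e.apply_symm_apply]
      · exact ⟨.inr ⟨H, hH, hle⟩, rfl⟩
  · intro s t u hst
    rw [hinf s t hst]
    exact (e u).2.2
  · intro s t i hst
    rw [hinf s t hst]
    exact i.2.2
  · intro i j hij
    -- The sum of two lines is not the whole space, so by modularity it lies in a plane of A, which
    -- is vertical because it contains X.
    obtain ⟨T, hT, hTX⟩ := hX (i.1 ⊓ j.1) (A.inf_mem_intersections
      (A.hyperplane_mem_intersections i.2.1) (A.hyperplane_mem_intersections j.2.1))
    rcases T.eq_empty_or_nonempty with rfl | ⟨H, hH⟩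
    · exfalso
      have h1 := Submodule.finrank_add_le_finrank_add_finrank X (i.1 ⊓ j.1)
      rw [hTX, sInf_empty, finrank_top, fX,
        A.finrank_inf_hyperplane hV i.2.1 j.2.1 fun h => hij (Subtype.ext h)] at h1
      omega
    · have hle : X ⊔ i.1 ⊓ j.1 ≤ H := hTX ▸ sInf_le hH
      refine ⟨e.symm ⟨H, hT hH, le_sup_left.trans hle⟩, ?_⟩
      change _ ≤ (e (e.symm _)).1
      rw [e.apply_symm_apply]
      exact le_sup_right.trans hle

end Supersolvable

/-! ### Fans of irreducible arrangements -/

section Fan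

/-- The fan of an irreducible arrangement has at least three vertical planes and two graphs. -/
theorem Fan.three_le_of_isIrreducible {n : ℕ} {ι : Type*} [Fintype ι] [Nonempty ι]
    (S : Fan A n ι) (hn : 2 ≤ n) (hA : A.IsIrreducible) : 3 ≤ n ∧ 2 ≤ Fintype.card ι := by
  have hV := S.finrank_eq_three
  constructor
  · by_contra hlt
    obtain rfl : n = 2 := by omega
    -- With two vertical planes, all graphs meet over one of them in a common line, which only the
    -- other vertical plane avoids.
    obtain ⟨t, ht⟩ := S.sortSystem.exists_forall_eq_of_le_two le_rfl
    obtain ⟨i0⟩ := ‹Nonempty ι›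
    refine hA (isReducible_of_forall_mem hV (S.ker_U_mem (t + 1))
      (p := S.point (S.α t) (S.height i0 (S.α t))) ?_ fun H hH => ?_)
    · rw [S.point_mem_U (by omega) (by omega)]
      omega
    · rcases (S.mem_iff H).1 hH with ⟨s, rfl⟩ | ⟨i, rfl⟩
      · obtain ⟨k, hk⟩ := S.exists_ker_U_eq (t - 1) s
        have hk' := k.2
        rw [show LinearMap.ker (verticalForm S.Φ (S.α s)) = _ from hk]
        rcases (show (k : ℕ) = 0 ∨ (k : ℕ) = 1 by omega) with h | h
        · right
          rw [S.point_mem_U (by omega) (by omega)]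
          omega
        · left
          rw [h, show t - 1 + (1 : ℕ) + 1 = t + 1 by push_cast; ring]
      · exact Or.inr ((S.point_mem_G t i0 i).2 (ht i0 i))
  · by_contra hlt
    have hsub : Subsingleton ι := Fintype.card_le_one_iff_subsingleton.1 (by omega)
    obtain ⟨i0⟩ := ‹Nonempty ι›
    refine hA (isReducible_of_forall_mem hV (S.ker_G_mem i0) (S.vertex_G i0) fun H hH => ?_)
    rcases (S.mem_iff H).1 hH with ⟨s, rfl⟩ | ⟨i, rfl⟩
    · exact Or.inr (S.vertex_U s)
    · rw [Subsingleton.elim i i0]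
      exact Or.inl rfl

/-- Three graphs meeting over a vertical plane contain a common line. -/
theorem Fan.ker_G_inf_le {n : ℕ} {ι : Type*} (S : Fan A n ι) {t : ℤ} {i j k : ι} (hij : i ≠ j)
    (h1 : S.height i (S.α t) = S.height j (S.α t)) (h2 : S.height j (S.α t) = S.height k (S.α t)) :
    LinearMap.ker (S.G i) ⊓ LinearMap.ker (S.G j) ≤ LinearMap.ker (S.G k) := by
  rw [inf_le_iff_mem S.finrank_eq_three (S.ker_G_mem i) (S.ker_G_mem j) (S.ker_G_injective.ne hij)
    (S.point_ne_zero _ _) ((S.point_mem_G t i i).2 rfl) ((S.point_mem_G t i j).2 h1)]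
  exact (S.point_mem_G t i k).2 (h1.trans h2)

end Fan

end HyperplaneArrangement

namespace HyperplaneArrangement

open Module Real

/-! ### The models A(2n,1) and A(4m+1,1) -/

section Models

theorem mem_perp {a p : Fin 3 → ℝ} : p ∈ perp a ↔ a 0 * p 0 + a 1 * p 1 + a 2 * p 2 = 0 := by
  simp [perp, form, Fin.sum_univ_three]

/-- The planes of `A(2n,1)` containing the last coordinate axis. -/
noncomputable def verticalPlane (n k : ℕ) : Submodule ℝ (Fin 3 → ℝ) := perp ![-s n k, c n k, 0]

/-- The planes of `A(2n,1)` not containing the last coordinate axis. -/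
noncomputable def obliquePlane (n i : ℕ) : Submodule ℝ (Fin 3 → ℝ) :=
  perp ![c n (2 * i + 1), s n (2 * i + 1), 1]

theorem mem_verticalPlane {n k : ℕ} {p : Fin 3 → ℝ} :
    p ∈ verticalPlane n k ↔ -s n k * p 0 + c n k * p 1 = 0 := by
  simp [verticalPlane, mem_perp]

theorem mem_obliquePlane {n i : ℕ} {p : Fin 3 → ℝ} :
    p ∈ obliquePlane n i ↔ c n (2 * i + 1) * p 0 + s n (2 * i + 1) * p 1 + p 2 = 0 := by
  simp [obliquePlane, mem_perp]

theorem sin_sub_ne_zero {n k l : ℕ} (hk : k < n) (hl : l < n) (h : k ≠ l) :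
    sin (2 * π * k / (2 * n) - 2 * π * l / (2 * n)) ≠ 0 := by
  have hn : (0 : ℝ) < n := by exact_mod_cast (by omega : 0 < n)
  have hk' : (k : ℝ) < n := by exact_mod_cast hk
  have hl' : (l : ℝ) < n := by exact_mod_cast hl
  have h0 : ((k : ℝ) - l) ≠ 0 := sub_ne_zero.2 (by exact_mod_cast h)
  have e : 2 * π * k / (2 * n) - 2 * π * l / (2 * n) = π * (((k : ℝ) - l) / n) := by
    field_simp
  have hk0 : (0 : ℝ) ≤ k := k.cast_nonneg
  have hl0 : (0 : ℝ) ≤ l := l.cast_nonneg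
  have h1 : ((k : ℝ) - l) / n < 1 := by rw [div_lt_one hn]; linarith
  have h2 : -1 < ((k : ℝ) - l) / n := by rw [lt_div_iff₀ hn]; linarith
  rw [e, Ne, sin_eq_zero_iff_of_lt_of_lt (by nlinarith [pi_pos]) (by nlinarith [pi_pos])]
  exact mul_ne_zero pi_ne_zero (div_ne_zero h0 hn.ne')

theorem verticalPlane_mod {n : ℕ} (hn : 0 < n) (k : ℕ) :
    verticalPlane n (k % n) = verticalPlane n k := by
  have hn' : (n : ℝ) ≠ 0 := by exact_mod_cast hn.ne'
  have e : 2 * π * k / (2 * n) = 2 * π * (k % n : ℕ) / (2 * n) + (k / n : ℕ) * π := by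
    have h : (k : ℝ) = (k % n : ℕ) + n * (k / n : ℕ) := by exact_mod_cast (Nat.mod_add_div k n).symm
    rw [h]
    field_simp
  ext p
  rw [mem_verticalPlane, mem_verticalPlane, s, c, s, c, e, sin_add_nat_mul_pi, cos_add_nat_mul_pi,
    show -((-1) ^ (k / n) * sin (2 * π * (k % n : ℕ) / (2 * n))) * p 0 +
      (-1) ^ (k / n) * cos (2 * π * (k % n : ℕ) / (2 * n)) * p 1 =
      (-1) ^ (k / n) * (-sin (2 * π * (k % n : ℕ) / (2 * n)) * p 0 +
        cos (2 * π * (k % n : ℕ) / (2 * n)) * p 1) by ring,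
    mul_eq_zero, or_iff_right (pow_ne_zero _ (by norm_num))]

theorem axis_mem_verticalPlane (n k : ℕ) : ![0, 0, 1] ∈ verticalPlane n k := by
  simp [mem_verticalPlane]

theorem axis_notMem_obliquePlane (n i : ℕ) : ![0, 0, 1] ∉ obliquePlane n i := by
  simp [mem_obliquePlane]

theorem axis_notMem_perp : ![0, 0, 1] ∉ perp ![0, 0, 1] := by
  simp [mem_perp]

theorem eq_zero_of_mem_verticalPlane {n k l : ℕ} (hk : k < n) (hl : l < n) (h : k ≠ l)
    {p : Fin 3 → ℝ} (h1 : p ∈ verticalPlane n k) (h2 : p ∈ verticalPlane n l) :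
    p 0 = 0 ∧ p 1 = 0 := by
  have hs := sin_sub_ne_zero hk hl h
  rw [mem_verticalPlane, s, c] at h1 h2
  rw [sin_sub] at hs
  constructor
  · refine (mul_eq_zero.1 ?_).resolve_left hs
    linear_combination -cos (2 * π * l / (2 * n)) * h1 + cos (2 * π * k / (2 * n)) * h2
  · refine (mul_eq_zero.1 ?_).resolve_left hs
    linear_combination -sin (2 * π * l / (2 * n)) * h1 + sin (2 * π * k / (2 * n)) * h2

theorem verticalPlane_injOn {n k l : ℕ} (hk : k < n) (hl : l < n)
    (h : verticalPlane n k = verticalPlane n l) : k = l := by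
  by_contra hne
  have h1 : ![c n k, s n k, 0] ∈ verticalPlane n k := by
    rw [mem_verticalPlane]
    simp only [Matrix.cons_val_zero, Matrix.cons_val_one]
    ring
  obtain ⟨h2, h3⟩ := eq_zero_of_mem_verticalPlane hk hl hne h1 (h ▸ h1)
  have h4 := sin_sq_add_cos_sq (2 * π * k / (2 * n))
  have h2' : cos (2 * π * k / (2 * n)) = 0 := h2
  have h3' : sin (2 * π * k / (2 * n)) = 0 := h3
  rw [h2', h3'] at h4
  norm_num at h4

theorem obliquePlane_injOn {n i j : ℕ} (hi : i < n) (hj : j < n)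
    (h : obliquePlane n i = obliquePlane n j) : i = j := by
  have h1 : ![c n (2 * i + 1), s n (2 * i + 1), -1] ∈ obliquePlane n i := by
    rw [mem_obliquePlane]
    simp only [Matrix.cons_val_zero, Matrix.cons_val_one, Matrix.cons_val_two, Matrix.tail_cons,
      Matrix.head_cons, s, c]
    linear_combination sin_sq_add_cos_sq (2 * π * (2 * i + 1 : ℕ) / (2 * n))
  rw [h, mem_obliquePlane] at h1
  simp only [Matrix.cons_val_zero, Matrix.cons_val_one, Matrix.cons_val_two, Matrix.tail_cons,
      Matrix.head_cons, s, c] at h1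
  have hn : (0 : ℝ) < n := by exact_mod_cast (by omega : 0 < n)
  by_contra hne
  have hs := sin_sub_ne_zero hi hj hne
  have e : 2 * π * (2 * j + 1 : ℕ) / (2 * n) - 2 * π * (2 * i + 1 : ℕ) / (2 * n) =
      -(2 * (2 * π * i / (2 * n) - 2 * π * j / (2 * n))) := by
    push_cast
    field_simp
    ring
  have h2 : cos (2 * π * (2 * j + 1 : ℕ) / (2 * n) - 2 * π * (2 * i + 1 : ℕ) / (2 * n)) = 1 := by
    rw [cos_sub]
    linarith
  rw [e, cos_neg, cos_two_mul] at h2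
  have h3 := sin_sq_add_cos_sq (2 * π * i / (2 * n) - 2 * π * j / (2 * n))
  exact hs (pow_eq_zero_iff two_ne_zero |>.1 (by linarith))

/-- Two oblique planes are exchanged by the reflection in the bisector of their directions, of
indices 2i + 1 and 2j + 1; the bisector has index i + j + 1. -/
theorem obliquePlane_inf_le {n i j : ℕ} (hi : i < n) (hj : j < n) (hij : i ≠ j) :
    obliquePlane n i ⊓ obliquePlane n j ≤ verticalPlane n ((i + j + 1) % n) := by
  rintro p ⟨h1, h2⟩
  rw [verticalPlane_mod (by omega), mem_verticalPlane]
  replace h1 := mem_obliquePlane.1 h1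
  replace h2 := mem_obliquePlane.1 h2
  have hn : (n : ℝ) ≠ 0 := by exact_mod_cast (by omega : n ≠ 0)
  have hs := sin_sub_ne_zero hi hj hij
  have e1 : (2 * π * (2 * i + 1 : ℕ) / (2 * n) + 2 * π * (2 * j + 1 : ℕ) / (2 * n)) / 2 =
      2 * π * (i + j + 1 : ℕ) / (2 * n) := by
    push_cast
    field_simp
    ring
  have e2 : (2 * π * (2 * i + 1 : ℕ) / (2 * n) - 2 * π * (2 * j + 1 : ℕ) / (2 * n)) / 2 =
      2 * π * i / (2 * n) - 2 * π * j / (2 * n) := by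
    push_cast
    field_simp
    ring
  have e3 := cos_sub_cos (2 * π * (2 * i + 1 : ℕ) / (2 * n)) (2 * π * (2 * j + 1 : ℕ) / (2 * n))
  have e4 := sin_sub_sin (2 * π * (2 * i + 1 : ℕ) / (2 * n)) (2 * π * (2 * j + 1 : ℕ) / (2 * n))
  rw [e1, e2] at e3 e4
  simp only [s, c] at h1 h2 ⊢
  refine (mul_eq_zero.1 ?_).resolve_left hs
  linear_combination (1 / 2) * (h1 - h2) - (p 0 / 2) * e3 - (p 1 / 2) * e4

/-- At height zero an oblique plane meets the horizontal one perpendicularly to its direction; a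
right angle is m index steps. -/
theorem perp_inf_obliquePlane_le {m i : ℕ} (hm : 0 < m) :
    perp ![0, 0, 1] ⊓ obliquePlane (2 * m) i ≤
      verticalPlane (2 * m) ((2 * i + 1 + m) % (2 * m)) := by
  rintro p ⟨h1, h2⟩
  rw [verticalPlane_mod (by omega), mem_verticalPlane]
  replace h1 := mem_perp.1 h1
  replace h2 := mem_obliquePlane.1 h2
  have hm' : (m : ℝ) ≠ 0 := by exact_mod_cast hm.ne'
  have e : 2 * π * (2 * i + 1 + m : ℕ) / (2 * (2 * m : ℕ)) =
      2 * π * (2 * i + 1 : ℕ) / (2 * (2 * m : ℕ)) + π / 2 := by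
    push_cast
    field_simp
  simp only [Matrix.cons_val_zero, Matrix.cons_val_one, Matrix.cons_val_two, Matrix.tail_cons,
      Matrix.head_cons] at h1
  rw [s, c, e, sin_add_pi_div_two, cos_add_pi_div_two]
  rw [s, c] at h2
  linear_combination h1 - h2

/-- The hyperplanes of `A(2n,1)` containing the last coordinate axis and the other ones. -/
noncomputable def modularLineA2n {n : ℕ} (hn : 0 < n) : ModularLine (A2n n) n (Fin n) where
  P := Sum.elim (fun k => verticalPlane n k) fun i => obliquePlane n i
  injective := by
    rintro (k | i) (l | j) h
    · rw [Fin.ext (verticalPlane_injOn k.2 l.2 h)]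
    · have h' : verticalPlane n k = obliquePlane n j := h
      exact absurd (h' ▸ axis_mem_verticalPlane n k) (axis_notMem_obliquePlane n j)
    · have h' : obliquePlane n i = verticalPlane n l := h
      exact absurd (h' ▸ axis_mem_verticalPlane n l) (axis_notMem_obliquePlane n i)
    · rw [Fin.ext (obliquePlane_injOn i.2 j.2 h)]
  range_eq := by
    rw [Set.Sum.elim_range]
    apply congrArg₂
    · ext H
      exact ⟨fun ⟨k, hk⟩ => ⟨k, k.2, hk⟩, fun ⟨k, hk, hk'⟩ => ⟨⟨k, hk⟩, hk'⟩⟩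
    · ext H
      exact ⟨fun ⟨k, hk⟩ => ⟨k, k.2, hk⟩, fun ⟨k, hk, hk'⟩ => ⟨⟨k, hk⟩, hk'⟩⟩
  inf_le u v w huv := by
    rintro p ⟨h1, h2⟩
    obtain ⟨h3, h4⟩ := eq_zero_of_mem_verticalPlane u.2 v.2 (Fin.val_ne_of_ne huv) h1 h2
    exact mem_verticalPlane.2 (by rw [h3, h4]; ring)
  not_inf_le u v i _ h := axis_notMem_obliquePlane n i
    (h ⟨axis_mem_verticalPlane n u, axis_mem_verticalPlane n v⟩)
  exists_inf_le i j hij := ⟨⟨(i + j + 1) % n, Nat.mod_lt _ hn⟩,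
    obliquePlane_inf_le i.2 j.2 (Fin.val_ne_of_ne hij)⟩

/-- The hyperplanes of `A(4m+1,1)` containing the last coordinate axis and the other ones. -/
noncomputable def modularLineA4m1 {m : ℕ} (hm : 0 < m) :
    ModularLine (A4m1 m) (2 * m) (Option (Fin (2 * m))) where
  P := Sum.elim (fun k => verticalPlane (2 * m) k)
    fun o => o.elim (perp ![0, 0, 1]) fun i => obliquePlane (2 * m) i
  injective := by
    have key : ∀ i, perp ![0, 0, 1] ≠ obliquePlane (2 * m) i := by
      intro i h
      have h1 : ![c (2 * m) (2 * i + 1), s (2 * m) (2 * i + 1), 0] ∈ perp ![0, 0, 1] := by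
        simp [mem_perp]
      rw [h, mem_obliquePlane] at h1
      simp only [Matrix.cons_val_zero, Matrix.cons_val_one, Matrix.cons_val_two, Matrix.tail_cons,
        Matrix.head_cons, s, c] at h1
      have h2 := sin_sq_add_cos_sq (2 * π * (2 * i + 1 : ℕ) / (2 * (2 * m : ℕ)))
      nlinarith
    rintro (k | _ | i) (l | _ | j) h
    · rw [Fin.ext (verticalPlane_injOn k.2 l.2 h)]
    · have h' : verticalPlane (2 * m) k = perp ![0, 0, 1] := h
      exact absurd (h' ▸ axis_mem_verticalPlane (2 * m) k) axis_notMem_perp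
    · have h' : verticalPlane (2 * m) k = obliquePlane (2 * m) j := h
      exact absurd (h' ▸ axis_mem_verticalPlane (2 * m) k) (axis_notMem_obliquePlane (2 * m) j)
    · have h' : perp ![0, 0, 1] = verticalPlane (2 * m) l := h
      exact absurd (h' ▸ axis_mem_verticalPlane (2 * m) l) axis_notMem_perp
    · rfl
    · exact absurd h (key j)
    · have h' : obliquePlane (2 * m) i = verticalPlane (2 * m) l := h
      exact absurd (h' ▸ axis_mem_verticalPlane (2 * m) l) (axis_notMem_obliquePlane (2 * m) i)
    · exact absurd h.symm (key i)
    · rw [Fin.ext (obliquePlane_injOn i.2 j.2 h)]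
  range_eq := by
    change _ = (A2n (2 * m)).hyperplanes ∪ {perp ![0, 0, 1]}
    rw [← (modularLineA2n (n := 2 * m) (by omega)).range_eq]
    ext H
    constructor
    · rintro ⟨k | _ | i, rfl⟩
      · exact Or.inl ⟨.inl k, rfl⟩
      · exact Or.inr rfl
      · exact Or.inl ⟨.inr i, rfl⟩
    · rintro (⟨k | i, rfl⟩ | rfl)
      · exact ⟨.inl k, rfl⟩
      · exact ⟨.inr (some i), rfl⟩
      · exact ⟨.inr none, rfl⟩
  inf_le := (modularLineA2n (n := 2 * m) (by omega)).inf_le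
  not_inf_le u v i huv h := by
    rcases i with _ | i
    · exact axis_notMem_perp (h ⟨axis_mem_verticalPlane _ u, axis_mem_verticalPlane _ v⟩)
    · exact axis_notMem_obliquePlane _ i
        (h ⟨axis_mem_verticalPlane _ u, axis_mem_verticalPlane _ v⟩)
  exists_inf_le i j hij := by
    rcases i with _ | i <;> rcases j with _ | j
    · exact absurd rfl hij
    · exact ⟨⟨_, Nat.mod_lt _ (by omega)⟩, perp_inf_obliquePlane_le hm⟩
    · refine ⟨⟨(2 * i + 1 + m) % (2 * m), Nat.mod_lt _ (by omega)⟩, ?_⟩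
      rw [inf_comm]
      exact perp_inf_obliquePlane_le hm
    · exact (modularLineA2n (n := 2 * m) (by omega)).exists_inf_le i j fun h => hij (by rw [h])

/-- A common line would lie over the vertical planes i + j + 1 and i + k + 1, which differ modulo n,
so it would be the axis, which no oblique plane contains. -/
theorem not_obliquePlane_inf_le {n : ℕ} {i j k : Fin n} (hij : i ≠ j) (hik : i ≠ k) (hjk : j ≠ k) :
    ¬ obliquePlane n i ⊓ obliquePlane n j ≤ obliquePlane n k := by
  intro h
  have hn : 0 < n := by have := i.2; omega
  let M := modularLineA2n hn
  have hV : finrank ℝ (Fin 3 → ℝ) = 3 := by simp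
  have hfin := (A2n n).finrank_inf_hyperplane hV (M.mem (.inr i)) (M.mem (.inr j))
    (M.injective.ne (by simpa using hij))
  let u : Fin n := ⟨(i + j + 1) % n, Nat.mod_lt _ hn⟩
  let v : Fin n := ⟨(i + k + 1) % n, Nat.mod_lt _ hn⟩
  have huv : u ≠ v := by
    intro e
    have e1 : (i + j + 1 : ℕ) ≡ i + k + 1 [MOD n] := congrArg Fin.val e
    have e2 := (Nat.ModEq.add_right_cancel' 1 e1).add_left_cancel' _
    exact hjk (Fin.ext (e2.eq_of_lt_of_lt j.2 k.2))
  have h1 := obliquePlane_inf_le i.2 j.2 (Fin.val_ne_of_ne hij)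
  have h2 := (le_inf inf_le_left h).trans (obliquePlane_inf_le i.2 k.2 (Fin.val_ne_of_ne hik))
  have hbot := (A2n n).inf_inf_eq_bot_of_not_le hV (M.mem (.inl u)) (M.mem (.inl v))
    (M.injective.ne (by simpa using huv)) (M.not_inf_le u v i huv)
  have h3 : M.P (.inr i) ⊓ M.P (.inr j) ≤ ⊥ := hbot ▸ le_inf (le_inf h1 h2) inf_le_left
  rw [le_bot_iff.1 h3, finrank_bot] at hfin
  omega

end Models

/-! ### Identification with the models -/

section Main

variable {V : Type*} [AddCommGroup V] [Module ℝ V] {A : HyperplaneArrangement ℝ V}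

theorem ModularLine.exists_of_latticeEquivalent (hV : finrank ℝ V = 3) {W : Type*} [AddCommGroup W]
    [Module ℝ W] (hW : finrank ℝ W = 3) {B : HyperplaneArrangement ℝ W} {n : ℕ} {ι : Type*}
    (M : ModularLine B n ι) (h : A.LatticeEquivalent B) :
    ∃ M' : ModularLine A n ι, ∀ x y z, M'.P x ⊓ M'.P y ≤ M'.P z ↔ M.P x ⊓ M.P y ≤ M.P z := by
  obtain ⟨P, hP, hPA, hi⟩ := h.exists_incidence hV hW M.injective M.range_eq
  refine ⟨⟨P, hP, hPA, ?_, ?_, ?_⟩, hi⟩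
  · intro s t u hst
    exact (hi _ _ _).2 (M.inf_le s t u hst)
  · intro s t i hst
    exact (hi _ _ _).not.2 (M.not_inf_le s t i hst)
  · intro i j hij
    obtain ⟨t, ht⟩ := M.exists_inf_le i j hij
    exact ⟨t, (hi _ _ _).2 ht⟩

theorem ModularLine.ncard_eq {n : ℕ} {ι : Type*} [Fintype ι] (M : ModularLine A n ι) :
    A.hyperplanes.ncard = n + Fintype.card ι := by
  rw [← M.range_eq, ← Set.image_univ, Set.ncard_image_of_injective _ M.injective, Set.ncard_univ,
    Nat.card_eq_fintype_card, Fintype.card_sum, Fintype.card_fin]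

theorem ModularLine.isSimplicial_of_no_triple [TopologicalSpace V] [IsTopologicalAddGroup V]
    [ContinuousSMul ℝ V] [T2Space V] (hV : finrank ℝ V = 3) {n : ℕ} {ι : Type*} [Fintype ι]
    (M : ModularLine A n ι) (hn : 2 ≤ n) (hcard : Fintype.card ι = n)
    (h : ∀ i j k, i ≠ j → i ≠ k → j ≠ k →
      ¬ M.P (.inr i) ⊓ M.P (.inr j) ≤ M.P (.inr k)) : A.IsSimplicial := by
  have : Nonempty ι := Fintype.card_pos_iff.1 (by omega)
  obtain ⟨S, hS⟩ := M.exists_fan hV hn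
  refine S.isSimplicial_of_neighboursMeet hn
    (S.sortSystem.neighboursMeet_of_no_triple hn hcard fun t i j k hij hik hjk h1 h2 => ?_)
  have := S.ker_G_inf_le (t := t) hij h1 h2
  rw [hS, hS, hS] at this
  exact h i j k hij hik hjk this

theorem ModularLine.isSimplicial_of_no_triple_of_ne [TopologicalSpace V] [IsTopologicalAddGroup V]
    [ContinuousSMul ℝ V] [T2Space V] (hV : finrank ℝ V = 3) {n : ℕ} {ι : Type*} [Fintype ι]
    (M : ModularLine A n ι) (hn : 2 ≤ n) (hcard : Fintype.card ι = n + 1) (o : ι)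
    (h : ∀ i j k, i ≠ o → j ≠ o → k ≠ o → i ≠ j → i ≠ k → j ≠ k →
      ¬ M.P (.inr i) ⊓ M.P (.inr j) ≤ M.P (.inr k)) : A.IsSimplicial := by
  have : Nonempty ι := ⟨o⟩
  obtain ⟨S, hS⟩ := M.exists_fan hV hn
  refine S.isSimplicial_of_neighboursMeet hn (S.sortSystem.neighboursMeet_of_no_triple_of_ne hn
    hcard o fun t i j k hi hj hk hij hik hjk h1 h2 => ?_)
  have := S.ker_G_inf_le (t := t) hij h1 h2
  rw [hS, hS, hS] at this
  exact h i j k hi hj hk hij hik hjk this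

theorem isIrreducible_and_of_latticeEquivalent_A2n [TopologicalSpace V] [IsTopologicalAddGroup V]
    [ContinuousSMul ℝ V] [T2Space V] (hV : finrank ℝ V = 3) {n : ℕ} (hn : 3 ≤ n)
    (h : A.LatticeEquivalent (A2n n)) :
    A.IsIrreducible ∧ A.IsSupersolvable ∧ A.IsSimplicial := by
  obtain ⟨M, hM⟩ := (modularLineA2n (n := n) (by omega)).exists_of_latticeEquivalent hV
    (by simp) h
  have : Nontrivial (Fin n) := Fin.nontrivial_iff_two_le.2 (by omega)
  refine ⟨M.isIrreducible hV hn this, M.isSupersolvable hV (by omega),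
    M.isSimplicial_of_no_triple hV (by omega) (by simp) fun i j k hij hik hjk => ?_⟩
  rw [hM]
  exact not_obliquePlane_inf_le hij hik hjk

theorem isIrreducible_and_of_latticeEquivalent_A4m1 [TopologicalSpace V] [IsTopologicalAddGroup V]
    [ContinuousSMul ℝ V] [T2Space V] (hV : finrank ℝ V = 3) {m : ℕ} (hm : 2 ≤ m)
    (h : A.LatticeEquivalent (A4m1 m)) :
    A.IsIrreducible ∧ A.IsSupersolvable ∧ A.IsSimplicial := by
  obtain ⟨M, hM⟩ := (modularLineA4m1 (m := m) (by omega)).exists_of_latticeEquivalent hV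
    (by simp) h
  have : Nonempty (Fin (2 * m)) := ⟨⟨0, by omega⟩⟩
  refine ⟨M.isIrreducible hV (by omega) inferInstance, M.isSupersolvable hV (by omega),
    M.isSimplicial_of_no_triple_of_ne hV (by omega) (by simp) none ?_⟩
  rintro (_ | i) (_ | j) (_ | k) hi hj hk hij hik hjk
  any_goals contradiction
  rw [hM]
  exact not_obliquePlane_inf_le (fun e => hij (by rw [e])) (fun e => hik (by rw [e]))
    (fun e => hjk (by rw [e]))

theorem LatticeEquivalent.refl (A : HyperplaneArrangement ℝ V) : A.LatticeEquivalent A :=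
  ⟨OrderIso.refl _⟩

/-- The model is simplicial by the counting criterion, being lattice equivalent to itself. A middle
would put three oblique planes through one line. -/
theorem exists_fan_A2n {n : ℕ} (hn : 3 ≤ n) :
    ∃ S : Fan (A2n n) n (Fin n), S.sortSystem.NeighboursMeet ∧ ¬ S.sortSystem.HasMiddle := by
  have : Nonempty (Fin n) := ⟨⟨0, by omega⟩⟩
  obtain ⟨S, hS⟩ := (modularLineA2n (n := n) (by omega)).exists_fan (by simp) (by omega)
  have hmeet := S.neighboursMeet_of_isSimplicial (by omega)
    (isIrreducible_and_of_latticeEquivalent_A2n (by simp) hn (LatticeEquivalent.refl _)).2.2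
  refine ⟨S, hmeet, fun hmid => ?_⟩
  obtain ⟨t, i, j, k, hij, hik, hjk, h1, h2⟩ := hmeet.exists_triple (by omega) hmid
  have := S.ker_G_inf_le (t := t) hij h1 h2
  rw [hS, hS, hS] at this
  exact not_obliquePlane_inf_le hij hik hjk this

theorem exists_fan_A4m1 {m : ℕ} (hm : 2 ≤ m) :
    ∃ S : Fan (A4m1 m) (2 * m) (Option (Fin (2 * m))),
      S.sortSystem.NeighboursMeet ∧ S.sortSystem.HasMiddle := by
  obtain ⟨S, hS⟩ := (modularLineA4m1 (m := m) (by omega)).exists_fan (by simp) (by omega)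
  have hmeet := S.neighboursMeet_of_isSimplicial (by omega)
    (isIrreducible_and_of_latticeEquivalent_A4m1 (by simp) hm (LatticeEquivalent.refl _)).2.2
  refine ⟨S, hmeet, ?_⟩
  -- Without a middle, the classification would identify this system with that of A(2(2m + 1),1),
  -- which also has 2m + 1 graphs, and force 2m = 2m + 1.
  by_contra hmid
  obtain ⟨T, hT, hTmid⟩ := exists_fan_A2n (n := 2 * m + 1) (by omega)
  have := (hmeet.exists_equiv (by omega) hT (by omega) (by simp; omega) (by simp)
    (iff_of_false hmid hTmid)).1
  omega

/-- Fans of the same size and type belong to lattice equivalent arrangements. -/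
theorem Fan.latticeEquivalent_of_hasMiddle_iff {W : Type*} [AddCommGroup W] [Module ℝ W]
    {B : HyperplaneArrangement ℝ W} {n n' : ℕ} {ι ι' : Type*} [Fintype ι] [Fintype ι']
    {S : Fan A n ι} {T : Fan B n' ι'} (hS : S.sortSystem.NeighboursMeet)
    (hT : T.sortSystem.NeighboursMeet) (hn : 3 ≤ n) (hn' : 3 ≤ n') (hι : 2 ≤ Fintype.card ι)
    (hcard : Fintype.card ι = Fintype.card ι')
    (hm : S.sortSystem.HasMiddle ↔ T.sortSystem.HasMiddle) : A.LatticeEquivalent B := by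
  obtain ⟨rfl, g, s, h⟩ := hS.exists_equiv hn hT hn' hι hcard hm
  refine S.latticeEquivalent T g s 0 fun t i j => ?_
  rw [zero_add]
  exact h t i j

theorem exists_latticeEquivalent [TopologicalSpace V] [IsTopologicalAddGroup V]
    [ContinuousSMul ℝ V] [T2Space V] (hV : finrank ℝ V = 3) (hirr : A.IsIrreducible)
    (hss : A.IsSupersolvable) (hsimp : A.IsSimplicial) :
    ∃ B ∈ R1 ∪ R2, A.LatticeEquivalent B := by
  obtain ⟨n, ι, _, _, M, hn⟩ := hss.exists_modularLine hV
  obtain ⟨S, -⟩ := M.exists_fan hV hn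
  obtain ⟨hn3, hι⟩ := S.three_le_of_isIrreducible hn hirr
  have hmeet := S.neighboursMeet_of_isSimplicial hn hsimp
  by_cases hmid : S.sortSystem.HasMiddle
  · obtain ⟨m, hm, hcard⟩ := hmeet.exists_card_eq_of_hasMiddle hn3 hmid
    obtain ⟨T, hT, hTmid⟩ := exists_fan_A4m1 hm
    exact ⟨_, Or.inr ⟨m, hm, rfl⟩, Fan.latticeEquivalent_of_hasMiddle_iff hmeet hT hn3 (by omega)
      hι (by simp [hcard]) (iff_of_true hmid hTmid)⟩
  -- The model is chosen by the number of graphs; that the numbers of vertical planes agree is part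
  -- of the classification.
  · have h3 := hmeet.three_le_card hn3 hι
    obtain ⟨T, hT, hTmid⟩ := exists_fan_A2n h3
    exact ⟨_, Or.inl ⟨_, h3, rfl⟩, Fan.latticeEquivalent_of_hasMiddle_iff hmeet hT hn3 h3
      hι (by simp) (iff_of_false hmid hTmid)⟩

theorem ncard_of_latticeEquivalent_A2n (hV : finrank ℝ V = 3) {n : ℕ} (hn : 3 ≤ n)
    (h : A.LatticeEquivalent (A2n n)) : A.hyperplanes.ncard = 2 * n := by
  obtain ⟨M, -⟩ := (modularLineA2n (n := n) (by omega)).exists_of_latticeEquivalent hV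
    (by simp) h
  rw [M.ncard_eq, Fintype.card_fin]
  omega

theorem ncard_of_latticeEquivalent_A4m1 (hV : finrank ℝ V = 3) {m : ℕ} (hm : 2 ≤ m)
    (h : A.LatticeEquivalent (A4m1 m)) : A.hyperplanes.ncard = 4 * m + 1 := by
  obtain ⟨M, -⟩ := (modularLineA4m1 (m := m) (by omega)).exists_of_latticeEquivalent hV
    (by simp) h
  rw [M.ncard_eq, Fintype.card_option, Fintype.card_fin]
  omega

/-- The number of planes is a lattice invariant, even for the first series and odd for the second,
and injective on each. -/
theorem eq_of_latticeEquivalent (hV : finrank ℝ V = 3) {B B' : HyperplaneArrangement ℝ (Fin 3 → ℝ)}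
    (hB : B ∈ R1 ∪ R2) (hB' : B' ∈ R1 ∪ R2) (h : A.LatticeEquivalent B)
    (h' : A.LatticeEquivalent B') : B = B' := by
  rcases hB with ⟨n, hn, rfl⟩ | ⟨m, hm, rfl⟩ <;> rcases hB' with ⟨n', hn', rfl⟩ | ⟨m', hm', rfl⟩
  · have h1 := ncard_of_latticeEquivalent_A2n hV hn h
    have h2 := ncard_of_latticeEquivalent_A2n hV hn' h'
    rw [show n = n' by omega]
  · have h1 := ncard_of_latticeEquivalent_A2n hV hn h
    have h2 := ncard_of_latticeEquivalent_A4m1 hV hm' h'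
    omega
  · have h1 := ncard_of_latticeEquivalent_A4m1 hV hm h
    have h2 := ncard_of_latticeEquivalent_A2n hV hn' h'
    omega
  · have h1 := ncard_of_latticeEquivalent_A4m1 hV hm h
    have h2 := ncard_of_latticeEquivalent_A4m1 hV hm' h'
    rw [show m = m' by omega]

end Main

end HyperplaneArrangement

theorem mainTheorem2 {V : Type*} [AddCommGroup V] [Module ℝ V] [TopologicalSpace V]
    [IsTopologicalAddGroup V] [ContinuousSMul ℝ V] [T2Space V]
    (hV : Module.finrank ℝ V = 3) (A : HyperplaneArrangement ℝ V) :
    (A.IsIrreducible ∧ A.IsSupersolvable ∧ A.IsSimplicial →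
      ∃! B : HyperplaneArrangement ℝ (Fin 3 → ℝ),
        B ∈ HyperplaneArrangement.R1 ∪ HyperplaneArrangement.R2 ∧ A.LatticeEquivalent B) ∧
    ((∃ B ∈ HyperplaneArrangement.R1 ∪ HyperplaneArrangement.R2, A.LatticeEquivalent B) →
      A.IsIrreducible ∧ A.IsSupersolvable ∧ A.IsSimplicial) := by
  constructor
  · rintro ⟨hirr, hss, hsimp⟩
    obtain ⟨B, hB, hAB⟩ := HyperplaneArrangement.exists_latticeEquivalent hV hirr hss hsimp
    exact ⟨B, ⟨hB, hAB⟩, fun B' hB' =>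
      HyperplaneArrangement.eq_of_latticeEquivalent hV hB'.1 hB hB'.2 hAB⟩
  · rintro ⟨B, ⟨n, hn, rfl⟩ | ⟨m, hm, rfl⟩, h⟩
    · exact HyperplaneArrangement.isIrreducible_and_of_latticeEquivalent_A2n hV hn h
    · exact HyperplaneArrangement.isIrreducible_and_of_latticeEquivalent_A4m1 hV hm h
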